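/- Let $X$ be a finite connected CW complex of dimension $d\ge 1$, let $X_j$ be its set of $j$-cells and $X^{(j)}$ its $j$-skeleton, and let $r\colon X_d\to(0,\infty)$ be a function, $b\mapsto r_b$ (the resistances). Give the real cellular chain groups $C_j(X;\mathbb R)$ the standard inner product $\langle\ ,\ \rangle$, for which the $j$-cells form an orthonormal basis. Let $R\colon C_d(X;\mathbb R)\to C_d(X;\mathbb R)$ be the linear map with $Rb=r_b b$ for each $d$-cell $b$, and let $\partial_R^*\colon C_{d-1}(X;\mathbb R)\to C_d(X;\mathbb R)$ be the adjoint of the boundary operator $\partial\colon C_d(X;\mathbb R)\to C_{d-1}(X;\mathbb R)$ with respect to the standard inner product on $C_{d-1}(X;\mathbb R)$ and the modified inner product $\langle x,y\rangle_R=\langle Rx,y\rangle$ on $C_d(X;\mathbb R)$. Let $B_{d-1}(X;\mathbb R)$ and $B_{d-1}(X;\mathbb Z)$ be the images of $\partial$ on the real and on the integral cellular $d$-chains, and let $\mathcal L^R\colon B_{d-1}(X;\mathbb R)\to B_{d-1}(X;\mathbb R)$ be the restriction of $\partial\partial_R^*$. A spanning tree of $X$ is a subcomplex $T\subset X$ such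 that $H_d(T;\mathbb Z)=0$, $\beta_{d-1}(T)=\beta_{d-1}(X)$ (where $\beta_{d-1}$ is the $(d-1)$-st Betti number) and $X^{(d-1)}\subset T$. Its weight is $$w_T=\theta_T^2\prod_{b\in T_d} r_b^{-1},$$ where $T_d$ is the set of $d$-cells of $T$ and $\theta_T$ is the order of the torsion subgroup of $H_{d-1}(T;\mathbb Z)$. Let $\theta_X$ be the order of the torsion subgroup of $H_{d-1}(X;\mathbb Z)$, and let $\mu_X$ be the square of the covolume of the lattice $B_{d-1}(X;\mathbb Z)\subset B_{d-1}(X;\mathbb R)$ with respect to the restriction of the standard inner product of $C_{d-1}(X;\mathbb R)$. Then $\mu_X\in\mathbb N$ and $$\det\mathcal L^R=\gamma_X\sum_T w_T,\qquad \gamma_X=\frac{\mu_X}{\theta_X^2},$$ where the sum is over all spanning trees $T$ of $X$. -/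

import Mathlib

open CategoryTheory CategoryTheory.Limits AlgebraicTopology
open Topology Topology.CWComplex

universe u

noncomputable section

namespace HigherTree

/-! ### Relative singular homology of topological pairs -/

/-- The integral singular chain complex functor. -/
def singularChains : TopCat.{u} ⥤ ChainComplex (ModuleCat.{u} ℤ) ℕ :=
  (singularChainComplexFunctor (ModuleCat.{u} ℤ)).obj (ModuleCat.of ℤ (ULift.{u} ℤ))

section Pair

variable {A Y B Z : TopCat.{u}}

/-- For a pair `(Y, A)` with inclusion `i : A ⟶ Y`, the short complex
`S(A) ⟶ S(Y) ⟶ S(Y) / S(A)` of singular chain complexes. -/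
def pairChains (i : A ⟶ Y) : ShortComplex (ChainComplex (ModuleCat.{u} ℤ) ℕ) :=
  ShortComplex.mk (singularChains.map i) (cokernel.π _) (cokernel.condition _)

lemma pairChains_shortExact (i : A ⟶ Y) [Mono i] : (pairChains i).ShortExact := by
  have hS : (singularChains.{u}).PreservesMonomorphisms := by
    unfold singularChains; infer_instance
  have h1 : Mono (pairChains i).f := hS.preserves i
  have h2 : Epi (pairChains i).g :=
    inferInstanceAs (Epi (cokernel.π (singularChains.map i)))
  exact { exact := ShortComplex.exact_cokernel _ }

/-- The singular homology group `H_n(Y; ℤ)`. -/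
abbrev absHomology (Y : TopCat.{u}) (n : ℕ) : ModuleCat.{u} ℤ :=
  (singularChains.obj Y).homology n

/-- The relative singular homology group `H_n(Y, A; ℤ)`, the homology of `S(Y) / S(A)`. -/
abbrev relHomology (i : A ⟶ Y) (n : ℕ) : ModuleCat.{u} ℤ :=
  (cokernel (singularChains.map i)).homology n

/-- The map `H_n(Y, A) ⟶ H_n(Z, B)` induced by a map of pairs `(g, f) : (Y, A) ⟶ (Z, B)`. -/
def relHomologyMap (i : A ⟶ Y) (j : B ⟶ Z) (f : A ⟶ B) (g : Y ⟶ Z) (w : i ≫ g = f ≫ j)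
    (n : ℕ) : relHomology i n ⟶ relHomology j n :=
  HomologicalComplex.homologyMap
    (cokernel.map (singularChains.map i) (singularChains.map j)
      (singularChains.map f) (singularChains.map g)
      (by rw [← Functor.map_comp, ← Functor.map_comp, w])) n

/-- The connecting homomorphism `H_{n+1}(Y, A) ⟶ H_n(A)`. -/
def connecting (i : A ⟶ Y) [Mono i] (n : ℕ) : relHomology i (n + 1) ⟶ absHomology A n :=
  (pairChains_shortExact i).δ (n + 1) n (by simp)

/-- The map `H_n(Y) ⟶ H_n(Y, A)`. -/
def toRel (i : A ⟶ Y) (n : ℕ) : absHomology Y n ⟶ relHomology i n :=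
  HomologicalComplex.homologyMap (cokernel.π (singularChains.map i)) n

end Pair

/-! ### Disks and their orientation -/

/-- The unit disk `D^n` of `Fin n → ℝ` (with the maximum norm), on which the characteristic maps
of a CW complex are defined. -/
abbrev disk (n : ℕ) : TopCat.{u} :=
  TopCat.of (ULift.{u} (Metric.closedBall (0 : Fin n → ℝ) 1))

/-- The boundary sphere `S^{n-1}` of the disk `D^n`. -/
abbrev diskBdry (n : ℕ) : TopCat.{u} :=
  TopCat.of (ULift.{u} (Metric.sphere (0 : Fin n → ℝ) 1))

/-- The inclusion of the boundary sphere in the disk. -/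
def diskIncl (n : ℕ) : diskBdry.{u} n ⟶ disk.{u} n :=
  TopCat.ofHom ⟨fun x => ⟨⟨x.down.1, Metric.sphere_subset_closedBall x.down.2⟩⟩, by fun_prop⟩

/-- A generator of the infinite cyclic group `H_n(D^n, S^{n-1}; ℤ)`, chosen once and for all. -/
def diskClass (n : ℕ) : relHomology (diskIncl.{u} n) n :=
  Classical.epsilon fun g => Submodule.span ℤ {g} = ⊤

/-! ### The cellular chain complex of a CW complex -/

section Cellular

variable {X : Type u} [TopologicalSpace X] [T2Space X] (C : Set X) [CWComplex C]

/-- The space `X^{(n-1)}`, the union of the cells of dimension less than `n`. -/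
abbrev skeletonSpace (n : ℕ) : TopCat.{u} := TopCat.of (skeletonLT C (n : ℕ∞) : Set X)

lemma skeletonLT_subset_succ (n : ℕ) :
    (skeletonLT C (n : ℕ∞) : Set X) ⊆ skeletonLT C ((n + 1 : ℕ) : ℕ∞) :=
  skeletonLT_mono (by exact_mod_cast n.le_succ)

/-- The inclusion of `X^{(n-1)}` in `X^{(n)}`. -/
def skeletonIncl (n : ℕ) : skeletonSpace C n ⟶ skeletonSpace C (n + 1) :=
  TopCat.ofHom ⟨Set.inclusion (skeletonLT_subset_succ C n), continuous_inclusion _⟩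

instance mono_skeletonIncl (n : ℕ) : Mono (skeletonIncl C n) :=
  (TopCat.mono_iff_injective _).2 (Set.inclusion_injective (skeletonLT_subset_succ C n))

variable {C} in
lemma map_mem_skeleton {n : ℕ} (i : cell C n) {x : Fin n → ℝ} (hx : x ∈ Metric.closedBall 0 1) :
    map n i x ∈ (skeletonLT C ((n + 1 : ℕ) : ℕ∞) : Set X) := by
  have h := closedCell_subset_skeletonLT n i ⟨x, hx, rfl⟩
  exact_mod_cast h

variable {C} in
/-- The characteristic map `D^n ⟶ X^{(n)}` of an `n`-cell. -/
def charMap {n : ℕ} (i : cell C n) : disk.{u} n ⟶ skeletonSpace C (n + 1) :=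
  TopCat.ofHom ⟨fun x => ⟨map n i x.down.1, map_mem_skeleton i x.down.2⟩,
    Continuous.subtype_mk ((continuousOn n i).comp_continuous
      (continuous_subtype_val.comp continuous_uliftDown) fun x => x.down.2) _⟩

variable {C} in
/-- The attaching map `S^{n-1} ⟶ X^{(n-1)}` of an `n`-cell. -/
def attachMap {n : ℕ} (i : cell C n) : diskBdry.{u} n ⟶ skeletonSpace C n :=
  TopCat.ofHom ⟨fun x => ⟨map n i x.down.1, cellFrontier_subset_skeletonLT n i ⟨_, x.down.2, rfl⟩⟩,
    Continuous.subtype_mk ((continuousOn n i).comp_continuous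
      (continuous_subtype_val.comp continuous_uliftDown)
      fun x => Metric.sphere_subset_closedBall x.down.2) _⟩

variable {C} in
/-- The class `[b] ∈ H_n(X^{(n)}, X^{(n-1)}; ℤ)` of an `n`-cell `b`. -/
def cellClass {n : ℕ} (b : cell C n) : relHomology (skeletonIncl C n) n :=
  (relHomologyMap (diskIncl n) (skeletonIncl C n) (attachMap b) (charMap b) rfl n).hom (diskClass n)

/-- The cellular boundary operator
`H_{n+1}(X^{(n+1)}, X^{(n)}) ⟶ H_n(X^{(n)}) ⟶ H_n(X^{(n)}, X^{(n-1)})`. -/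
def skeletonBoundary (n : ℕ) :
    relHomology (skeletonIncl C (n + 1)) (n + 1) ⟶ relHomology (skeletonIncl C n) n :=
  connecting (skeletonIncl C (n + 1)) n ≫ toRel (skeletonIncl C n) n

variable {C} in
/-- The boundary `∂b` of an `(n+1)`-cell `b`, expanded in the `n`-cells: the classes `[a]` of the
`n`-cells are a basis of `H_n(X^{(n)}, X^{(n-1)}; ℤ)`, and the incidence numbers `c a` are the
coordinates of the boundary of `[b]` in it, `∂[b] = ∑ a, c a • [a]`. -/
def cellBoundary {n : ℕ} (b : cell C (n + 1)) : cell C n →₀ ℤ :=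
  Classical.epsilon fun c =>
    Finsupp.linearCombination ℤ (cellClass (C := C) (n := n)) c =
      (skeletonBoundary C n).hom (cellClass b)

/-- The integral cellular chains `C_n(X; ℤ)`. -/
abbrev IntChain (n : ℕ) : Type u := cell C n →₀ ℤ

/-- The boundary operator `∂ : C_{n+1}(X; ℤ) → C_n(X; ℤ)`. -/
def boundary (n : ℕ) : IntChain C (n + 1) →ₗ[ℤ] IntChain C n :=
  Finsupp.linearCombination ℤ cellBoundary

/-- The integral cellular cycles `Z_n(X; ℤ)`. -/
def cycles : (n : ℕ) → Submodule ℤ (IntChain C n)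
  | 0 => ⊤
  | n + 1 => LinearMap.ker (boundary C n)

/-- The integral cellular boundaries `B_n(X; ℤ)`. -/
def boundaries (n : ℕ) : Submodule ℤ (IntChain C n) :=
  LinearMap.range (boundary C n)

/-- The cellular homology group `H_n(X; ℤ)`. -/
abbrev Homology (n : ℕ) : Type u :=
  cycles C n ⧸ (boundaries C n).comap (cycles C n).subtype

/-- The Betti number `β_n(X)`, the rank of `H_n(X; ℤ)`. -/
def betti (n : ℕ) : ℕ := Module.finrank ℤ (Homology C n)

/-- The order of the torsion subgroup of `H_n(X; ℤ)`. -/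
def torsionOrder (n : ℕ) : ℕ := Nat.card (Submodule.torsion ℤ (Homology C n))

/-- The CW complex has dimension `d`. -/
def HasDimension (d : ℕ) : Prop :=
  Nonempty (cell C d) ∧ ∀ n, d < n → IsEmpty (cell C n)

/-! ### Spanning trees -/

variable {C} in
/-- Spanning trees of a complex of dimension `k + 1`. -/
structure IsSpanningTree (k : ℕ) (T : Subcomplex C) : Prop where
  homology_top : Subsingleton (Homology (T : Set X) (k + 1))
  betti_eq : betti (T : Set X) k = betti C k
  skeleton_subset : (skeleton C (k : ℕ∞) : Set X) ⊆ T

variable [CWComplex.Finite C]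

instance finite_cell (n : ℕ) : _root_.Finite (cell C n) :=
  RelCWComplex.FiniteType.finite_cell n

instance fintype_cell (n : ℕ) : Fintype (cell C n) := Fintype.ofFinite _

/-- A finite CW complex has finitely many subcomplexes. -/
instance finite_subcomplex : _root_.Finite (Subcomplex C) := by
  have hfin : _root_.Finite (Σ n, cell C n) := RelCWComplex.finite_cells_of_finite
  refine _root_.Finite.of_injective
    (fun E : Subcomplex C => {p : Σ n, cell C n | p.2 ∈ E.I p.1}) fun E F h => ?_
  have hI : E.I = F.I := by
    funext n
    ext i
    exact Set.ext_iff.1 h ⟨n, i⟩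
  apply SetLike.coe_injective
  rw [← CWComplex.Subcomplex.union (E := E), ← CWComplex.Subcomplex.union (E := F), hI]

/-- The finite set of all spanning trees. -/
def spanningTrees (k : ℕ) : Finset (Subcomplex C) :=
  (Set.toFinite {T : Subcomplex C | IsSpanningTree k T}).toFinset

variable {C} in
/-- The weight `w_T = θ_T² ∏_{b ∈ T_d} r_b⁻¹`, where `d = k + 1`. -/
def weight {k : ℕ} (r : cell C (k + 1) → ℝ) (T : Subcomplex C) : ℝ :=
  (torsionOrder (T : Set X) k : ℝ) ^ 2 * ∏ b ∈ (Set.toFinite (T.I (k + 1))).toFinset, (r b)⁻¹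

/-! ### Real chains and the weighted Laplacian -/

/-- The real cellular chains `C_n(X; ℝ)`, with the inner product for which the cells are an
orthonormal basis. -/
abbrev RealChain (n : ℕ) : Type u := EuclideanSpace ℝ (cell C n)

/-- The orthonormal basis of `C_n(X; ℝ)` given by the cells. -/
def cellBasis (n : ℕ) : OrthonormalBasis (cell C n) ℝ (RealChain C n) :=
  EuclideanSpace.basisFun _ ℝ

/-- The map `C_n(X; ℤ) → C_n(X; ℝ)`. -/
def toReal (n : ℕ) : IntChain C n →ₗ[ℤ] RealChain C n :=
  Finsupp.linearCombination ℤ (cellBasis C n)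

/-- The boundary operator `∂ : C_{n+1}(X; ℝ) → C_n(X; ℝ)`. -/
def realBoundary (n : ℕ) : RealChain C (n + 1) →ₗ[ℝ] RealChain C n :=
  (cellBasis C (n + 1)).toBasis.constr ℝ fun b => toReal C n (boundary C n (Finsupp.single b 1))

/-- The space of real boundaries `B_n(X; ℝ)`. -/
def realBoundaries (n : ℕ) : Submodule ℝ (RealChain C n) :=
  LinearMap.range (realBoundary C n)

variable {C} in
/-- The operator `R` with `R b = r_b b` on every cell `b`. -/
def resistance {n : ℕ} (r : cell C n → ℝ) : RealChain C n →ₗ[ℝ] RealChain C n :=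
  (cellBasis C n).toBasis.constr ℝ fun b => r b • cellBasis C n b

variable {C} in
/-- The operator `∂_R^* = R⁻¹ ∂^*`, see `inner_realBoundary`. -/
def weightedCoboundary {n : ℕ} (r : cell C (n + 1) → ℝ) :
    RealChain C n →ₗ[ℝ] RealChain C (n + 1) :=
  resistance (fun b => (r b)⁻¹) ∘ₗ LinearMap.adjoint (realBoundary C n)

variable {C} in
/-- `∂_R^*` is the adjoint of `∂` for the standard inner product on `C_n(X; ℝ)` and the modified
inner product `⟨x, y⟩_R = ⟨R x, y⟩` on `C_{n+1}(X; ℝ)`. -/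
lemma inner_realBoundary {n : ℕ} (r : cell C (n + 1) → ℝ) (hr : ∀ b, 0 < r b)
    (x : RealChain C (n + 1)) (y : RealChain C n) :
    inner ℝ (realBoundary C n x) y = inner ℝ (resistance r x) (weightedCoboundary r y) := by
  have key : ∀ (s : cell C (n + 1) → ℝ) (v : RealChain C (n + 1)) (b),
      resistance s v b = s b * v b := by
    intro s v b
    classical
    simp [resistance, Module.Basis.constr_apply_fintype, cellBasis, EuclideanSpace.basisFun_apply,
      Pi.single_apply, mul_comm]
  rw [← LinearMap.adjoint_inner_right, weightedCoboundary, LinearMap.comp_apply,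
    PiLp.inner_apply, PiLp.inner_apply]
  refine Finset.sum_congr rfl fun b _ => ?_
  rw [key, key]
  have := (hr b).ne'
  simp only [RCLike.inner_apply, conj_trivial]
  field_simp

variable {C} in
/-- The weighted Laplacian `∂ ∂_R^*`, restricted to `B_n(X; ℝ)`. -/
def weightedLaplacian {n : ℕ} (r : cell C (n + 1) → ℝ) :
    realBoundaries C n →ₗ[ℝ] realBoundaries C n :=
  (realBoundary C n ∘ₗ weightedCoboundary r).restrict fun _ _ => LinearMap.mem_range_self _ _

/-- The lattice `B_n(X; ℤ)` in `B_n(X; ℝ)`. -/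
def boundaryLattice (n : ℕ) : Submodule ℤ (realBoundaries C n) :=
  ((boundaries C n).map (toReal C n)).comap ((realBoundaries C n).subtype.restrictScalars ℤ)

/-- The square of the covolume of `B_n(X; ℤ)` in `B_n(X; ℝ)`, with respect to the volume for which
a cube on an orthonormal basis of `B_n(X; ℝ)` has volume one. -/
def covolumeSq (n : ℕ) : ℝ :=
  ZLattice.covolume (boundaryLattice C n)
    (stdOrthonormalBasis ℝ (realBoundaries C n)).toBasis.addHaar ^ 2

end Cellular

end HigherTree

end

/-! Write d = k + 1. Let Q be the integer matrix of the boundaries of the d-cells in a ℤ-basis `e`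
of the lattice B_k(X; ℤ) (`coordMatrix`), D the diagonal matrix of the r_b⁻¹ and G the Gram matrix
of `e`. Then `e` is also a real basis of B_k(X; ℝ), in which the Laplacian has matrix Q D Qᵀ G. Its
determinant is det G · det(Q D Qᵀ). Here det G is the squared covolume μ_X, an integer because `e`
consists of integral chains. Cauchy–Binet turns det(Q D Qᵀ) into the sum of det(Q_S)² ∏_{b ∈ S}
r_b⁻¹ over the sets S of d-cells whose size is the rank of the lattice.

The nonzero terms are the spanning trees. A subcomplex T containing the k-skeleton is determined by
its set S of d-cells. Vanishing of H_d(T) means that the boundaries of the cells in S are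
independent, and equality of Betti numbers means that they span a subgroup of full rank; together
this says that S has the right size and det Q_S ≠ 0. Then |det Q_S| is the index of B_k(T) in
B_k(X). As Z_k(T) = Z_k(X), both groups of boundaries have the same saturation in the cycles, so θ_T
= |det Q_S| θ_X. The lemmas that carry this are `det_weightedLaplacian`, `covolumeSq_eq`,
`torsionCard_of_le`, `sq_torsionCard_mul_det` and `sum_weight_spanningTrees`.

The argument needs a cellular boundary that squares to zero and is compatible with subcomplexes.
Incidence numbers are chosen as solutions of an equation in relative singular homology, so it has to
be proved that the classes of the n-cells form a basis of H_n(X^(n), X^(n-1)); this is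
`bijective_linearCombination_cellClass`. A single operator (`d_prism`) gives both homotopy
invariance and the homotopy from subdivision to the identity. Subdivision gives excision, an
induction on dimension gives H_n(ℝⁿ, ℝⁿ ∖ 0) ≅ ℤ, and an open collar that deforms into the lower
skeleton lets excision reduce the pair of skeleta to open cubes.

Concrete chains are indexed by their number of vertices: index m is degree m - 1, and index 0 is the
augmentation term. -/

noncomputable section

/-! ### Formal chains with cone constructions, and affine simplices. -/

namespace HigherTree

/-! ### Chains of ordered tuples -/

/-- Formal integral combinations of `m`-tuples of elements of `K`. -/
abbrev OrdChain (K : Type*) (m : ℕ) := (Fin m → K) →₀ ℤ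

namespace OrdChain

variable {K L M : Type*}

/-- The alternating sum of the faces of a tuple. -/
def d (m : ℕ) : OrdChain K (m + 1) →ₗ[ℤ] OrdChain K m :=
  Finsupp.linearCombination ℤ fun v =>
    ∑ i : Fin (m + 1), (-1 : ℤ) ^ (i : ℕ) • Finsupp.single (v ∘ i.succAbove) 1

/-- The cone with apex `a`. -/
def cone {m : ℕ} (a : K) : OrdChain K m →ₗ[ℤ] OrdChain K (m + 1) :=
  Finsupp.lmapDomain ℤ ℤ fun v => Fin.cons a v

/-- The map of chains induced by a map of vertices. -/
def map (φ : K → L) (m : ℕ) : OrdChain K m →ₗ[ℤ] OrdChain L m :=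
  Finsupp.lmapDomain ℤ ℤ fun v => φ ∘ v

lemma d_single (m : ℕ) (v : Fin (m + 1) → K) : d m (Finsupp.single v 1) =
    ∑ i : Fin (m + 1), (-1 : ℤ) ^ (i : ℕ) • Finsupp.single (v ∘ i.succAbove) 1 := by
  simp [d]

@[simp] lemma cone_single {m : ℕ} (a : K) (v : Fin m → K) (n : ℤ) :
    cone a (Finsupp.single v n) = Finsupp.single (Fin.cons a v) n := by
  simp [cone, Finsupp.mapDomain_single]

@[simp] lemma map_single (φ : K → L) {m : ℕ} (v : Fin m → K) (n : ℤ) :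
    map φ m (Finsupp.single v n) = Finsupp.single (φ ∘ v) n := by
  simp [map, Finsupp.mapDomain_single]

lemma d_map (φ : K → L) (m : ℕ) (x : OrdChain K (m + 1)) :
    d m (map φ _ x) = map φ _ (d m x) := by
  have : d m ∘ₗ map φ _ = map φ _ ∘ₗ d m := by
    ext v : 1
    apply LinearMap.ext_ring
    simp [d_single, Function.comp_assoc]
  exact LinearMap.congr_fun this x

lemma map_cone (φ : K → L) {m : ℕ} (a : K) (x : OrdChain K m) :
    map φ _ (cone a x) = cone (φ a) (map φ _ x) := by
  have : map φ _ ∘ₗ cone a = cone (m := m) (φ a) ∘ₗ map φ _ := by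
    ext v : 1
    apply LinearMap.ext_ring
    simp [Fin.comp_cons]
  exact LinearMap.congr_fun this x

lemma map_map (φ : K → L) (ψ : L → M) {m : ℕ} (x : OrdChain K m) :
    map ψ _ (map φ _ x) = map (ψ ∘ φ) _ x := by
  have : map ψ m ∘ₗ map φ _ = map (ψ ∘ φ) _ := by
    ext v : 1
    apply LinearMap.ext_ring
    simp [Function.comp_assoc]
  exact LinearMap.congr_fun this x

lemma d_cone_zero (a : K) (x : OrdChain K 0) : d 0 (cone a x) = x := by
  have : d 0 ∘ₗ cone a = LinearMap.id (R := ℤ) (M := OrdChain K 0) := by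
    ext v : 1
    apply LinearMap.ext_ring
    simp only [LinearMap.comp_apply, Finsupp.lsingle_apply, cone_single, d_single]
    simp [Subsingleton.elim _ v]
  exact LinearMap.congr_fun this x

/-- Omitting the apex gives back `x`; omitting any other vertex gives a cone over a face, with the
sign shifted by one. Thus coning is a contracting homotopy, and every identity below is deduced from
this one by induction. -/
lemma d_cone {m : ℕ} (a : K) (x : OrdChain K (m + 1)) :
    d (m + 1) (cone a x) = x - cone a (d m x) := by
  have : d (m + 1) ∘ₗ cone a = LinearMap.id - cone (K := K) a ∘ₗ d m := by
    ext v : 1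
    apply LinearMap.ext_ring
    simp only [LinearMap.comp_apply, Finsupp.lsingle_apply, cone_single, d_single,
      LinearMap.sub_apply, LinearMap.id_apply, map_sum, map_smul]
    rw [Fin.sum_univ_succ]
    have h0 : (Fin.cons a v : Fin (m + 2) → K) ∘ (0 : Fin (m + 2)).succAbove = v := by
      ext i; simp
    rw [h0, sub_eq_add_neg, ← Finset.sum_neg_distrib]
    simp only [Fin.val_zero, pow_zero, one_smul, Fin.val_succ, pow_succ]
    congr 1
    refine Finset.sum_congr rfl fun i _ => ?_
    have : (Fin.cons a v : Fin (m + 2) → K) ∘ i.succ.succAbove =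
        Fin.cons a (v ∘ i.succAbove) := by
      ext j
      refine Fin.cases ?_ (fun j => ?_) j <;> simp
    rw [this]
    simp
  exact LinearMap.congr_fun this x

lemma d_d (m : ℕ) (x : OrdChain K (m + 2)) : d m (d (m + 1) x) = 0 := by
  have key : d (K := K) m ∘ₗ d (m + 1) = 0 := by
    clear x
    induction m with
    | zero =>
      ext v : 1
      apply LinearMap.ext_ring
      -- Every nonempty tuple is the cone over its tail, so the cone formula replaces the usual
      -- cancellation of signs.
      obtain ⟨a, w, rfl⟩ : ∃ a w, v = Fin.cons a w := ⟨v 0, Fin.tail v, by simp⟩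
      have := d_cone a (Finsupp.single w (1 : ℤ))
      rw [cone_single] at this
      simp only [LinearMap.comp_apply, Finsupp.lsingle_apply, this, map_sub, d_cone_zero]
      simp
    | succ m ih =>
      ext v : 1
      apply LinearMap.ext_ring
      obtain ⟨a, w, rfl⟩ : ∃ a w, v = Fin.cons a w := ⟨v 0, Fin.tail v, by simp⟩
      have := d_cone a (Finsupp.single w (1 : ℤ))
      rw [cone_single] at this
      have h2 := LinearMap.congr_fun ih (Finsupp.single w 1)
      simp only [LinearMap.comp_apply, LinearMap.zero_apply] at h2
      simp only [LinearMap.comp_apply, Finsupp.lsingle_apply, this, map_sub, d_cone, h2]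
      simp
  exact LinearMap.congr_fun key x

/-- The iterated cone construction with apices `b`, which is barycentric subdivision when `b`
is the barycenter. -/
def sd (b : ∀ m, (Fin (m + 1) → K) → K) : ∀ m, OrdChain K m →ₗ[ℤ] OrdChain K m
  | 0 => LinearMap.id
  | m + 1 => Finsupp.linearCombination ℤ fun v => cone (b m v) (sd b m (d m (Finsupp.single v 1)))

lemma sd_single (b : ∀ m, (Fin (m + 1) → K) → K) (m : ℕ) (v : Fin (m + 1) → K) :
    sd b (m + 1) (Finsupp.single v 1) = cone (b m v) (sd b m (d m (Finsupp.single v 1))) := by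
  simp [sd]

/-- Inductively the subdivided boundary of a tuple is a cycle, so the boundary of the cone over it
is that cycle itself. Nothing about the apices is used. -/
lemma d_sd (b : ∀ m, (Fin (m + 1) → K) → K) (m : ℕ) (x : OrdChain K (m + 1)) :
    d m (sd b _ x) = sd b _ (d m x) := by
  have key : d (K := K) m ∘ₗ sd b _ = sd b _ ∘ₗ d m := by
    clear x
    induction m with
    | zero =>
      ext v : 1
      apply LinearMap.ext_ring
      simp only [LinearMap.comp_apply, Finsupp.lsingle_apply, sd_single, d_cone_zero]
    | succ m ih =>
      ext v : 1
      apply LinearMap.ext_ring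
      have h2 := LinearMap.congr_fun ih (d (m + 1) (Finsupp.single v 1))
      simp only [LinearMap.comp_apply, d_d, map_zero] at h2
      simp only [LinearMap.comp_apply, Finsupp.lsingle_apply, sd_single b (m + 1), d_cone, h2,
        map_zero, sub_zero]
  exact LinearMap.congr_fun key x

lemma map_sd (b : ∀ m, (Fin (m + 1) → K) → K) (b' : ∀ m, (Fin (m + 1) → L) → L) (φ : K → L)
    (hφ : ∀ m v, φ (b m v) = b' m (φ ∘ v)) (m : ℕ) (x : OrdChain K m) :
    map φ _ (sd b _ x) = sd b' _ (map φ _ x) := by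
  have key : map φ m ∘ₗ sd b _ = sd b' _ ∘ₗ map φ _ := by
    clear x
    induction m with
    | zero => rfl
    | succ m ih =>
      ext v : 1
      apply LinearMap.ext_ring
      have h2 := LinearMap.congr_fun ih (d m (Finsupp.single v 1))
      simp only [LinearMap.comp_apply] at h2
      simp only [LinearMap.comp_apply, Finsupp.lsingle_apply, sd_single, map_cone, h2, hφ,
        map_single, ← d_map]
  exact LinearMap.congr_fun key x

lemma d_sd_pow (b : ∀ m, (Fin (m + 1) → K) → K) (N m : ℕ) (x : OrdChain K (m + 1)) :
    d m ((sd b _ ^ N) x) = (sd b _ ^ N) (d m x) := by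
  induction N generalizing x with
  | zero => simp
  | succ N ih => rw [pow_succ, pow_succ, Module.End.mul_apply, ih, d_sd, Module.End.mul_apply]

lemma map_sd_pow (b : ∀ m, (Fin (m + 1) → K) → K) (b' : ∀ m, (Fin (m + 1) → L) → L) (φ : K → L)
    (hφ : ∀ m v, φ (b m v) = b' m (φ ∘ v)) (N m : ℕ) (x : OrdChain K m) :
    map φ _ ((sd b _ ^ N) x) = (sd b' _ ^ N) (map φ _ x) := by
  induction N generalizing x with
  | zero => simp
  | succ N ih =>
    rw [pow_succ, pow_succ, Module.End.mul_apply, ih, map_sd b b' φ hφ, Module.End.mul_apply]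

/-- The homotopy between two families of maps of chains given by the cone construction. -/
def htpy (b : ∀ m, (Fin (m + 1) → K) → L) (f g : ∀ m, OrdChain K m →ₗ[ℤ] OrdChain L m) :
    ∀ m, OrdChain K m →ₗ[ℤ] OrdChain L (m + 1)
  | 0 => 0
  | m + 1 => Finsupp.linearCombination ℤ fun v => cone (b m v)
      (f _ (Finsupp.single v 1) - g _ (Finsupp.single v 1) -
        htpy b f g m (d m (Finsupp.single v 1)))

lemma htpy_single (b : ∀ m, (Fin (m + 1) → K) → L) (f g : ∀ m, OrdChain K m →ₗ[ℤ] OrdChain L m)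
    (m : ℕ) (v : Fin (m + 1) → K) : htpy b f g (m + 1) (Finsupp.single v 1) = cone (b m v)
      (f _ (Finsupp.single v 1) - g _ (Finsupp.single v 1) -
        htpy b f g m (d m (Finsupp.single v 1))) := by
  simp [htpy]

/-- Acyclic models with an explicit contraction: by induction f v - g v - h(d v) is a cycle, and
coning fills it. The induction starts with h = 0 because `f` and `g` agree on the augmentation term.
-/
lemma d_htpy (b : ∀ m, (Fin (m + 1) → K) → L) (f g : ∀ m, OrdChain K m →ₗ[ℤ] OrdChain L m)
    (hf : ∀ m x, d m (f _ x) = f _ (d m x)) (hg : ∀ m x, d m (g _ x) = g _ (d m x))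
    (h0 : f 0 = g 0) (m : ℕ) (x : OrdChain K (m + 1)) :
    d _ (htpy b f g (m + 1) x) + htpy b f g m (d m x) = f _ x - g _ x := by
  have key : d _ ∘ₗ htpy b f g (m + 1) + htpy b f g m ∘ₗ d m = f _ - g _ := by
    clear x
    induction m with
    | zero =>
      ext v : 1
      apply LinearMap.ext_ring
      simp only [LinearMap.comp_apply, Finsupp.lsingle_apply, htpy_single, d_cone,
        LinearMap.add_apply, LinearMap.sub_apply, map_sub, hf, hg, h0]
      simp [htpy]
    | succ m ih =>
      ext v : 1
      apply LinearMap.ext_ring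
      have h2 := LinearMap.congr_fun ih (d (m + 1) (Finsupp.single v 1))
      simp only [LinearMap.comp_apply, LinearMap.add_apply, d_d, map_zero, add_zero,
        LinearMap.sub_apply] at h2
      simp only [LinearMap.comp_apply, Finsupp.lsingle_apply, htpy_single b f g (m + 1), d_cone,
        LinearMap.add_apply, LinearMap.sub_apply, map_sub, hf, hg, h2]
      abel
  exact LinearMap.congr_fun key x

lemma map_htpy {K' L' : Type*} (b : ∀ m, (Fin (m + 1) → K) → L)
    (f g : ∀ m, OrdChain K m →ₗ[ℤ] OrdChain L m) (b' : ∀ m, (Fin (m + 1) → K') → L')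
    (f' g' : ∀ m, OrdChain K' m →ₗ[ℤ] OrdChain L' m) (φ : K → K') (ψ : L → L')
    (hb : ∀ m v, ψ (b m v) = b' m (φ ∘ v)) (hf : ∀ m x, map ψ m (f m x) = f' m (map φ m x))
    (hg : ∀ m x, map ψ m (g m x) = g' m (map φ m x)) (m : ℕ) (x : OrdChain K m) :
    map ψ _ (htpy b f g m x) = htpy b' f' g' m (map φ m x) := by
  have key : map ψ _ ∘ₗ htpy b f g m = htpy b' f' g' m ∘ₗ map φ m := by
    clear x
    induction m with
    | zero => simp [htpy]
    | succ m ih =>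
      ext v : 1
      apply LinearMap.ext_ring
      have h2 := LinearMap.congr_fun ih (d m (Finsupp.single v 1))
      simp only [LinearMap.comp_apply] at h2
      simp only [LinearMap.comp_apply, Finsupp.lsingle_apply, htpy_single, map_cone, h2, hb,
        map_single, ← d_map, map_sub, hf, hg]
  exact LinearMap.congr_fun key x

end OrdChain

/-! ### Affine simplices -/

/-- The standard simplex with `m` vertices. -/
abbrev Simplex (m : ℕ) := stdSimplex ℝ (Fin m)

section Affine

variable {E : Type*} [NormedAddCommGroup E] [NormedSpace ℝ E] {K : Set E}

/-- The affine simplex in a convex set with given vertices. -/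
def aff (hK : Convex ℝ K) {m : ℕ} (v : Fin m → K) : C(Simplex m, K) where
  toFun t := ⟨∑ i, t i • (v i : E), hK.sum_mem (fun i _ => t.2.1 i) t.2.2 fun i _ => (v i).2⟩
  continuous_toFun := by
    refine Continuous.subtype_mk (continuous_finsetSum _ fun i _ => ?_) _
    exact ((continuous_apply i).comp continuous_subtype_val).smul continuous_const

lemma aff_coe (hK : Convex ℝ K) {m : ℕ} (v : Fin m → K) (t : Simplex m) :
    (aff hK v t : E) = ∑ i, t i • (v i : E) := rfl

lemma aff_apply {p q : ℕ} (v : Fin p → Simplex q) (t : Simplex p) (j : Fin q) :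
    aff (convex_stdSimplex ℝ (Fin q)) v t j = ∑ i, t i * v i j := by
  change (aff (convex_stdSimplex ℝ (Fin q)) v t).1 j = _
  simp [aff]
  rfl

lemma aff_comp_aff (hK : Convex ℝ K) {p q : ℕ} (w : Fin q → K) (v : Fin p → Simplex q) :
    (aff hK w).comp (aff (convex_stdSimplex ℝ (Fin q)) v) = aff hK (aff hK w ∘ v) := by
  ext t
  simp only [ContinuousMap.comp_apply, aff_coe, Function.comp_apply, Finset.smul_sum, smul_smul]
  rw [Finset.sum_comm]
  refine Finset.sum_congr rfl fun i _ => ?_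
  rw [← Finset.sum_smul]
  congr 1
  rw [aff_apply]

/-- The vertices of the standard simplex. -/
def vert (m : ℕ) : Fin m → Simplex m := fun i => stdSimplex.vertex i

lemma aff_vert_apply (hK : Convex ℝ K) {m : ℕ} (v : Fin m → K) (i : Fin m) :
    aff hK v (vert m i) = v i := by
  ext
  simp [aff_coe, vert, Pi.single_apply]

lemma aff_comp_vert (hK : Convex ℝ K) {m : ℕ} (v : Fin m → K) : aff hK v ∘ vert m = v :=
  funext fun i => aff_vert_apply hK v i

lemma aff_vert (m : ℕ) : aff (convex_stdSimplex ℝ (Fin m)) (vert m) = ContinuousMap.id _ := by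
  ext t i
  rw [aff_apply]
  simp [vert, Pi.single_apply]

/-- The inclusion of the `i`-th face. -/
def face {m : ℕ} (i : Fin (m + 1)) : C(Simplex m, Simplex (m + 1)) :=
  aff (convex_stdSimplex ℝ (Fin (m + 1))) (vert (m + 1) ∘ i.succAbove)

lemma face_apply {m : ℕ} (i : Fin (m + 1)) (t : Simplex m) :
    face i t = stdSimplex.map i.succAbove t := by
  ext j
  rw [face, aff_apply]
  simp [vert, Pi.single_apply, FunOnFinite.linearMap_apply_apply, Finset.sum_filter, eq_comm]

lemma aff_comp_face (hK : Convex ℝ K) {m : ℕ} (v : Fin (m + 1) → K) (i : Fin (m + 1)) :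
    (aff hK v).comp (face i) = aff hK (v ∘ i.succAbove) := by
  rw [face, aff_comp_aff, ← Function.comp_assoc, aff_comp_vert]

/-- The barycenter of a tuple in a convex set. -/
def bary (hK : Convex ℝ K) (m : ℕ) (v : Fin (m + 1) → K) : K :=
  aff hK v stdSimplex.barycenter

/-- Affine maps preserve barycenters; this is the hypothesis needed for subdivision and its homotopy
to be natural for face inclusions. -/
lemma aff_bary (hK : Convex ℝ K) {q m : ℕ} (w : Fin q → K) (v : Fin (m + 1) → Simplex q) :
    aff hK w (bary (convex_stdSimplex ℝ (Fin q)) m v) = bary hK m (aff hK w ∘ v) := by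
  rw [bary, bary, ← aff_comp_aff]
  rfl

end Affine

end HigherTree

end

/-! ### Singular chains: homotopies, subdivision, relative homology and excision. -/

noncomputable section

namespace HigherTree

/-! ### Singular chains -/

/-- Integral singular chains with `m` vertices; for `m = 0` this is the augmentation term. -/
abbrev SChain (Y : Type*) [TopologicalSpace Y] (m : ℕ) := C(Simplex m, Y) →₀ ℤ

namespace SChain

variable {Y Z W K : Type*} [TopologicalSpace Y] [TopologicalSpace Z] [TopologicalSpace W]

/-- The singular boundary operator. -/
def d (m : ℕ) : SChain Y (m + 1) →ₗ[ℤ] SChain Y m :=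
  Finsupp.linearCombination ℤ fun σ =>
    ∑ i : Fin (m + 1), (-1 : ℤ) ^ (i : ℕ) • Finsupp.single (σ.comp (face i)) 1

lemma d_single (m : ℕ) (σ : C(Simplex (m + 1), Y)) : d m (Finsupp.single σ 1) =
    ∑ i : Fin (m + 1), (-1 : ℤ) ^ (i : ℕ) • Finsupp.single (σ.comp (face i)) 1 := by
  simp [d]

/-- The map of singular chains induced by a continuous map. -/
def map (f : C(Y, Z)) (m : ℕ) : SChain Y m →ₗ[ℤ] SChain Z m :=
  Finsupp.lmapDomain ℤ ℤ fun σ => f.comp σ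

@[simp] lemma map_single (f : C(Y, Z)) {m : ℕ} (σ : C(Simplex m, Y)) (n : ℤ) :
    map f m (Finsupp.single σ n) = Finsupp.single (f.comp σ) n := by
  simp [map, Finsupp.mapDomain_single]

lemma map_map (f : C(Y, Z)) (g : C(Z, W)) {m : ℕ} (x : SChain Y m) :
    map g m (map f m x) = map (g.comp f) m x := by
  have : map g m ∘ₗ map f m = map (g.comp f) m := by
    ext v : 1
    apply LinearMap.ext_ring
    simp [ContinuousMap.comp_assoc]
  exact LinearMap.congr_fun this x

lemma map_id {m : ℕ} (x : SChain Y m) : map (ContinuousMap.id Y) m x = x := by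
  have : map (ContinuousMap.id Y) m = LinearMap.id := by
    ext v : 1
    apply LinearMap.ext_ring
    simp
  exact LinearMap.congr_fun this x

lemma d_map (f : C(Y, Z)) (m : ℕ) (x : SChain Y (m + 1)) :
    d m (map f _ x) = map f _ (d m x) := by
  have : d m ∘ₗ map f _ = map f _ ∘ₗ d m := by
    ext v : 1
    apply LinearMap.ext_ring
    simp [d_single, ContinuousMap.comp_assoc]
  exact LinearMap.congr_fun this x

/-- A family of singular simplices indexed by tuples induces a map of chains. -/
def ofOrd (ρ : ∀ m, (Fin m → K) → C(Simplex m, Z)) (m : ℕ) : OrdChain K m →ₗ[ℤ] SChain Z m :=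
  Finsupp.lmapDomain ℤ ℤ (ρ m)

@[simp] lemma ofOrd_single (ρ : ∀ m, (Fin m → K) → C(Simplex m, Z)) {m : ℕ} (v : Fin m → K)
    (n : ℤ) : ofOrd ρ m (Finsupp.single v n) = Finsupp.single (ρ m v) n := by
  simp [ofOrd, Finsupp.mapDomain_single]

lemma d_ofOrd (ρ : ∀ m, (Fin m → K) → C(Simplex m, Z))
    (hρ : ∀ m v i, (ρ (m + 1) v).comp (face i) = ρ m (v ∘ i.succAbove)) (m : ℕ)
    (x : OrdChain K (m + 1)) : d m (ofOrd ρ _ x) = ofOrd ρ _ (OrdChain.d m x) := by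
  have : d m ∘ₗ ofOrd ρ _ = ofOrd ρ _ ∘ₗ OrdChain.d m := by
    ext v : 1
    apply LinearMap.ext_ring
    simp [d_single, OrdChain.d_single, hρ]
  exact LinearMap.congr_fun this x

/-- The image under `σ` of a chain of affine simplices. -/
def push {q : ℕ} (σ : C(Simplex q, Y)) : ∀ m, OrdChain (Simplex q) m →ₗ[ℤ] SChain Y m :=
  ofOrd fun _ v => σ.comp (aff (convex_stdSimplex ℝ (Fin q)) v)

/-- The image under a map from a prism of a chain of affine simplices. -/
def pushPrism {q : ℕ} (G : C(Simplex q × unitInterval, Z)) :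
    ∀ m, OrdChain (Simplex q × unitInterval) m →ₗ[ℤ] SChain Z m :=
  ofOrd fun _ v => G.comp ((aff (convex_stdSimplex ℝ (Fin q)) (Prod.fst ∘ v)).prodMk
    (aff (convex_Icc (0 : ℝ) 1) (Prod.snd ∘ v)))

lemma d_push {q : ℕ} (σ : C(Simplex q, Y)) (m : ℕ) (x : OrdChain (Simplex q) (m + 1)) :
    d m (push σ _ x) = push σ _ (OrdChain.d m x) :=
  d_ofOrd _ (fun m v i => by rw [ContinuousMap.comp_assoc, aff_comp_face]) m x

lemma d_pushPrism {q : ℕ} (G : C(Simplex q × unitInterval, Z)) (m : ℕ)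
    (x : OrdChain (Simplex q × unitInterval) (m + 1)) :
    d m (pushPrism G _ x) = pushPrism G _ (OrdChain.d m x) := by
  refine d_ofOrd _ (fun m v i => ?_) m x
  rw [ContinuousMap.comp_assoc]
  congr 1
  rw [← Function.comp_assoc, ← Function.comp_assoc, ← aff_comp_face, ← aff_comp_face]
  rfl

lemma push_map {q r : ℕ} (σ : C(Simplex q, Y)) (w : Fin r → Simplex q) (m : ℕ)
    (x : OrdChain (Simplex r) m) :
    push σ m (OrdChain.map (aff (convex_stdSimplex ℝ (Fin q)) w) m x) =
      push (σ.comp (aff (convex_stdSimplex ℝ (Fin q)) w)) m x := by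
  have : push σ m ∘ₗ OrdChain.map (aff (convex_stdSimplex ℝ (Fin q)) w) m =
      push (σ.comp (aff (convex_stdSimplex ℝ (Fin q)) w)) m := by
    ext v : 1
    apply LinearMap.ext_ring
    simp [push, ContinuousMap.comp_assoc, aff_comp_aff]
  exact LinearMap.congr_fun this x

lemma pushPrism_map {q r : ℕ} (G : C(Simplex q × unitInterval, Z)) (w : Fin r → Simplex q) (m : ℕ)
    (x : OrdChain (Simplex r × unitInterval) m) :
    pushPrism G m
      (OrdChain.map (Prod.map (aff (convex_stdSimplex ℝ (Fin q)) w) id) m x) =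
      pushPrism (G.comp
        ((aff (convex_stdSimplex ℝ (Fin q)) w).prodMap (ContinuousMap.id _))) m x := by
  have : pushPrism G m ∘ₗ
      OrdChain.map (Prod.map (aff (convex_stdSimplex ℝ (Fin q)) w) id) m =
      pushPrism (G.comp
        ((aff (convex_stdSimplex ℝ (Fin q)) w).prodMap (ContinuousMap.id _))) m := by
    ext v : 1
    apply LinearMap.ext_ring
    simp only [pushPrism, LinearMap.comp_apply, Finsupp.lsingle_apply, OrdChain.map_single,
      ofOrd_single, ContinuousMap.comp_assoc]
    congr 2
    have h1 : Prod.fst ∘ Prod.map (aff (convex_stdSimplex ℝ (Fin q)) w) id ∘ v =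
        aff (convex_stdSimplex ℝ (Fin q)) w ∘ Prod.fst ∘ v := rfl
    have h2 : Prod.snd ∘ Prod.map (aff (convex_stdSimplex ℝ (Fin q)) w) id ∘ v =
        Prod.snd ∘ v := rfl
    rw [h1, h2, ← aff_comp_aff]
    rfl
  exact LinearMap.congr_fun this x

/-- The barycenters in a standard simplex. -/
abbrev sbary (q : ℕ) : ∀ m, (Fin (m + 1) → Simplex q) → Simplex q :=
  bary (convex_stdSimplex ℝ (Fin q))

/-- The `N`-fold barycentric subdivision of singular chains. -/
def sd (N m : ℕ) : SChain Y m →ₗ[ℤ] SChain Y m :=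
  Finsupp.linearCombination ℤ fun σ =>
    push σ m ((OrdChain.sd (sbary m) m ^ N) (Finsupp.single (vert m) 1))

lemma sd_single (N m : ℕ) (σ : C(Simplex m, Y)) : sd N m (Finsupp.single σ 1) =
    push σ m ((OrdChain.sd (sbary m) m ^ N) (Finsupp.single (vert m) 1)) := by
  simp [sd]

lemma d_single_vert (m : ℕ) : OrdChain.d m (Finsupp.single (vert (m + 1)) 1) =
    ∑ i : Fin (m + 1), (-1 : ℤ) ^ (i : ℕ) • OrdChain.map (face i) m
      (Finsupp.single (vert m) 1) := by
  simp only [OrdChain.d_single, OrdChain.map_single, face, aff_comp_vert]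

/-- Each singular simplex is the image of the tautological affine simplex, so identities of singular
chains can be checked on chains of tuples in a standard simplex. -/
lemma push_vert {m : ℕ} (σ : C(Simplex m, Y)) (n : ℤ) :
    push σ m (Finsupp.single (vert m) n) = Finsupp.single σ n := by
  simp [push, aff_vert]

lemma d_d (m : ℕ) (x : SChain Y (m + 2)) : d m (d (m + 1) x) = 0 := by
  have : d m ∘ₗ d (m + 1) = (0 : SChain Y (m + 2) →ₗ[ℤ] SChain Y m) := by
    ext σ : 1
    apply LinearMap.ext_ring
    rw [LinearMap.comp_apply, LinearMap.comp_apply, Finsupp.lsingle_apply, ← push_vert σ,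
      d_push, d_push, OrdChain.d_d, map_zero]
    rfl
  exact LinearMap.congr_fun this x

lemma d_sd (N m : ℕ) (x : SChain Y (m + 1)) : d m (sd N _ x) = sd N _ (d m x) := by
  have : d m ∘ₗ sd N _ = sd N _ ∘ₗ d (Y := Y) m := by
    ext σ : 1
    apply LinearMap.ext_ring
    simp only [LinearMap.comp_apply, Finsupp.lsingle_apply, sd_single, d_push,
      OrdChain.d_sd_pow, d_single, map_sum, map_smul, d_single_vert]
    refine Finset.sum_congr rfl fun i _ => ?_
    rw [face, ← OrdChain.map_sd_pow _ _ _ (fun m v => aff_bary _ _ v), push_map]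
  exact LinearMap.congr_fun this x

/-- The homotopy, on chains of tuples, between the top of the prism and the subdivided bottom. -/
def ordPrism (N q m : ℕ) :
    OrdChain (Simplex q) m →ₗ[ℤ] OrdChain (Simplex q × unitInterval) (m + 1) :=
  OrdChain.htpy (fun m v => (sbary q m v, 0)) (fun m => OrdChain.map (fun x => (x, 1)) m)
    (fun m => OrdChain.map (fun x => (x, 0)) m ∘ₗ OrdChain.sd (sbary q) m ^ N) m

/-- The prism operator of a homotopy, combined with subdivision of the bottom. -/
def prism (N : ℕ) (H : C(Y × unitInterval, Z)) (m : ℕ) : SChain Y m →ₗ[ℤ] SChain Z (m + 1) :=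
  Finsupp.linearCombination ℤ fun σ =>
    pushPrism (H.comp (σ.prodMap (ContinuousMap.id _))) (m + 1)
      (ordPrism N m m (Finsupp.single (vert m) 1))

lemma prism_single (N : ℕ) (H : C(Y × unitInterval, Z)) (m : ℕ) (σ : C(Simplex m, Y)) :
    prism N H m (Finsupp.single σ 1) =
    pushPrism (H.comp (σ.prodMap (ContinuousMap.id _))) (m + 1)
      (ordPrism N m m (Finsupp.single (vert m) 1)) := by
  simp [prism]

/-- The time `t` map of a homotopy. -/
def atTime (H : C(Y × unitInterval, Z)) (t : unitInterval) : C(Y, Z) :=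
  H.comp ((ContinuousMap.id Y).prodMk (ContinuousMap.const Y t))

@[simp] lemma atTime_apply (H : C(Y × unitInterval, Z)) (t : unitInterval) (y : Y) :
    atTime H t y = H (y, t) := rfl

lemma pushPrism_map_const {q : ℕ} (H : C(Y × unitInterval, Z)) (σ : C(Simplex q, Y))
    (t : unitInterval) (m : ℕ) (x : OrdChain (Simplex q) m) :
    pushPrism (H.comp (σ.prodMap (ContinuousMap.id _))) m
      (OrdChain.map (fun x => (x, t)) m x) = map (atTime H t) m (push σ m x) := by
  have : pushPrism (H.comp (σ.prodMap (ContinuousMap.id _))) m ∘ₗ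
      OrdChain.map (fun x => (x, t)) m = map (atTime H t) m ∘ₗ push σ m := by
    ext v : 1
    apply LinearMap.ext_ring
    simp only [pushPrism, push, LinearMap.comp_apply, Finsupp.lsingle_apply, OrdChain.map_single,
      ofOrd_single, ContinuousMap.comp_assoc, map_single]
    congr 1
    ext s
    have ht : aff (convex_Icc (0 : ℝ) 1) (Prod.snd ∘ (fun x => (x, t)) ∘ v) s = t := by
      ext
      rw [aff_coe]
      simp only [Function.comp_apply, smul_eq_mul, ← Finset.sum_mul, stdSimplex.sum_eq_one,
        one_mul]
    change H (_, aff (convex_Icc (0 : ℝ) 1) (Prod.snd ∘ (fun x => (x, t)) ∘ v) s) = _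
    rw [ht]
    rfl
  exact LinearMap.congr_fun this x

/-- The cone homotopy is built once in the convex prism over the standard simplex and pushed forward
by `H`. For N = 0 the formula is homotopy invariance; for the constant homotopy it compares
subdivision with the identity. -/
lemma d_prism (N : ℕ) (H : C(Y × unitInterval, Z)) (m : ℕ) (x : SChain Y (m + 1)) :
    d _ (prism N H _ x) + prism N H _ (d m x) =
      map (atTime H 1) _ x - map (atTime H 0) _ (sd N _ x) := by
  have : d _ ∘ₗ prism N H _ + prism N H _ ∘ₗ d m =
      map (atTime H 1) _ - map (atTime H 0) _ ∘ₗ sd N _ := by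
    ext σ : 1
    apply LinearMap.ext_ring
    have h1 := OrdChain.d_htpy (fun k v => (sbary (m + 1) k v, (0 : unitInterval)))
      (fun k => OrdChain.map (fun x => (x, 1)) k)
      (fun k => OrdChain.map (fun x => (x, 0)) k ∘ₗ OrdChain.sd (sbary (m + 1)) k ^ N)
      (fun k x => OrdChain.d_map _ _ _)
      (fun k x => by simp only [LinearMap.comp_apply, OrdChain.d_map, OrdChain.d_sd_pow])
      (by
        ext v : 1
        apply LinearMap.ext_ring
        have h0 : OrdChain.sd (sbary (m + 1)) 0 = 1 := rfl
        rw [h0]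
        simp only [one_pow, LinearMap.comp_apply, Module.End.one_apply, OrdChain.map_single,
          Finsupp.lsingle_apply]
        congr 1
        exact Subsingleton.elim _ _) m (Finsupp.single (vert (m + 1)) 1)
    change OrdChain.d _ (ordPrism N (m + 1) (m + 1) _) + ordPrism N (m + 1) m _ = _ at h1
    have h2 := congrArg (pushPrism (H.comp (σ.prodMap (ContinuousMap.id _))) (m + 1)) h1
    rw [map_add, map_sub, ← d_pushPrism, ← prism_single, d_single_vert, map_sum, map_sum,
      LinearMap.comp_apply, pushPrism_map_const, pushPrism_map_const, ← sd_single,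
      push_vert] at h2
    simp only [LinearMap.add_apply, LinearMap.comp_apply, LinearMap.sub_apply,
      Finsupp.lsingle_apply, ← h2]
    congr 1
    rw [d_single, map_sum]
    refine Finset.sum_congr rfl fun i _ => ?_
    rw [map_smul, map_smul, map_smul, prism_single]
    congr 1
    -- The prism chain of a face is the restriction of that of the whole simplex, because the apices
    -- (barycenter, 0) are preserved by face inclusions.
    have h3 : OrdChain.map (Prod.map (face i) id) _
        (ordPrism N m m (Finsupp.single (vert m) 1)) =
        ordPrism N (m + 1) m (OrdChain.map (face i) m (Finsupp.single (vert m) 1)) := by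
      refine OrdChain.map_htpy _ _ _ _ _ _ _ _ (fun k v => ?_) (fun k x => ?_) (fun k x => ?_) _ _
      · simp only [Prod.map, id, face, aff_bary]
      · simp only [OrdChain.map_map]
        rfl
      · simp only [LinearMap.comp_apply, OrdChain.map_map]
        rw [← OrdChain.map_sd_pow (sbary m) (sbary (m + 1)) (face i)
          (fun m v => aff_bary _ _ v), OrdChain.map_map]
        rfl
    rw [← h3, face, pushPrism_map]
    rfl
  exact LinearMap.congr_fun this x

/-! ### Chains in a subset -/

/-- The chains consisting of simplices in the subset `A`. -/
def sub (A : Set Y) (m : ℕ) : Submodule ℤ (SChain Y m) :=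
  Finsupp.supported ℤ ℤ {σ | Set.range σ ⊆ A}

lemma single_mem_sub {A : Set Y} {m : ℕ} {σ : C(Simplex m, Y)} (h : Set.range σ ⊆ A) (n : ℤ) :
    Finsupp.single σ n ∈ sub A m :=
  Finsupp.single_mem_supported ℤ _ h

lemma sub_univ (m : ℕ) : sub (Set.univ : Set Y) m = ⊤ := by
  simp [sub, Finsupp.supported_univ]

/-- The only simplex without vertices is the empty map, whose range lies in every subset, even in ∅.
Hence the augmentation term disappears from relative chains, and the relative groups below are the
ordinary ones. -/
lemma sub_zero (A : Set Y) : sub A 0 = ⊤ := by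
  have : {σ : C(Simplex 0, Y) | Set.range σ ⊆ A} = Set.univ := by
    refine Set.eq_univ_of_forall fun σ => ?_
    rintro _ ⟨t, -⟩
    have := t.2.2
    simp at this
  rw [sub, this, Finsupp.supported_univ]

lemma sub_mono {A B : Set Y} (h : A ⊆ B) (m : ℕ) : sub A m ≤ sub B m :=
  Finsupp.supported_mono fun _ hσ => hσ.trans h

lemma map_le_of_single {A : Set Y} {m : ℕ} {M : Type*} [AddCommGroup M] [Module ℤ M]
    (F : SChain Y m →ₗ[ℤ] M) (P : Submodule ℤ M)
    (h : ∀ σ : C(Simplex m, Y), Set.range σ ⊆ A → F (Finsupp.single σ 1) ∈ P) {x : SChain Y m}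
    (hx : x ∈ sub A m) : F x ∈ P := by
  rw [sub, Finsupp.supported_eq_span_single] at hx
  have : Submodule.span ℤ ((fun i => Finsupp.single i (1 : ℤ)) '' {σ : C(Simplex m, Y) | Set.range σ ⊆ A}) ≤
      P.comap F := by
    rw [Submodule.span_le]
    rintro _ ⟨σ, hσ, rfl⟩
    exact h σ hσ
  exact this hx

lemma map_mem {A : Set Y} {B : Set Z} (f : C(Y, Z)) (h : Set.MapsTo f A B) {m : ℕ}
    {x : SChain Y m} (hx : x ∈ sub A m) : map f m x ∈ sub B m := by
  refine map_le_of_single _ _ (fun σ hσ => ?_) hx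
  rw [map_single]
  refine single_mem_sub ?_ _
  rintro _ ⟨t, rfl⟩
  exact h (hσ ⟨t, rfl⟩)

lemma d_mem {A : Set Y} {m : ℕ} {x : SChain Y (m + 1)} (hx : x ∈ sub A (m + 1)) :
    d m x ∈ sub A m := by
  refine map_le_of_single _ _ (fun σ hσ => ?_) hx
  rw [d_single]
  refine Submodule.sum_mem _ fun i _ => Submodule.smul_mem _ _ (single_mem_sub ?_ _)
  rintro _ ⟨t, rfl⟩
  exact hσ ⟨_, rfl⟩

lemma ofOrd_mem {B : Set Z} (ρ : ∀ m, (Fin m → K) → C(Simplex m, Z)) (m : ℕ)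
    (h : ∀ v, Set.range (ρ m v) ⊆ B) (x : OrdChain K m) : ofOrd ρ m x ∈ sub B m := by
  induction x using Finsupp.induction_linear with
  | zero => simp
  | add x y hx hy => rw [_root_.map_add]; exact add_mem hx hy
  | single v n => rw [ofOrd_single]; exact single_mem_sub (h v) n

lemma sd_mem {A : Set Y} (N : ℕ) {m : ℕ} {x : SChain Y m} (hx : x ∈ sub A m) :
    sd N m x ∈ sub A m := by
  refine map_le_of_single _ _ (fun σ hσ => ?_) hx
  rw [sd_single]
  refine ofOrd_mem _ _ (fun v => ?_) _
  rintro _ ⟨t, rfl⟩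
  exact hσ ⟨_, rfl⟩

lemma prism_mem {A : Set Y} {B : Set Z} (N : ℕ) (H : C(Y × unitInterval, Z))
    (hH : ∀ y ∈ A, ∀ t, H (y, t) ∈ B) {m : ℕ} {x : SChain Y m} (hx : x ∈ sub A m) :
    prism N H m x ∈ sub B (m + 1) := by
  refine map_le_of_single _ _ (fun σ hσ => ?_) hx
  rw [prism_single]
  refine ofOrd_mem _ _ (fun v => ?_) _
  rintro _ ⟨t, rfl⟩
  exact hH _ (hσ ⟨_, rfl⟩) _

end SChain

end HigherTree

end

noncomputable section

namespace HigherTree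

/-! ### Subdivision makes simplices small -/

section Small

variable {E : Type*} [NormedAddCommGroup E] [NormedSpace ℝ E] {K : Set E}

/-- The tuples in `s` of diameter at most `D`. -/
def smallTuples (K s : Set E) (m : ℕ) (D : ℝ) : Set (Fin m → K) :=
  {w | (∀ i, (w i : E) ∈ s) ∧ ∀ i j, ‖(w i : E) - w j‖ ≤ D}

/-- The vector from the barycenter to a vertex is the average of m + 1 differences of vertices, one
of which is zero; this gives m / (m + 1). The weaker constant is the one that matches the number m +
1 of vertices in `sd_mem_smallTuples`. -/
lemma norm_bary_sub_le (hK : Convex ℝ K) {m : ℕ} {D : ℝ} (v : Fin (m + 1) → K)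
    (hv : ∀ i j, ‖(v i : E) - v j‖ ≤ D) (k : Fin (m + 1)) :
    ‖(v k : E) - bary hK m v‖ ≤ (m + 1 : ℕ) / ((m + 1 : ℕ) + 1 : ℝ) * D := by
  have hD : 0 ≤ D := (norm_nonneg _).trans (hv 0 0)
  have hm : (0 : ℝ) < m + 1 := by positivity
  have h1 : (v k : E) - bary hK m v = ∑ i, ((m : ℝ) + 1)⁻¹ • ((v k : E) - v i) := by
    rw [← Finset.smul_sum, Finset.sum_sub_distrib, bary, aff_coe, smul_sub]
    congr 1
    · rw [Finset.sum_const, Finset.card_univ, Fintype.card_fin, ← Nat.cast_smul_eq_nsmul ℝ,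
        smul_smul]
      push_cast
      rw [inv_mul_cancel₀ hm.ne', one_smul]
    · rw [Finset.smul_sum]
      refine Finset.sum_congr rfl fun i _ => ?_
      congr 1
      change (stdSimplex.barycenter : Simplex (m + 1)).val i = _
      simp
  have h2 : ‖(v k : E) - bary hK m v‖ ≤ ∑ i, if i = k then 0 else ((m : ℝ) + 1)⁻¹ * D := by
    rw [h1]
    refine (norm_sum_le _ _).trans (Finset.sum_le_sum fun i _ => ?_)
    split_ifs with h
    · simp [h]
    · rw [norm_smul, Real.norm_of_nonneg (by positivity)]
      exact mul_le_mul_of_nonneg_left (hv k i) (by positivity)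
  refine h2.trans ?_
  have h3 : (∑ i : Fin (m + 1), if i = k then 0 else ((m : ℝ) + 1)⁻¹ * D) =
      m * (((m : ℝ) + 1)⁻¹ * D) := by
    simp [Finset.sum_ite, Finset.filter_ne']
  rw [h3, ← mul_assoc]
  refine mul_le_mul_of_nonneg_right ?_ hD
  rw [← div_eq_mul_inv, div_le_div_iff₀ hm (by positivity)]
  push_cast
  nlinarith

lemma supported_le_comap {α M : Type*} [AddCommGroup M] [Module ℤ M] {s : Set α}
    (F : (α →₀ ℤ) →ₗ[ℤ] M) (P : Submodule ℤ M) (h : ∀ a ∈ s, F (Finsupp.single a 1) ∈ P)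
    {x : α →₀ ℤ} (hx : x ∈ Finsupp.supported ℤ ℤ s) : F x ∈ P := by
  rw [Finsupp.supported_eq_span_single] at hx
  have : Submodule.span ℤ ((fun i => Finsupp.single i (1 : ℤ)) '' s) ≤ P.comap F := by
    rw [Submodule.span_le]
    rintro _ ⟨σ, hσ, rfl⟩
    exact h σ hσ
  exact this hx

/-- Edges at the apex are bounded by `norm_bary_sub_le`, the others by induction. The convex set `s`
is a parameter so that the induction can carry the information that all vertices stay near the apex.
-/
lemma sd_mem_smallTuples (hK : Convex ℝ K) (m : ℕ) :
    ∀ (s : Set E), Convex ℝ s → ∀ (D : ℝ) (x : OrdChain K m),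
      x ∈ Finsupp.supported ℤ ℤ (smallTuples K s m D) → OrdChain.sd (bary hK) m x ∈
        Finsupp.supported ℤ ℤ (smallTuples K s m (m / (m + 1 : ℝ) * D)) := by
  induction m with
  | zero =>
    intro s _ D x hx
    have : smallTuples K s 0 (((0 : ℕ) : ℝ) / ((0 : ℕ) + 1 : ℝ) * D) = Set.univ :=
      Set.eq_univ_of_forall fun w => ⟨fun i => i.elim0, fun i => i.elim0⟩
    rw [this, Finsupp.supported_univ]
    trivial
  | succ m ih =>
    intro s hs D x hx
    refine supported_le_comap (OrdChain.sd (bary hK) (m + 1)) _ (fun v hv => ?_) hx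
    have hD : 0 ≤ D := (norm_nonneg _).trans (hv.2 0 0)
    set r : ℝ := (m + 1 : ℕ) / ((m + 1 : ℕ) + 1 : ℝ) * D with hr
    have hb : (bary hK m v : E) ∈ s := by
      rw [bary, aff_coe]
      exact hs.sum_mem (fun i _ => stdSimplex.zero_le _ i) (stdSimplex.sum_eq_one _)
        fun i _ => hv.1 i
    -- The ball contains all vertices of `v` and is convex, so it contains the vertices of the
    -- subdivided boundary as well.
    have h1 := ih (s ∩ Metric.closedBall (bary hK m v : E) r)
      (hs.inter (convex_closedBall _ _)) D (OrdChain.d m (Finsupp.single v 1)) (by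
        rw [OrdChain.d_single]
        refine Submodule.sum_mem _ fun i _ => Submodule.smul_mem _ _
          (Finsupp.single_mem_supported ℤ _ ⟨fun j => ⟨hv.1 _, ?_⟩, fun j k => hv.2 _ _⟩)
        rw [mem_closedBall_iff_norm]
        exact norm_bary_sub_le hK v hv.2 _)
    rw [OrdChain.sd_single]
    refine supported_le_comap (OrdChain.cone (bary hK m v)) _ (fun w hw => ?_) h1
    rw [OrdChain.cone_single]
    have hmr : (m : ℝ) / (m + 1 : ℝ) * D ≤ r := by
      refine mul_le_mul_of_nonneg_right ?_ hD
      rw [div_le_div_iff₀ (by positivity) (by positivity)]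
      push_cast
      nlinarith
    have hr0 : 0 ≤ r := by positivity
    have hw' : ∀ i, ‖(w i : E) - bary hK m v‖ ≤ r := fun i =>
      mem_closedBall_iff_norm.1 (hw.1 i).2
    refine Finsupp.single_mem_supported ℤ _ ⟨fun i => ?_, fun i j => ?_⟩
    · refine Fin.cases ?_ (fun i => ?_) i
      · simpa using hb
      · simpa using (hw.1 i).1
    · refine Fin.cases ?_ (fun i => ?_) i <;> refine Fin.cases ?_ (fun j => ?_) j
      · simpa using hr0
      · simpa [norm_sub_rev] using hw' j
      · simpa using hw' i
      · simpa using (hw.2 i j).trans hmr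

lemma sd_pow_mem_smallTuples (hK : Convex ℝ K) (m : ℕ) {s : Set E} (hs : Convex ℝ s) {D : ℝ}
    {x : OrdChain K m} (hx : x ∈ Finsupp.supported ℤ ℤ (smallTuples K s m D)) (N : ℕ) :
    (OrdChain.sd (bary hK) m ^ N) x ∈
      Finsupp.supported ℤ ℤ (smallTuples K s m ((m / (m + 1 : ℝ)) ^ N * D)) := by
  induction N with
  | zero => simpa using hx
  | succ N ih =>
    rw [pow_succ', pow_succ', Module.End.mul_apply, mul_assoc]
    exact sd_mem_smallTuples hK m s hs _ _ ih

end Small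

namespace SChain

variable {Y Z W : Type*} [TopologicalSpace Y] [TopologicalSpace Z] [TopologicalSpace W]

/-- The cover is pulled back to the standard simplex, where it has a Lebesgue number, while
diameters shrink like (m / (m + 1))^N. Asking for all large N allows finitely many simplices to be
treated together. -/
lemma eventually_sd_small {ι : Type*} [Nonempty ι] {U : ι → Set Y} (hU : ∀ i, IsOpen (U i))
    (hcov : ⋃ i, U i = Set.univ) {m : ℕ} (x : SChain Y m) :
    ∀ᶠ N in Filter.atTop,
      sd N m x ∈ Finsupp.supported ℤ ℤ {σ : C(Simplex m, Y) | ∃ i, Set.range σ ⊆ U i} := by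
  induction x using Finsupp.induction_linear with
  | zero => simp
  | add x y hx hy =>
    filter_upwards [hx, hy] with N h1 h2
    rw [_root_.map_add]
    exact add_mem h1 h2
  | single σ n =>
    obtain ⟨δ, hδ, hball⟩ := lebesgue_number_lemma_of_metric (s := (Set.univ : Set (Simplex m)))
      isCompact_univ (c := fun i => σ ⁻¹' U i) (fun i => (hU i).preimage σ.continuous) (by
        rw [← Set.preimage_iUnion, hcov]; simp)
    have hlim : Filter.Tendsto (fun N : ℕ => ((m : ℝ) / (m + 1)) ^ N * 1) Filter.atTop (𝓝 0) := by
      have := tendsto_pow_atTop_nhds_zero_of_lt_one (r := (m : ℝ) / (m + 1)) (by positivity)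
        (by rw [div_lt_one (by positivity)]; linarith)
      simpa using this
    filter_upwards [hlim.eventually (gt_mem_nhds hδ)] with N hN
    have hs : Finsupp.single σ n = n • Finsupp.single σ (1 : ℤ) := by simp
    rw [hs, map_smul, sd_single]
    refine Submodule.smul_mem _ _ ?_
    have hv : (Finsupp.single (vert m) 1 : OrdChain (Simplex m) m) ∈
        Finsupp.supported ℤ ℤ (smallTuples (Simplex m) Set.univ m 1) := by
      refine Finsupp.single_mem_supported ℤ _ ⟨fun i => trivial, fun i j => ?_⟩
      rw [← dist_eq_norm]
      exact (Metric.dist_le_diam_of_mem (bounded_stdSimplex _) (vert m i).2 (vert m j).2).trans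
        diam_stdSimplex_le
    have h1 := sd_pow_mem_smallTuples (convex_stdSimplex ℝ (Fin m)) m convex_univ hv N
    refine supported_le_comap (push σ m) _ (fun w hw => ?_) h1
    rw [push, ofOrd_single]
    refine Finsupp.single_mem_supported ℤ _ ?_
    cases m with
    | zero =>
      refine ⟨Classical.arbitrary ι, ?_⟩
      rintro _ ⟨t, -⟩
      have := t.2.2
      simp at this
    | succ m =>
      obtain ⟨i, hi⟩ := hball (w 0) trivial
      refine ⟨i, ?_⟩
      rintro _ ⟨t, rfl⟩
      refine hi ?_
      rw [Metric.mem_ball, Subtype.dist_eq]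
      refine lt_of_le_of_lt ?_ hN
      rw [← Metric.mem_closedBall, aff_coe]
      refine (convex_closedBall _ _).sum_mem (fun i _ => t.2.1 i) t.2.2 fun i _ => ?_
      rw [mem_closedBall_iff_norm]
      exact hw.2 i 0

lemma map_sd (f : C(Y, Z)) (N m : ℕ) (x : SChain Y m) : map f m (sd N m x) = sd N m (map f m x) := by
  have : map f m ∘ₗ sd N m = sd N m ∘ₗ map f m := by
    ext σ : 1
    apply LinearMap.ext_ring
    simp only [LinearMap.comp_apply, Finsupp.lsingle_apply, sd_single, map_single]
    generalize (OrdChain.sd (sbary m) m ^ N) (Finsupp.single (vert m) 1) = y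
    have : map f m ∘ₗ push σ m = push (f.comp σ) m := by
      ext σ : 1
      apply LinearMap.ext_ring
      simp [push, ContinuousMap.comp_assoc]
    exact LinearMap.congr_fun this y
  exact LinearMap.congr_fun this x

lemma sd_zero (m : ℕ) (x : SChain Y m) : sd 0 m x = x := by
  have : sd 0 m = LinearMap.id (R := ℤ) (M := SChain Y m) := by
    ext σ : 1
    apply LinearMap.ext_ring
    simp only [LinearMap.comp_apply, Finsupp.lsingle_apply, sd_single, pow_zero,
      Module.End.one_apply, push_vert, LinearMap.id_apply]
  exact LinearMap.congr_fun this x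

/-- Subdivision is homotopic to the identity. -/
lemma sub_sd (N m : ℕ) (x : SChain Y (m + 1)) :
    x - sd N _ x = d _ (prism N ContinuousMap.fst _ x) + prism N ContinuousMap.fst _ (d m x) := by
  have h : ∀ t, atTime (ContinuousMap.fst : C(Y × unitInterval, Y)) t = ContinuousMap.id Y :=
    fun t => rfl
  rw [d_prism, h, h, map_id, map_id]

lemma map_injective {f : C(Y, Z)} (hf : Function.Injective f) (m : ℕ) :
    Function.Injective (map f m) :=
  Finsupp.mapDomain_injective fun σ τ h => by
    ext t
    exact hf (DFunLike.congr_fun h t)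

lemma exists_map_eq {f : C(Y, Z)} (hf : IsEmbedding f) {m : ℕ} {x : SChain Z m}
    (hx : x ∈ sub (Set.range f) m) : ∃ y, map f m y = x := by
  refine map_le_of_single LinearMap.id (LinearMap.range (map f m)) (fun σ hσ => ?_) hx
  choose g hg using fun t => hσ ⟨t, rfl⟩
  refine ⟨Finsupp.single ⟨g, ?_⟩ 1, ?_⟩
  · rw [hf.continuous_iff]
    convert σ.continuous
    exact funext hg
  · rw [map_single]
    congr 1
    ext t
    exact hg t

lemma map_mem_range (f : C(Y, Z)) {m : ℕ} (x : SChain Y m) : map f m x ∈ sub (Set.range f) m :=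
  map_mem (A := Set.univ) f (fun a _ => Set.mem_range_self a) (by rw [sub_univ]; trivial)

lemma mem_sub_of_map_mem {f : C(Y, Z)} (hf : Function.Injective f) {A : Set Z} {m : ℕ}
    {x : SChain Y m} (hx : map f m x ∈ sub A m) : x ∈ sub (f ⁻¹' A) m := by
  classical
  rw [sub, Finsupp.mem_supported] at hx ⊢
  rw [map, Finsupp.lmapDomain_apply, Finsupp.mapDomain_support_of_injective (fun σ τ h => by
    ext t
    exact hf (DFunLike.congr_fun h t))] at hx
  intro σ hσ
  rintro _ ⟨t, rfl⟩
  exact hx (Finset.mem_coe.2 (Finset.mem_image_of_mem _ hσ)) ⟨t, rfl⟩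

lemma map_mem_iff {f : C(Y, Z)} (hf : Function.Injective f) {A : Set Z} {m : ℕ}
    {x : SChain Y m} : map f m x ∈ sub A m ↔ x ∈ sub (f ⁻¹' A) m :=
  ⟨mem_sub_of_map_mem hf, fun h => map_mem f (fun _ h => h) h⟩

/-- A nonempty simplex lies in at most one of the disjoint sets, so no cancellation occurs between
the summands. -/
lemma mem_sub_of_sum_mem {β : Type*} [Fintype β] {R : β → Set Y}
    (hR : Pairwise fun b c => Disjoint (R b) (R c)) {V : Set Y} {m : ℕ} {y : β → SChain Y m}
    (hy : ∀ b, y b ∈ sub (R b) m) (hsum : ∑ b, y b ∈ sub V m) (b : β) : y b ∈ sub V m := by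
  cases m with
  | zero => rw [sub_zero]; trivial
  | succ m =>
    rw [sub, Finsupp.mem_supported] at hsum ⊢
    intro σ hσ
    refine hsum ?_
    rw [Finset.mem_coe, Finsupp.mem_support_iff] at hσ ⊢
    rw [Finsupp.finsetSum_apply, Finset.sum_eq_single b]
    · exact hσ
    · intro c _ hc
      by_contra h
      have h1 : Set.range σ ⊆ R c := hy c (Finsupp.mem_support_iff.2 h)
      have h2 : Set.range σ ⊆ R b := hy b (Finsupp.mem_support_iff.2 hσ)
      exact Set.disjoint_left.1 (hR hc) (h1 ⟨vert _ 0, rfl⟩) (h2 ⟨vert _ 0, rfl⟩)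
    · simp

end SChain

end HigherTree

end

noncomputable section

namespace HigherTree

open SChain

/-! ### Relative homology -/

section RelHom

variable {Y Z W : Type*} [TopologicalSpace Y] [TopologicalSpace Z] [TopologicalSpace W]

/-- Relative cycles of dimension `n`. -/
def relCycles (A : Set Y) (n : ℕ) : Submodule ℤ (SChain Y (n + 1)) := (sub A n).comap (d n)

/-- Relative boundaries of dimension `n`. -/
def relBoundaries (A : Set Y) (n : ℕ) : Submodule ℤ (SChain Y (n + 1)) :=
  LinearMap.range (d (n + 1)) ⊔ sub A (n + 1)

/-- Relative singular homology, in terms of chains of the ambient space. -/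
abbrev RelHom (A : Set Y) (n : ℕ) := relCycles A n ⧸ (relBoundaries A n).submoduleOf (relCycles A n)

namespace RelHom

variable {A : Set Y} {B : Set Z} {n : ℕ}

/-- The class of a relative cycle. -/
def mk (x : SChain Y (n + 1)) (hx : d n x ∈ sub A n) : RelHom A n :=
  Submodule.Quotient.mk ⟨x, hx⟩

lemma exists_mk (h : RelHom A n) : ∃ x hx, mk x hx = h := by
  obtain ⟨x, rfl⟩ := Submodule.Quotient.mk_surjective _ h
  exact ⟨x.1, x.2, rfl⟩

lemma mem_relBoundaries {x : SChain Y (n + 1)} :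
    x ∈ relBoundaries A n ↔ ∃ e, ∃ a ∈ sub A (n + 1), x = d (n + 1) e + a := by
  rw [relBoundaries, Submodule.mem_sup]
  constructor
  · rintro ⟨_, ⟨e, rfl⟩, a, ha, rfl⟩
    exact ⟨e, a, ha, rfl⟩
  · rintro ⟨e, a, ha, rfl⟩
    exact ⟨_, ⟨e, rfl⟩, a, ha, rfl⟩

lemma mk_eq_zero {x : SChain Y (n + 1)} {hx : d n x ∈ sub A n} :
    mk x hx = 0 ↔ ∃ e, ∃ a ∈ sub A (n + 1), x = d (n + 1) e + a := by
  rw [mk, Submodule.Quotient.mk_eq_zero, ← mem_relBoundaries]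
  rfl

lemma mk_eq_mk {x y : SChain Y (n + 1)} {hx : d n x ∈ sub A n} {hy : d n y ∈ sub A n} :
    mk x hx = mk y hy ↔ ∃ e, ∃ a ∈ sub A (n + 1), x - y = d (n + 1) e + a := by
  rw [mk, mk, Submodule.Quotient.eq, ← mem_relBoundaries]
  rfl

lemma mk_add {x y : SChain Y (n + 1)} (hx : d n x ∈ sub A n) (hy : d n y ∈ sub A n) :
    mk x hx + mk y hy = mk (x + y) (by rw [map_add]; exact add_mem hx hy) := rfl

lemma smul_mk {x : SChain Y (n + 1)} (k : ℤ) (hx : d n x ∈ sub A n) :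
    k • mk x hx = mk (k • x) (by rw [map_smul]; exact Submodule.smul_mem _ _ hx) := rfl

lemma mk_sum {ι : Type*} (s : Finset ι) (x : ι → SChain Y (n + 1))
    (hx : ∀ i, d n (x i) ∈ sub A n) :
    ∑ i ∈ s, mk (x i) (hx i) =
      mk (∑ i ∈ s, x i) (by rw [map_sum]; exact Submodule.sum_mem _ fun i _ => hx i) := by
  classical
  induction s using Finset.induction_on with
  | empty => simp only [Finset.sum_empty]; rfl
  | insert a s ha ih => simp only [Finset.sum_insert ha, ih, mk_add]

lemma map_rel {f : C(Y, Z)} (hf : Set.MapsTo f A B) {x : SChain Y (n + 1)}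
    (hx : d n x ∈ sub A n) : d n (SChain.map f _ x) ∈ sub B n := by
  rw [d_map]
  exact map_mem f hf hx

/-- The map induced by a map of pairs. -/
def map (f : C(Y, Z)) (hf : Set.MapsTo f A B) (n : ℕ) : RelHom A n →ₗ[ℤ] RelHom B n :=
  Submodule.mapQ _ _ ((SChain.map f (n + 1)).restrict fun _ hx => map_rel hf hx) (by
    rintro ⟨x, hx⟩ hx'
    obtain ⟨e, a, ha, rfl⟩ := mem_relBoundaries.1 (show x ∈ relBoundaries A n from hx')
    refine mem_relBoundaries.2 ⟨SChain.map f _ e, SChain.map f _ a, map_mem f hf ha, ?_⟩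
    rw [d_map, ← map_add]
    rfl)

lemma map_mk (f : C(Y, Z)) (hf : Set.MapsTo f A B) {x : SChain Y (n + 1)}
    (hx : d n x ∈ sub A n) : map f hf n (mk x hx) = mk (SChain.map f _ x) (map_rel hf hx) := rfl

lemma map_comp {D : Set W} (f : C(Y, Z)) (hf : Set.MapsTo f A B) (g : C(Z, W))
    (hg : Set.MapsTo g B D) (hgf : Set.MapsTo (g.comp f) A D) (h : RelHom A n) :
    map g hg n (map f hf n h) = map (g.comp f) hgf n h := by
  obtain ⟨x, hx, rfl⟩ := exists_mk h
  simp only [map_mk, SChain.map_map]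

lemma map_id (hA : Set.MapsTo (ContinuousMap.id Y) A A) (h : RelHom A n) :
    map (ContinuousMap.id Y) hA n h = h := by
  obtain ⟨x, hx, rfl⟩ := exists_mk h
  simp only [map_mk, SChain.map_id]

lemma map_congr {f g : C(Y, Z)} (hfg : f = g) (hf : Set.MapsTo f A B) (h : RelHom A n) :
    map f hf n h = map g (hfg ▸ hf) n h := by
  subst hfg; rfl

/-- Homotopy invariance for maps of pairs. -/
lemma map_atTime_eq (H : C(Y × unitInterval, Z)) (hH : ∀ y ∈ A, ∀ t, H (y, t) ∈ B)
    (h1 : Set.MapsTo (atTime H 1) A B) (h0 : Set.MapsTo (atTime H 0) A B) (h : RelHom A n) :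
    map (atTime H 1) h1 n h = map (atTime H 0) h0 n h := by
  obtain ⟨x, hx, rfl⟩ := exists_mk h
  rw [map_mk, map_mk, mk_eq_mk]
  refine ⟨prism 0 H _ x, prism 0 H _ (d n x), prism_mem 0 H hH hx, ?_⟩
  rw [d_prism, sd_zero]

lemma mk_sd {x : SChain Y (n + 1)} (hx : d n x ∈ sub A n) (N : ℕ) :
    mk (sd N _ x) (by rw [d_sd]; exact sd_mem N hx) = mk x hx := by
  symm
  rw [mk_eq_mk, sub_sd]
  exact ⟨_, _, prism_mem N _ (fun y hy _ => hy) hx, rfl⟩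

/-- Excision: if `Y` is covered by an open set `V` and disjoint open copies of `U`, which meet `V`
in copies of `D`, then the homology of `(Y, V)` is a sum of copies of that of `(U, D)`. -/
theorem excision {β : Type*} [Fintype β] {V : Set Y} (hV : IsOpen V) {D : Set Z}
    (j : β → C(Z, Y)) (hj : ∀ b, IsOpenEmbedding (j b)) (hD : ∀ b, j b ⁻¹' V = D)
    (hdisj : Pairwise fun b c => Disjoint (Set.range (j b)) (Set.range (j c)))
    (hcov : V ∪ ⋃ b, Set.range (j b) = Set.univ) (n : ℕ) :
    Function.Bijective fun ξ : β → RelHom D n =>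
      ∑ b, map (B := V) (j b) (by rw [← hD b]; exact Set.mapsTo_preimage _ _) n (ξ b) := by
  -- After enough subdivisions each simplex of the chain lies in `V` or in one of the pieces.
  have small : ∀ (m : ℕ) (x : SChain Y m), ∃ N, ∃ v ∈ sub V m, ∃ z : β → SChain Z m,
      sd N m x = v + ∑ b, SChain.map (j b) m (z b) := by
    intro m x
    obtain ⟨N, hN⟩ := (eventually_sd_small (U := fun b : Option β => b.elim V
      fun b => Set.range (j b)) (by
        rintro (_ | b)
        · exact hV
        · exact (hj b).isOpen_range) (by
        rw [← hcov, Set.iUnion_option]; rfl) x).exists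
    have h2 := supported_le_comap LinearMap.id
      (sub V m ⊔ LinearMap.range (∑ b, SChain.map (j b) m ∘ₗ LinearMap.proj (R := ℤ)
        (φ := fun _ : β => SChain Z m) b)) (fun σ hσ => ?_) hN
    · obtain ⟨v, hv, _, ⟨z, rfl⟩, hx⟩ := Submodule.mem_sup.1 h2
      refine ⟨N, v, hv, z, hx.symm.trans ?_⟩
      simp
    · obtain ⟨_ | b, hb⟩ := hσ
      · exact Submodule.mem_sup_left (single_mem_sub hb 1)
      · obtain ⟨z, hz⟩ := exists_map_eq (hj b).isEmbedding (single_mem_sub hb 1)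
        classical
        refine Submodule.mem_sup_right ⟨Pi.single b z, ?_⟩
        rw [LinearMap.id_apply, ← hz, LinearMap.sum_apply, Finset.sum_eq_single b]
        · simp
        · intro c _ hc
          simp [hc]
        · simp
  have inj := fun b => (hj b).injective
  constructor
  · let F : (β → RelHom D n) →ₗ[ℤ] RelHom V n :=
      ∑ b, map (B := V) (j b) (by rw [← hD b]; exact Set.mapsTo_preimage _ _) n ∘ₗ
        LinearMap.proj b
    have hF : ∀ ξ, F ξ = ∑ b, map (B := V) (j b) (by rw [← hD b]; exact Set.mapsTo_preimage _ _) n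
        (ξ b) := fun ξ => by simp [F]
    simp only [← hF]
    rw [injective_iff_map_eq_zero]
    intro ξ hξ
    rw [hF] at hξ
    choose z hz hzξ using fun b => exists_mk (ξ b)
    simp only [← hzξ, map_mk] at hξ
    rw [mk_sum, mk_eq_zero] at hξ
    obtain ⟨e, v, hv, hev⟩ := hξ
    obtain ⟨N, w, hw, y, hy⟩ := small _ e
    -- The summands on the left lie in disjoint pieces and the right side lies in `V`; hence each
    -- summand lies in `V`, that is, in the copy of `D`.
    have key : ∑ b, SChain.map (j b) _ (sd N _ (z b) - d _ (y b)) = d _ w + sd N _ v := by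
      have h1 := congrArg (sd N _) hev
      rw [map_add, ← d_sd, hy, map_add, map_sum, map_sum] at h1
      simp only [map_sub, Finset.sum_sub_distrib, SChain.map_sd, h1, d_map]
      abel
    funext b
    have h2 := mem_sub_of_sum_mem hdisj (fun b => map_mem_range (j b) (sd N _ (z b) - d _ (y b)))
      (by rw [key]; exact add_mem (d_mem hw) (sd_mem N hv)) b
    rw [map_mem_iff (inj b), hD] at h2
    rw [← hzξ, ← mk_sd (hz b) N, Pi.zero_apply, mk_eq_zero]
    exact ⟨y b, _, h2, by abel⟩
  · intro h
    obtain ⟨x, hx, rfl⟩ := exists_mk h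
    obtain ⟨N, v, hv, z, hz⟩ := small _ x
    have hdz : ∀ b, d n (z b) ∈ sub D n := by
      intro b
      rw [← hD b, ← map_mem_iff (inj b)]
      refine mem_sub_of_sum_mem hdisj (fun b => map_mem_range (j b) (d n (z b))) ?_ b
      have h1 := congrArg (d n) hz
      rw [d_sd, map_add, map_sum] at h1
      simp only [d_map] at h1
      rw [← sub_eq_of_eq_add' h1]
      exact sub_mem (sd_mem N hx) (d_mem hv)
    refine ⟨fun b => mk (z b) (hdz b), ?_⟩
    simp only [map_mk]
    rw [mk_sum, ← mk_sd hx N, mk_eq_mk]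
    exact ⟨0, -v, neg_mem hv, by rw [hz, map_zero]; abel⟩

/-- If `A'` deforms into `A` then the homology relative to `A` and to `A'` agrees. -/
theorem bijective_of_deformation {A A' : Set Y} (G : C(A' × unitInterval, A'))
    (h0 : ∀ a, G (a, 0) = a) (h1 : ∀ a, (G (a, 1) : Y) ∈ A)
    (hG : ∀ a : A', (a : Y) ∈ A → ∀ t, (G (a, t) : Y) ∈ A)
    (hid : Set.MapsTo (ContinuousMap.id Y) A A') (n : ℕ) :
    Function.Bijective (map (ContinuousMap.id Y) hid n) := by
  let val : C(A', Y) := ⟨Subtype.val, continuous_subtype_val⟩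
  have hval : IsEmbedding val := IsEmbedding.subtypeVal
  have hrange : Set.range val = A' := Subtype.range_coe
  have lift : ∀ {m} {x : SChain Y m}, x ∈ sub A' m → ∃ y, SChain.map val m y = x :=
    fun hx => exists_map_eq hval (by rwa [hrange])
  have hG0 : atTime G 0 = ContinuousMap.id _ := ContinuousMap.ext h0
  have hG1 : ∀ {m} (y : SChain A' m), SChain.map val m (SChain.map (atTime G 1) m y) ∈ sub A m := by
    intro m y
    rw [SChain.map_map]
    exact map_mem (A := Set.univ) _ (fun a _ => h1 a) (by rw [sub_univ]; trivial)
  -- The prism of `G` joins a chain of A' to its image at time one, a chain of A. Correcting by it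
  -- replaces the long exact sequence of the triple.
  have hprism := fun (m) (y : SChain A' (m + 1)) => d_prism 0 G m y
  simp only [sd_zero, hG0, SChain.map_id] at hprism
  have hmem : ∀ {m} {y : SChain A' m}, SChain.map val m y ∈ sub A m →
      SChain.map val _ (prism 0 G m y) ∈ sub A (m + 1) := by
    intro m y hy
    have h1 := (map_mem_iff hval.injective).1 hy
    exact (map_mem_iff hval.injective).2 (prism_mem (B := val ⁻¹' A) 0 G hG h1)
  constructor
  · rw [injective_iff_map_eq_zero]
    intro h hh
    obtain ⟨x, hx, rfl⟩ := exists_mk h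
    rw [map_mk, mk_eq_zero, SChain.map_id] at hh
    obtain ⟨e, a, ha, rfl⟩ := hh
    obtain ⟨y, rfl⟩ := lift ha
    rw [map_add, d_d, zero_add, d_map] at hx
    have h2 := congrArg (SChain.map val _) (hprism n y)
    rw [map_add, map_sub, ← d_map] at h2
    rw [mk_eq_zero]
    refine ⟨e - SChain.map val _ (prism 0 G _ y), SChain.map val _ (SChain.map (atTime G 1) _ y)
      - SChain.map val _ (prism 0 G _ (d n y)), sub_mem (hG1 y) (hmem hx), ?_⟩
    rw [map_sub, eq_sub_of_add_eq h2]
    abel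
  · intro h
    obtain ⟨x, hx, rfl⟩ := exists_mk h
    cases n with
    | zero =>
      refine ⟨mk x (by rw [SChain.sub_zero]; trivial), ?_⟩
      rw [map_mk, mk_eq_mk]
      exact ⟨0, 0, zero_mem _, by simp [SChain.map_id]⟩
    | succ n =>
      obtain ⟨y, hy⟩ := lift hx
      -- As the boundary of `x`, `y` is a cycle; the boundary of its prism is therefore the image of
      -- `y` at time one minus `y`, and adding the prism to `x` moves its boundary into A.
      have hdy : d n y = 0 := by
        apply map_injective hval.injective
        rw [← d_map, hy, d_d, map_zero]
      have h2 := congrArg (SChain.map val _) (hprism n y)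
      rw [hdy, map_zero, add_zero, map_sub, ← d_map, hy] at h2
      refine ⟨mk (x + SChain.map val _ (prism 0 G _ y)) ?_, ?_⟩
      · rw [map_add, h2, add_sub_cancel]
        exact hG1 y
      · rw [map_mk, mk_eq_mk]
        refine ⟨0, SChain.map val _ (prism 0 G _ y), ?_, by simp [SChain.map_id]⟩
        have h3 := map_mem_range val (prism 0 G _ y)
        rwa [hrange] at h3

end RelHom

end RelHom

end HigherTree

end

/-! ### Acyclicity of contractible spaces and the local homology of Euclidean space. -/

noncomputable section

namespace HigherTree

open SChain

/-! ### Contractible spaces are acyclic -/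

section Acyclic

variable {Y : Type*} [TopologicalSpace Y]

/-- The constant singular simplex. -/
def constChain (p : Y) (m : ℕ) : SChain Y m := Finsupp.single (ContinuousMap.const _ p) 1

lemma d_constChain (p : Y) (m : ℕ) :
    d m (constChain p (m + 1)) = if Even m then constChain p m else 0 := by
  rw [constChain, d_single]
  have : ∀ i : Fin (m + 1), (ContinuousMap.const (Simplex (m + 1)) p).comp (face i) =
      ContinuousMap.const _ p := fun i => rfl
  simp only [this, ← Finset.sum_smul, Fin.sum_neg_one_pow, Nat.even_add_one]
  split_ifs <;> simp_all [constChain]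

lemma exists_map_const (p : Y) {m : ℕ} (x : SChain Y m) :
    ∃ k : ℤ, SChain.map (ContinuousMap.const Y p) m x = k • constChain p m := by
  induction x using Finsupp.induction_linear with
  | zero => exact ⟨0, by simp⟩
  | add x y hx hy =>
    obtain ⟨k, hk⟩ := hx
    obtain ⟨l, hl⟩ := hy
    exact ⟨k + l, by rw [map_add, hk, hl, add_smul]⟩
  | single σ n =>
    refine ⟨n, ?_⟩
    rw [map_single, constChain, Finsupp.smul_single, smul_eq_mul, mul_one]
    rfl

lemma exists_d_eq_zero [Nonempty Y] (x : SChain Y 0) : ∃ e, d 0 e = x := by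
  let p : Y := Classical.arbitrary Y
  have : ∀ σ : C(Simplex 0, Y), σ = ContinuousMap.const _ p := by
    intro σ
    ext t
    have := t.2.2
    simp at this
  induction x using Finsupp.induction_linear with
  | zero => exact ⟨0, by simp⟩
  | add x y hx hy =>
    obtain ⟨k, hk⟩ := hx
    obtain ⟨l, hl⟩ := hy
    exact ⟨k + l, by rw [map_add, hk, hl]⟩
  | single σ n =>
    refine ⟨n • constChain p 1, ?_⟩
    rw [map_smul, d_constChain, if_pos (by simp), constChain, Finsupp.smul_single, this σ]
    simp

/-- The contraction makes `x` homologous to a multiple of a constant simplex. By parity, either the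
constant simplex bounds the constant simplex one degree higher, or it is not a cycle and the
multiple is zero. -/
lemma exists_d_eq_succ [ContractibleSpace Y] {m : ℕ} {x : SChain Y (m + 1)} (hx : d m x = 0) :
    ∃ e, d (m + 1) e = x := by
  obtain ⟨p, ⟨F⟩⟩ := id_nullhomotopic Y
  let H : C(Y × unitInterval, Y) := F.toContinuousMap.comp ContinuousMap.prodSwap
  have h0 : atTime H 0 = ContinuousMap.id Y := by
    ext y
    exact F.apply_zero y
  have h1 : atTime H 1 = ContinuousMap.const Y p := by
    ext y
    exact F.apply_one y
  have key := d_prism 0 H m x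
  rw [hx, map_zero, add_zero, sd_zero, h0, h1, SChain.map_id] at key
  obtain ⟨k, hk⟩ := exists_map_const p x
  suffices ∃ e, d (m + 1) e = k • constChain p (m + 1) by
    obtain ⟨e, he⟩ := this
    exact ⟨e - prism 0 H _ x, by rw [map_sub, he, key, hk]; abel⟩
  by_cases hm : Even m
  · have h3 : d m (k • constChain p (m + 1)) = 0 := by rw [← hk, d_map, hx, map_zero]
    rw [map_smul, d_constChain, if_pos hm, constChain, Finsupp.smul_single,
      Finsupp.single_eq_zero] at h3
    have : k = 0 := by simpa using h3
    exact ⟨0, by simp [this]⟩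
  · refine ⟨k • constChain p (m + 2), ?_⟩
    rw [map_smul, d_constChain, if_pos (by rwa [Nat.even_add_one])]

/-- A chain whose boundary lies in a contractible subspace becomes an absolute cycle after a
correction inside that subspace. -/
lemma exists_d_eq_sub {W : Set Y} [ContractibleSpace W] {m : ℕ} {x : SChain Y (m + 1)}
    (hx : d m x ∈ sub W m) : ∃ w ∈ sub W (m + 1), d m w = d m x := by
  let val : C(W, Y) := ⟨Subtype.val, continuous_subtype_val⟩
  have hval : IsEmbedding val := IsEmbedding.subtypeVal
  have hr : Set.range val = W := Subtype.range_coe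
  obtain ⟨y, hy⟩ := exists_map_eq hval (x := d m x) (by rwa [hr])
  have : ∃ e, d m e = y := by
    cases m with
    | zero => exact exists_d_eq_zero y
    | succ m =>
      refine exists_d_eq_succ (map_injective hval.injective _ ?_)
      rw [← d_map, hy, d_d, map_zero]
  obtain ⟨e, rfl⟩ := this
  refine ⟨SChain.map val _ e, ?_, by rw [d_map, hy]⟩
  have := map_mem_range val e
  rwa [hr] at this

end Acyclic

/-! ### Local homology of Euclidean space -/

/-- The element generates a free module of rank one. -/
def IsGen {M : Type*} [AddCommGroup M] (γ : M) : Prop := Function.Bijective fun k : ℤ => k • γ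

lemma IsGen.map {M N : Type*} [AddCommGroup M] [AddCommGroup N] {γ : M} (h : IsGen γ)
    {F : M →ₗ[ℤ] N} (hF : Function.Bijective F) : IsGen (F γ) := by
  have := hF.comp h
  simpa [IsGen, Function.comp_def] using this

lemma IsGen.exists_of_bijective {M N : Type*} [AddCommGroup M] [AddCommGroup N] {γ : N}
    (h : IsGen γ) {F : M →ₗ[ℤ] N} (hF : Function.Bijective F) : ∃ γ' : M, F γ' = γ ∧ IsGen γ' := by
  obtain ⟨γ', rfl⟩ := hF.surjective γ
  refine ⟨γ', rfl, ?_⟩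
  refine (hF.of_comp_iff' _).1 ?_
  simpa [IsGen, Function.comp_def] using h

section Local

variable {Y Z : Type*} [TopologicalSpace Y] [TopologicalSpace Z]

/-- The connecting map of a triple with contractible largest and smallest space preserves
generators. -/
lemma exists_isGen_succ [ContractibleSpace Y] {P W : Set Y} (hWP : W ⊆ P) [ContractibleSpace W]
    {n : ℕ} (h : ∃ γ : RelHom ((↑) ⁻¹' W : Set P) n, IsGen γ) :
    ∃ γ : RelHom P (n + 1), IsGen γ := by
  obtain ⟨γ, hγ⟩ := h
  obtain ⟨g, hg, rfl⟩ := RelHom.exists_mk γ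
  let val : C(P, Y) := ⟨Subtype.val, continuous_subtype_val⟩
  have hval : IsEmbedding val := IsEmbedding.subtypeVal
  have hr : Set.range val = P := Subtype.range_coe
  have lift : ∀ {m} {x : SChain Y m}, x ∈ sub P m → ∃ y, SChain.map val m y = x :=
    fun hx => exists_map_eq hval (by rwa [hr])
  have memP : ∀ {m} (x : SChain P m), SChain.map val m x ∈ sub P m := fun x => by
    have := map_mem_range val x
    rwa [hr] at this
  have hg' : d n (SChain.map val _ g) ∈ sub W n := by
    rw [d_map, map_mem_iff hval.injective]
    exact hg
  -- The generator is closed up inside `W` and the resulting cycle is filled in `Y`. The filling `c`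
  -- represents the preimage of the generator under H_{n+1}(Y, P) ≅ H_n(P) ≅ H_n(P, W), in augmented
  -- homology.
  obtain ⟨w, hw, hdw⟩ := exists_d_eq_sub hg'
  obtain ⟨c, hc⟩ := exists_d_eq_succ (x := SChain.map val _ g - w)
    (by rw [map_sub, hdw, sub_self])
  have hcP : d (n + 1) c ∈ sub P (n + 1) := by
    rw [hc]
    exact sub_mem (memP g) (sub_mono hWP _ hw)
  refine ⟨RelHom.mk c hcP, ?_, ?_⟩
  · intro k l hkl
    rw [← sub_eq_zero] at hkl ⊢
    have h0 : (k - l) • RelHom.mk c hcP = 0 := by rw [sub_smul]; exact hkl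
    generalize k - l = k at h0
    rw [RelHom.smul_mk, RelHom.mk_eq_zero] at h0
    obtain ⟨e, a, ha, hea⟩ := h0
    obtain ⟨a, rfl⟩ := lift ha
    obtain ⟨w, rfl⟩ := lift (sub_mono hWP _ hw)
    have h1 := congrArg (d _) hea
    rw [map_smul, map_add, d_d, zero_add, hc, ← map_sub, d_map, ← map_smul] at h1
    have h2 := map_injective hval.injective _ h1
    have h3 : k • RelHom.mk g hg = 0 := by
      rw [RelHom.smul_mk, RelHom.mk_eq_zero]
      refine ⟨a, k • w, Submodule.smul_mem _ _ ((map_mem_iff hval.injective).1 hw), ?_⟩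
      rw [← h2, smul_sub]
      abel
    exact hγ.injective (by simpa using h3)
  · intro h
    obtain ⟨z, hz, rfl⟩ := RelHom.exists_mk h
    obtain ⟨ζ, hζ⟩ := lift hz
    have hζ0 : d n ζ = 0 := by
      apply map_injective hval.injective
      rw [← d_map, hζ, d_d, map_zero]
    -- The multiple is read off from the boundary of `z`; then z - k c has, up to chains in `P`, a
    -- boundary in `W`, and it can be filled in `Y`.
    obtain ⟨k, hk⟩ := hγ.surjective (RelHom.mk ζ (by rw [hζ0]; exact zero_mem _))
    refine ⟨k, ?_⟩
    simp only at hk ⊢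
    rw [eq_comm, RelHom.smul_mk, RelHom.mk_eq_mk] at hk
    rw [eq_comm, RelHom.smul_mk, RelHom.mk_eq_mk]
    obtain ⟨e, a, ha, hea⟩ := hk
    have ha' : SChain.map val _ a ∈ sub W _ := (map_mem_iff hval.injective).2 ha
    have h1 := congrArg (SChain.map val _) hea
    rw [map_sub, hζ, map_add, map_smul, ← d_map, ← sub_add_cancel (SChain.map val _ g) w,
      ← hc] at h1
    have h2 : d _ (z - k • c - SChain.map val _ e) = SChain.map val _ a + k • w := by
      rw [map_sub, map_sub, map_smul]
      rw [smul_add] at h1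
      rw [sub_eq_iff_eq_add] at h1
      rw [h1]
      abel
    obtain ⟨w', hw', hdw'⟩ := exists_d_eq_sub (W := W) (x := z - k • c - SChain.map val _ e)
      (by rw [h2]; exact add_mem ha' (Submodule.smul_mem _ _ hw))
    obtain ⟨f, hf⟩ := exists_d_eq_succ (x := z - k • c - SChain.map val _ e - w')
      (by rw [map_sub, hdw', sub_self])
    refine ⟨f, SChain.map val _ e + w', add_mem (memP e) (sub_mono hWP _ hw'), ?_⟩
    rw [hf]
    abel

lemma bijective_of_homotopyInverse {A : Set Y} {B : Set Z} (f : C(Y, Z)) (hf : Set.MapsTo f A B)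
    (g : C(Z, Y)) (hg : Set.MapsTo g B A) (hfg : f.comp g = ContinuousMap.id Z)
    (H : C(Y × unitInterval, Y)) (h1 : atTime H 1 = ContinuousMap.id Y)
    (h0 : atTime H 0 = g.comp f) (hH : ∀ y ∈ A, ∀ t, H (y, t) ∈ A) (n : ℕ) :
    Function.Bijective (RelHom.map g hg n) := by
  refine Function.bijective_iff_has_inverse.2 ⟨RelHom.map f hf n, fun h => ?_, fun h => ?_⟩
  · have hid : Set.MapsTo (ContinuousMap.id Z) B B := fun _ h => h
    rw [RelHom.map_comp g hg f hf (hfg ▸ hid), RelHom.map_congr hfg, RelHom.map_id]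
  · have hid : Set.MapsTo (ContinuousMap.id Y) A A := fun _ h => h
    have hgf : Set.MapsTo (g.comp f) A A := fun x hx => hg (hf hx)
    rw [RelHom.map_comp f hf g hg hgf, RelHom.map_congr h0.symm,
      ← RelHom.map_atTime_eq H hH (h1 ▸ hid), RelHom.map_congr h1, RelHom.map_id]

/-- For a point relative to the empty set, the two faces of the only 1-simplex cancel, so
degree-zero chains are homology. -/
lemma exists_isGen_zero : ∃ γ : RelHom ({0}ᶜ : Set (Fin 0 → ℝ)) 0, IsGen γ := by
  have hsub : Subsingleton C(Simplex 1, Fin 0 → ℝ) := ⟨fun σ τ => by ext t i; exact i.elim0⟩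
  let τ : C(Simplex 1, Fin 0 → ℝ) := ContinuousMap.const _ 0
  have hd : ∀ e : SChain (Fin 0 → ℝ) 2, d 1 e = 0 := by
    intro e
    have : d 1 = (0 : SChain (Fin 0 → ℝ) 2 →ₗ[ℤ] _) := by
      ext σ : 1
      apply LinearMap.ext_ring
      simp [d_single, Fin.sum_univ_succ, Subsingleton.elim _ τ]
    rw [this]; rfl
  have ha : ∀ a ∈ sub ({0}ᶜ : Set (Fin 0 → ℝ)) 1, a = 0 := by
    intro a ha
    ext σ
    by_contra h
    have := ha (Finsupp.mem_support_iff.2 h) ⟨vert 1 0, rfl⟩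
    exact this (Subsingleton.elim _ _)
  refine ⟨RelHom.mk (Finsupp.single τ 1) (by rw [SChain.sub_zero]; trivial), ?_, ?_⟩
  · intro k l hkl
    simp only [RelHom.smul_mk, RelHom.mk_eq_mk] at hkl
    obtain ⟨e, a, ha', h⟩ := hkl
    rw [hd, ha a ha', add_zero, sub_eq_zero] at h
    simpa using DFunLike.congr_fun h τ
  · intro h
    obtain ⟨x, hx, rfl⟩ := RelHom.exists_mk h
    refine ⟨x τ, ?_⟩
    simp only [RelHom.smul_mk]
    congr 1
    ext σ
    rw [Subsingleton.elim σ τ]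
    simp

/-- Inside the punctured space `P`, let `W` be the complement of a closed half-line from the origin.
It is contractible, so H_{n+1}(ℝ^{n+1}, P) ≅ H_n(P, W). Excision to the open half-space `U` around
the removed ray, followed by projection along the ray, identifies the latter with H_n(ℝⁿ, ℝⁿ ∖ 0).
-/
lemma exists_isGen_euclidean (n : ℕ) : ∃ γ : RelHom ({0}ᶜ : Set (Fin n → ℝ)) n, IsGen γ := by
  induction n with
  | zero => exact exists_isGen_zero
  | succ n ih =>
    let P : Set (Fin (n + 1) → ℝ) := {0}ᶜ
    let W : Set (Fin (n + 1) → ℝ) := {x | Fin.tail x ≠ 0 ∨ x 0 < 0}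
    let U : Set (Fin (n + 1) → ℝ) := {x | 0 < x 0}
    have htail : Continuous fun x : Fin (n + 1) → ℝ => Fin.tail x :=
      continuous_pi fun i => continuous_apply _
    have hWP : W ⊆ P := by
      rintro x hx rfl
      rcases hx with hx | hx
      · exact hx rfl
      · exact lt_irrefl _ hx
    have hUP : U ⊆ P := by
      rintro x hx rfl
      exact lt_irrefl (0 : ℝ) hx
    have hUo : IsOpen U := isOpen_lt continuous_const (continuous_apply 0)
    have hWo : IsOpen W :=
      (isOpen_ne.preimage htail).union (isOpen_lt (continuous_apply 0) continuous_const)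
    -- The set is star-shaped about a point on the opposite half-line.
    have hW : ContractibleSpace W := by
      refine StarConvex.contractibleSpace (x := (Fin.cons (-1) 0 : Fin (n + 1) → ℝ)) ?_
        ⟨Fin.cons (-1) 0, Or.inr (by simp)⟩
      intro y hy a b ha hb hab
      have h0 : (a • (Fin.cons (-1) 0 : Fin (n + 1) → ℝ) + b • y) 0 = -a + b * y 0 := by simp
      have ht : Fin.tail (a • (Fin.cons (-1) 0 : Fin (n + 1) → ℝ) + b • y) = b • Fin.tail y := by
        ext i
        simp [Fin.tail]
      rcases hb.eq_or_lt with rfl | hb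
      · right
        rw [h0]
        linarith
      · rcases hy with hy | hy
        · left
          rw [ht]
          exact smul_ne_zero hb.ne' hy
        · right
          rw [h0]
          nlinarith
    refine exists_isGen_succ hWP ?_
    let j : C(U, P) := ⟨Set.inclusion hUP, continuous_inclusion hUP⟩
    have hj : IsOpenEmbedding j := by
      refine ⟨IsEmbedding.inclusion hUP, ?_⟩
      change IsOpen (Set.range (Set.inclusion hUP))
      rw [Set.range_inclusion]
      exact hUo.preimage continuous_subtype_val
    let D : Set U := j ⁻¹' ((↑) ⁻¹' W)
    have hDmem : ∀ u : U, u ∈ D ↔ Fin.tail u.1 ≠ 0 := fun u =>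
      or_iff_left (not_lt.2 (le_of_lt u.2))
    have hex := RelHom.excision (β := Unit) (V := ((↑) ⁻¹' W : Set P)) (D := D)
      (hWo.preimage continuous_subtype_val) (fun _ => j) (fun _ => hj) (fun _ => rfl)
      (fun a b hab => (hab rfl).elim) (by
        refine Set.eq_univ_of_forall fun x => ?_
        by_cases h : Fin.tail x.1 = 0
        · by_cases h' : x.1 0 < 0
          · exact Or.inl (Or.inr h')
          · right
            have hx : 0 < x.1 0 := by
              refine lt_of_le_of_ne (not_lt.1 h') fun h0 => x.2 ?_
              rw [Set.mem_singleton_iff]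
              ext i
              refine Fin.cases h0.symm (fun i => ?_) i
              exact congrFun h i
            exact Set.mem_iUnion.2 ⟨(), ⟨⟨x.1, hx⟩, rfl⟩⟩
        · exact Or.inl (Or.inl h)) n
    have hex' : Function.Bijective (RelHom.map (A := D) (B := ((↑) ⁻¹' W : Set P)) j
        (Set.mapsTo_preimage _ _) n) := by
      have h2 := hex.comp (Equiv.funUnique Unit (RelHom D n)).symm.bijective
      simpa [Function.comp_def] using h2
    obtain ⟨γ, hγ⟩ := ih
    let s : C(Fin n → ℝ, U) := ⟨fun x => ⟨Fin.cons 1 x, by simp [U]⟩, by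
      refine Continuous.subtype_mk ?_ _
      fun_prop⟩
    let tl : C(U, Fin n → ℝ) := ⟨fun u => Fin.tail u.1, htail.comp continuous_subtype_val⟩
    have hs : Set.MapsTo s {0}ᶜ D := fun x hx => (hDmem _).2 (by simpa [s] using hx)
    have htl : Set.MapsTo tl D {0}ᶜ := fun u hu => (hDmem u).1 hu
    -- The first coordinate moves linearly between 1 and its value; the tail, which alone decides
    -- membership in `D`, is fixed.
    let H : C(U × unitInterval, U) :=
      ⟨fun p => ⟨Fin.cons ((1 - p.2.1) * 1 + p.2.1 * p.1.1 0) (Fin.tail p.1.1), by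
        have h0 : 0 < p.1.1 0 := p.1.2
        have h1 := p.2.2.1
        have h2 := p.2.2.2
        simp only [U, Set.mem_ofPred_eq, Fin.cons_zero]
        rcases h1.eq_or_lt with h | h
        · rw [← h]; norm_num
        · have := mul_pos h h0
          nlinarith⟩, by
        refine Continuous.subtype_mk ?_ _
        have hc : Continuous fun p : U × unitInterval => p.1.1 :=
          continuous_subtype_val.comp continuous_fst
        have hc' : ∀ i, Continuous fun p : U × unitInterval => p.1.1 i := fun i =>
          (continuous_apply i).comp hc
        have ht : Continuous fun p : U × unitInterval => p.2.1 :=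
          continuous_subtype_val.comp continuous_snd
        refine continuous_pi fun i => ?_
        refine Fin.cases ?_ (fun i => ?_) i
        · simp only [Fin.cons_zero]
          exact ((continuous_const.sub ht).mul continuous_const).add (ht.mul (hc' 0))
        · simp only [Fin.cons_succ, Fin.tail]
          exact hc' _⟩
    have hsb := bijective_of_homotopyInverse tl htl s hs (by ext x i; simp [tl, s]) H
      (by
        ext u i
        refine Fin.cases ?_ (fun i => ?_) i <;> simp [H])
      (by
        ext u i
        refine Fin.cases ?_ (fun i => ?_) i <;> simp [H, s, tl, Fin.tail])
      (fun u hu t => (hDmem _).2 (by simpa [H] using (hDmem u).1 hu)) n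
    exact ⟨_, (hγ.map hsb).map hex'⟩

/-- The homology of the open cube relative to an outer shell is infinite cyclic. -/
lemma exists_isGen_ball (n : ℕ) :
    ∃ γ : RelHom {x : Metric.ball (0 : Fin n → ℝ) 1 | 1 / 2 < ‖(x : Fin n → ℝ)‖} n, IsGen γ := by
  let V : Set (Fin n → ℝ) := {x | 1 / 2 < ‖x‖}
  have hV : IsOpen V := isOpen_lt continuous_const continuous_norm
  let j : C(Metric.ball (0 : Fin n → ℝ) 1, Fin n → ℝ) := ⟨Subtype.val, continuous_subtype_val⟩
  have hj : IsOpenEmbedding j := Metric.isOpen_ball.isOpenEmbedding_subtypeVal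
  have hex := RelHom.excision (β := Unit) hV (D := j ⁻¹' V) (fun _ => j) (fun _ => hj)
    (fun _ => rfl) (fun a b hab => (hab rfl).elim) (by
      refine Set.eq_univ_of_forall fun x => ?_
      by_cases h : 1 / 2 < ‖x‖
      · exact Or.inl h
      · right
        have : Set.range j = Metric.ball (0 : Fin n → ℝ) 1 := Subtype.range_coe
        rw [this]
        simp only [Set.iUnion_const, mem_ball_zero_iff]
        linarith) n
  have hex' : Function.Bijective (RelHom.map (A := j ⁻¹' V) (B := V) j
      (Set.mapsTo_preimage _ _) n) := by
    have h2 := hex.comp (Equiv.funUnique Unit (RelHom (j ⁻¹' V) n)).symm.bijective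
    simpa [Function.comp_def] using h2
  have hsub : Set.MapsTo (ContinuousMap.id (Fin n → ℝ)) V {0}ᶜ := by
    rintro x hx rfl
    have h1 : (1 : ℝ) / 2 < ‖(0 : Fin n → ℝ)‖ := hx
    rw [norm_zero] at h1
    norm_num at h1
  let P : Set (Fin n → ℝ) := {0}ᶜ
  have hP : ∀ x : P, 0 < ‖x.1‖ := fun x => norm_pos_iff.2 x.2
  have hmax : ∀ (x : P) (t : unitInterval), 1 ≤ max 1 (t.1 / ‖x.1‖) := fun _ _ => le_max_left _ _
  -- At time t points are pushed radially out to norm at least t, and norms never decrease; so the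
  -- region of norm above 1/2 is preserved and is reached from everywhere at time one.
  let G : C(P × unitInterval, P) := ⟨fun p => ⟨max 1 (p.2.1 / ‖p.1.1‖) • p.1.1,
    smul_ne_zero (by linarith [hmax p.1 p.2]) p.1.2⟩, by
      have hc : Continuous fun p : P × unitInterval => p.1.1 :=
        continuous_subtype_val.comp continuous_fst
      have ht : Continuous fun p : P × unitInterval => p.2.1 :=
        continuous_subtype_val.comp continuous_snd
      exact ((continuous_const.max (ht.div hc.norm fun p => (hP p.1).ne')).smul hc).subtype_mk _⟩
  have hnorm : ∀ (x : P) (t : unitInterval), ‖(G (x, t)).1‖ = max 1 (t.1 / ‖x.1‖) * ‖x.1‖ := by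
    intro x t
    change ‖max 1 (t.1 / ‖x.1‖) • x.1‖ = _
    rw [norm_smul, Real.norm_of_nonneg (by linarith [hmax x t])]
  have hdef := RelHom.bijective_of_deformation (A := V) (A' := P) G
    (by
      intro a
      ext1
      change max 1 ((0 : ℝ) / ‖a.1‖) • a.1 = a.1
      simp)
    (by
      intro a
      change 1 / 2 < ‖(G (a, 1)).1‖
      rw [hnorm]
      have h1 : (1 : unitInterval).1 / ‖a.1‖ ≤ max 1 ((1 : unitInterval).1 / ‖a.1‖) :=
        le_max_right _ _
      have h2 := mul_le_mul_of_nonneg_right h1 (hP a).le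
      rw [div_mul_cancel₀ _ (hP a).ne'] at h2
      refine lt_of_lt_of_le ?_ h2
      norm_num)
    (by
      intro a ha t
      change 1 / 2 < ‖(G (a, t)).1‖
      rw [hnorm]
      have h1 : (1 : ℝ) / 2 < ‖a.1‖ := ha
      nlinarith [hmax a t])
    hsub n
  obtain ⟨γ, hγ⟩ := exists_isGen_euclidean n
  obtain ⟨γ', -, h'⟩ := hγ.exists_of_bijective hdef
  obtain ⟨γ'', -, h''⟩ := h'.exists_of_bijective hex'
  exact ⟨γ'', h''⟩

end Local

end HigherTree

end

/-! ### Homology of a space relative to the complement of finitely many open cells. -/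

noncomputable section

namespace HigherTree

open SChain

/-! ### Homology of a space relative to the complement of its open cells -/

/-- The closed cube of side two. -/
abbrev Cube (n : ℕ) := Metric.closedBall (0 : Fin n → ℝ) 1

/-- The open cube of side two. -/
abbrev OpenCube (n : ℕ) := Metric.ball (0 : Fin n → ℝ) 1

lemma norm_le_of_cube {n : ℕ} (x : Cube n) : ‖x.1‖ ≤ 1 := mem_closedBall_zero_iff.1 x.2

lemma norm_lt_of_openCube {n : ℕ} (x : OpenCube n) : ‖x.1‖ < 1 := mem_ball_zero_iff.1 x.2

/-- Radial expansion of the cube, fixing its boundary. -/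
def expand (n : ℕ) : C(Cube n × unitInterval, Cube n) where
  toFun p := ⟨((1 + p.2.1) / max 1 ((1 + p.2.1) * ‖p.1.1‖)) • p.1.1, by
    have h0 := p.2.2.1
    have h1 : (0 : ℝ) < max 1 ((1 + p.2.1) * ‖p.1.1‖) := lt_max_of_lt_left one_pos
    rw [mem_closedBall_zero_iff, norm_smul, Real.norm_of_nonneg (by positivity), div_mul_eq_mul_div,
      div_le_one h1]
    exact le_max_right _ _⟩
  continuous_toFun := by
    have hc : Continuous fun p : Cube n × unitInterval => p.1.1 :=
      continuous_subtype_val.comp continuous_fst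
    have ht : Continuous fun p : Cube n × unitInterval => 1 + p.2.1 :=
      continuous_const.add (continuous_subtype_val.comp continuous_snd)
    exact ((ht.div (continuous_const.max (ht.mul hc.norm)) fun p =>
      (lt_max_of_lt_left one_pos).ne').smul hc).subtype_mk _

lemma norm_expand {n : ℕ} (x : Cube n) (s : unitInterval) :
    ‖(expand n (x, s)).1‖ = (1 + s.1) * ‖x.1‖ / max 1 ((1 + s.1) * ‖x.1‖) := by
  change ‖((1 + s.1) / max 1 ((1 + s.1) * ‖x.1‖)) • x.1‖ = _
  have h0 := s.2.1
  have h1 : (0 : ℝ) < max 1 ((1 + s.1) * ‖x.1‖) := lt_max_of_lt_left one_pos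
  rw [norm_smul, Real.norm_of_nonneg (by positivity), div_mul_eq_mul_div]

lemma expand_of_norm_eq {n : ℕ} {x : Cube n} (hx : ‖x.1‖ = 1) (s : unitInterval) :
    expand n (x, s) = x := by
  ext1
  change ((1 + s.1) / max 1 ((1 + s.1) * ‖x.1‖)) • x.1 = x.1
  have h0 := s.2.1
  rw [hx, mul_one, max_eq_right (by linarith), div_self (by linarith), one_smul]

lemma expand_zero {n : ℕ} (x : Cube n) : expand n (x, 0) = x := by
  ext1
  change ((1 + (0 : ℝ)) / max 1 ((1 + (0 : ℝ)) * ‖x.1‖)) • x.1 = x.1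
  rw [add_zero, one_mul, max_eq_left (norm_le_of_cube x), div_one, one_smul]

lemma half_lt_norm_expand {n : ℕ} {x : Cube n} (hx : 1 / 2 < ‖x.1‖) (s : unitInterval) :
    1 / 2 < ‖(expand n (x, s)).1‖ := by
  have h0 := s.2.1
  rw [norm_expand, lt_div_iff₀ (lt_max_of_lt_left one_pos)]
  rcases max_cases 1 ((1 + s.1) * ‖x.1‖) with h | h <;> rw [h.1] <;> nlinarith

lemma norm_expand_one {n : ℕ} {x : Cube n} (hx : 1 / 2 < ‖x.1‖) :
    ‖(expand n (x, 1)).1‖ = 1 := by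
  have h1 : ((1 : unitInterval) : ℝ) = 1 := rfl
  rw [norm_expand, h1, max_eq_right (by linarith), div_self (by linarith)]

/-- A closed subspace `A` such that the rest of the space consists of open `n`-cells, with
characteristic maps `φ`. -/
structure CellAttachment {Y : Type*} [TopologicalSpace Y] (A : Set Y) {β : Type*} {n : ℕ}
    (φ : β → C(Cube n, Y)) : Prop where
  isClosed : IsClosed A
  mem_of_norm_eq : ∀ b x, ‖x.1‖ = 1 → φ b x ∈ A
  notMem_of_norm_lt : ∀ b x, ‖x.1‖ < 1 → φ b x ∉ A
  eq_of_eq : ∀ b c x y, ‖x.1‖ < 1 → ‖y.1‖ < 1 → φ b x = φ c y → b = c ∧ x = y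
  cover : ∀ y, y ∉ A → ∃ b x, φ b x = y

namespace CellAttachment

variable {Y : Type*} [TopologicalSpace Y] {A : Set Y} {β : Type*} {n : ℕ} {φ : β → C(Cube n, Y)}

lemma norm_lt_iff (h : CellAttachment A φ) (b : β) (x : Cube n) : ‖x.1‖ < 1 ↔ φ b x ∉ A :=
  ⟨h.notMem_of_norm_lt b x, fun hx => lt_of_le_of_ne (norm_le_of_cube x) fun h' =>
    hx (h.mem_of_norm_eq b x h')⟩

/-- The expansion of the cells, as a self-map of the whole space. -/
def expandFun (h : CellAttachment A φ) (p : Y × unitInterval) : Y :=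
  open Classical in
  if hp : p.1 ∉ A then
    φ (h.cover p.1 hp).choose (expand n ((h.cover p.1 hp).choose_spec.choose, p.2))
  else p.1

lemma expandFun_of_mem (h : CellAttachment A φ) {y : Y} (hy : y ∈ A) (s : unitInterval) :
    h.expandFun (y, s) = y := by
  rw [expandFun, dif_neg (not_not.2 hy)]

/-- The choices in the definition do no harm: outside `A` the cell and the point are unique, and
over `A` the point is on the boundary of the cube, which expansion fixes. -/
lemma expandFun_apply (h : CellAttachment A φ) (b : β) (x : Cube n) (s : unitInterval) :
    h.expandFun (φ b x, s) = φ b (expand n (x, s)) := by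
  by_cases hx : φ b x ∈ A
  · have h1 : ‖x.1‖ = 1 := by
      by_contra h1
      exact h.notMem_of_norm_lt b x (lt_of_le_of_ne (norm_le_of_cube x) h1) hx
    rw [h.expandFun_of_mem hx, expand_of_norm_eq h1]
  · obtain ⟨b', x', h2, h3⟩ : ∃ b' x', φ b' x' = φ b x ∧
        h.expandFun (φ b x, s) = φ b' (expand n (x', s)) :=
      ⟨_, _, (h.cover _ hx).choose_spec.choose_spec, dif_pos hx⟩
    obtain ⟨rfl, rfl⟩ := h.eq_of_eq _ _ _ _ ((h.norm_lt_iff _ _).2 (by rwa [h2]))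
      ((h.norm_lt_iff b x).2 hx) h2
    exact h3

lemma isClosedMap [T2Space Y] (φ : C(Cube n, Y)) : IsClosedMap φ := φ.continuous.isClosedMap

/-- The space need not be presented as a quotient: the preimage of a closed set is a finite union of
closed sets, since the maps from the compact sets cube × interval are closed. -/
lemma continuous_expandFun [T2Space Y] [Finite β] (h : CellAttachment A φ) : Continuous h.expandFun := by
  rw [continuous_iff_isClosed]
  intro F hF
  have : h.expandFun ⁻¹' F = ((A ∩ F) ×ˢ Set.univ) ∪ ⋃ b,
      Prod.map (φ b) id '' {p : Cube n × unitInterval | φ b (expand n p) ∈ F} := by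
    ext ⟨y, s⟩
    constructor
    · intro hy
      by_cases hA : y ∈ A
      · left
        rw [Set.mem_preimage, h.expandFun_of_mem hA] at hy
        exact ⟨⟨hA, hy⟩, trivial⟩
      · right
        obtain ⟨b, x, rfl⟩ := h.cover y hA
        rw [Set.mem_preimage, h.expandFun_apply] at hy
        exact Set.mem_iUnion.2 ⟨b, (x, s), hy, rfl⟩
    · rintro (⟨⟨hA, hy⟩, -⟩ | hy)
      · rw [Set.mem_preimage, h.expandFun_of_mem hA]
        exact hy
      · obtain ⟨b, ⟨x, t⟩, hx, hxy⟩ := Set.mem_iUnion.1 hy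
        obtain ⟨rfl, rfl⟩ := Prod.mk.inj hxy
        rw [Set.mem_preimage, id, h.expandFun_apply]
        exact hx
  rw [this]
  refine ((h.isClosed.inter hF).prod isClosed_univ).union (isClosed_iUnion_of_finite fun b => ?_)
  refine ((φ b).continuous.prodMap continuous_id).isClosedMap _ ?_
  exact hF.preimage ((φ b).continuous.comp (expand n).continuous)

/-- The open neighbourhood of `A` obtained by removing the inner halves of the cells. -/
def shell (_ : CellAttachment A φ) : Set Y := (⋃ b, φ b '' {x | ‖x.1‖ ≤ 1 / 2})ᶜ

lemma isOpen_shell [T2Space Y] [Finite β] (h : CellAttachment A φ) : IsOpen h.shell := by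
  refine (isClosed_iUnion_of_finite fun b => isClosedMap (φ b) _ ?_).isOpen_compl
  exact isClosed_le (continuous_subtype_val.norm) continuous_const

lemma subset_shell (h : CellAttachment A φ) : A ⊆ h.shell := by
  intro y hy hy'
  obtain ⟨b, x, hx, rfl⟩ := Set.mem_iUnion.1 hy'
  have hx' : ‖x.1‖ ≤ 1 / 2 := hx
  exact h.notMem_of_norm_lt b x (by linarith) hy

lemma mem_shell_iff (h : CellAttachment A φ) (b : β) (x : Cube n) :
    φ b x ∈ h.shell ↔ 1 / 2 < ‖x.1‖ := by
  constructor
  · intro hx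
    by_contra h'
    exact hx (Set.mem_iUnion.2 ⟨b, x, not_lt.1 h', rfl⟩)
  · intro hx hx'
    obtain ⟨c, x', hx', hc⟩ := Set.mem_iUnion.1 hx'
    have hx'' : ‖x'.1‖ ≤ 1 / 2 := hx'
    have h1 : φ b x ∉ A := by
      rw [← hc]
      exact h.notMem_of_norm_lt c x' (by linarith)
    obtain ⟨-, rfl⟩ := h.eq_of_eq _ _ _ _ (by linarith) ((h.norm_lt_iff b x).2 h1) hc
    linarith

/-- Expansion by a factor of up to two, cut off at the boundary, carries the collar of norm above
1/2 onto the boundary at time one. Thus `A` may be replaced by an open neighbourhood, to which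
excision applies. -/
lemma bijective_shell [T2Space Y] [Finite β] (h : CellAttachment A φ)
    (hid : Set.MapsTo (ContinuousMap.id Y) A h.shell) (m : ℕ) :
    Function.Bijective (RelHom.map (ContinuousMap.id Y) hid m) := by
  have key : ∀ y ∈ h.shell, y ∉ A → ∃ b x, φ b x = y ∧ 1 / 2 < ‖x.1‖ := by
    intro y hy hA
    obtain ⟨b, x, rfl⟩ := h.cover y hA
    exact ⟨b, x, rfl, (h.mem_shell_iff b x).1 hy⟩
  have hmem : ∀ p : h.shell × unitInterval, h.expandFun (p.1.1, p.2) ∈ h.shell := fun p => by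
    by_cases hA : p.1.1 ∈ A
    · rw [h.expandFun_of_mem hA]
      exact p.1.2
    · obtain ⟨b, x, hx, hx'⟩ := key p.1.1 p.1.2 hA
      rw [← hx, h.expandFun_apply, h.mem_shell_iff]
      exact half_lt_norm_expand hx' _
  let G : C(h.shell × unitInterval, h.shell) := ⟨fun p => ⟨h.expandFun (p.1.1, p.2), hmem p⟩,
    Continuous.subtype_mk (h.continuous_expandFun.comp
      ((continuous_subtype_val.comp continuous_fst).prodMk continuous_snd)) hmem⟩
  refine RelHom.bijective_of_deformation G (fun a => ?_) (fun a => ?_) (fun a ha t => ?_) hid m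
  · ext1
    change h.expandFun (a.1, 0) = a.1
    by_cases hA : a.1 ∈ A
    · rw [h.expandFun_of_mem hA]
    · obtain ⟨b, x, hx, -⟩ := key a.1 a.2 hA
      rw [← hx, h.expandFun_apply, expand_zero]
  · change h.expandFun (a.1, 1) ∈ A
    by_cases hA : a.1 ∈ A
    · rwa [h.expandFun_of_mem hA]
    · obtain ⟨b, x, hx, hx'⟩ := key a.1 a.2 hA
      rw [← hx, h.expandFun_apply]
      exact h.mem_of_norm_eq _ _ (norm_expand_one hx')
  · change h.expandFun (a.1, t) ∈ A
    rwa [h.expandFun_of_mem ha]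

/-- The inclusion of the open cube in the cube. -/
def openCubeIncl (n : ℕ) : C(OpenCube n, Cube n) :=
  ⟨Set.inclusion Metric.ball_subset_closedBall, continuous_inclusion _⟩

/-- The complement of the image of an open set is `A` together with finitely many images of compact
sets: the other closed cubes, and the given one with the open set removed. -/
lemma isOpenEmbedding_comp [T2Space Y] [Finite β] (h : CellAttachment A φ) (b : β) :
    IsOpenEmbedding ((φ b).comp (openCubeIncl n)) := by
  refine IsOpenEmbedding.of_continuous_injective_isOpenMap ((φ b).comp _).continuous
    (fun x y hxy => ?_) fun O hO => ?_
  · have := (h.eq_of_eq b b (openCubeIncl n x) (openCubeIncl n y) (norm_lt_of_openCube x) (norm_lt_of_openCube y) hxy).2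
    exact Set.inclusion_injective Metric.ball_subset_closedBall this
  · have hincl : IsOpenEmbedding (openCubeIncl n) := by
      refine ⟨IsEmbedding.inclusion Metric.ball_subset_closedBall, ?_⟩
      change IsOpen (Set.range (Set.inclusion Metric.ball_subset_closedBall))
      rw [Set.range_inclusion]
      exact Metric.isOpen_ball.preimage continuous_subtype_val
    have hO' := hincl.isOpenMap O hO
    rw [← isClosed_compl_iff]
    have : ((φ b).comp (openCubeIncl n) '' O)ᶜ =
        A ∪ ⋃ c, φ c '' {x | c = b → x ∉ openCubeIncl n '' O} := by
      ext y
      constructor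
      · intro hy
        by_cases hA : y ∈ A
        · exact Or.inl hA
        · right
          obtain ⟨c, x, rfl⟩ := h.cover y hA
          refine Set.mem_iUnion.2 ⟨c, x, ?_, rfl⟩
          rintro rfl ⟨o, ho, rfl⟩
          exact hy ⟨o, ho, rfl⟩
      · rintro hy ⟨o, ho, rfl⟩
        have ho' : φ b (openCubeIncl n o) ∉ A := h.notMem_of_norm_lt _ _ (norm_lt_of_openCube o)
        rcases hy with hy | hy
        · exact ho' hy
        · obtain ⟨c, x, hx, hxo⟩ := Set.mem_iUnion.1 hy
          have hxo' : φ c x = φ b (openCubeIncl n o) := hxo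
          obtain ⟨rfl, rfl⟩ := h.eq_of_eq c b x _
            ((h.norm_lt_iff c x).2 (by rwa [hxo'])) (norm_lt_of_openCube o) hxo'
          exact hx rfl ⟨o, ho, rfl⟩
    rw [this]
    refine h.isClosed.union (isClosed_iUnion_of_finite fun c => isClosedMap (φ c) _ ?_)
    by_cases hc : c = b
    · simp only [hc, true_imp_iff]
      exact hO'.isClosed_compl
    · simp [hc]

lemma bijective_excision [T2Space Y] [Fintype β] (h : CellAttachment A φ)
    (hm : ∀ b, Set.MapsTo ((φ b).comp (openCubeIncl n))
      {x : OpenCube n | 1 / 2 < ‖(x : Fin n → ℝ)‖} h.shell) (m : ℕ) :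
    Function.Bijective fun ξ : β → RelHom {x : OpenCube n | 1 / 2 < ‖(x : Fin n → ℝ)‖} m =>
      ∑ b, RelHom.map _ (hm b) m (ξ b) := by
  refine RelHom.excision h.isOpen_shell (fun b => (φ b).comp (openCubeIncl n))
    h.isOpenEmbedding_comp (fun b => ?_) (fun b c hbc => ?_) (Set.eq_univ_of_forall fun y => ?_) m
  · ext x
    exact h.mem_shell_iff b _
  · refine Set.disjoint_left.2 ?_
    rintro _ ⟨x, rfl⟩ ⟨y, hy⟩
    exact hbc (h.eq_of_eq c b (openCubeIncl n y) (openCubeIncl n x) (norm_lt_of_openCube y) (norm_lt_of_openCube x) hy).1.symm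
  · by_cases hA : y ∈ A
    · exact Or.inl (h.subset_shell hA)
    · right
      obtain ⟨b, x, rfl⟩ := h.cover y hA
      exact Set.mem_iUnion.2
        ⟨b, ⟨x.1, mem_ball_zero_iff.2 ((h.norm_lt_iff b x).2 hA)⟩, rfl⟩

/-- The cube is obtained from its boundary by attaching one cell. -/
lemma cube (n : ℕ) :
    CellAttachment {x : Cube n | ‖x.1‖ = 1} fun _ : Unit => ContinuousMap.id (Cube n) where
  isClosed := isClosed_eq continuous_subtype_val.norm continuous_const
  mem_of_norm_eq _ _ h := h
  notMem_of_norm_lt _ _ h h' := h.ne h'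
  eq_of_eq _ _ _ _ _ _ h := ⟨rfl, h⟩
  cover y _ := ⟨(), y, rfl⟩

lemma mapsTo_openCubeIncl (n : ℕ) : Set.MapsTo (openCubeIncl n)
    {x : OpenCube n | 1 / 2 < ‖(x : Fin n → ℝ)‖} (cube n).shell := fun x hx =>
  ((cube n).mem_shell_iff () (openCubeIncl n x)).2 hx

lemma bijective_openCubeIncl (n m : ℕ) :
    Function.Bijective (RelHom.map (openCubeIncl n) (mapsTo_openCubeIncl n) m) := by
  have h1 := (cube n).bijective_excision (fun _ => mapsTo_openCubeIncl n) m
  have h2 := h1.comp (Equiv.funUnique Unit _).symm.bijective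
  simp only [Function.comp_def, Finset.univ_unique, Finset.sum_singleton] at h2
  exact h2

lemma exists_isGen_cube (n : ℕ) : ∃ γ : RelHom {x : Cube n | ‖x.1‖ = 1} n, IsGen γ := by
  obtain ⟨γ, hγ⟩ := exists_isGen_ball n
  obtain ⟨γ', -, h⟩ := (hγ.map (bijective_openCubeIncl n n)).exists_of_bijective
    ((cube n).bijective_shell (fun x hx => (cube n).subset_shell hx) n)
  exact ⟨γ', h⟩

/-- The relative homology has the images of a generator of the homology of the cube as a basis. -/
theorem bijective_sum_smul [T2Space Y] [Fintype β] (h : CellAttachment A φ)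
    (hφ : ∀ b, Set.MapsTo (φ b) {x | ‖x.1‖ = 1} A) {γ : RelHom {x : Cube n | ‖x.1‖ = 1} n}
    (hγ : IsGen γ) :
    Function.Bijective fun c : β → ℤ => ∑ b, c b • RelHom.map (φ b) (hφ b) n γ := by
  have hidC : Set.MapsTo (ContinuousMap.id (Cube n)) {x : Cube n | ‖x.1‖ = 1} (cube n).shell :=
    fun x hx => (cube n).subset_shell hx
  have hidY : Set.MapsTo (ContinuousMap.id Y) A h.shell := fun x hx => h.subset_shell hx
  have hiC := (cube n).bijective_shell hidC n
  have hiY := h.bijective_shell hidY n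
  obtain ⟨γ', hγγ', hγ'⟩ := (hγ.map hiC).exists_of_bijective (bijective_openCubeIncl n n)
  have hm : ∀ b, Set.MapsTo ((φ b).comp (openCubeIncl n))
      {x : OpenCube n | 1 / 2 < ‖(x : Fin n → ℝ)‖} h.shell := fun b x hx =>
    (h.mem_shell_iff b _).2 hx
  have hs : ∀ b, Set.MapsTo (φ b) (cube n).shell h.shell := fun b x hx =>
    (h.mem_shell_iff b x).2 (((cube n).mem_shell_iff () x).1 hx)
  have hn : ∀ b, Set.MapsTo (φ b) {x : Cube n | ‖x.1‖ = 1} h.shell := fun b x hx =>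
    hidY (hφ b hx)
  -- Naturality of the two replacements, boundary by collar and closed cube by open cube, for each
  -- characteristic map.
  have key : ∀ b, RelHom.map (ContinuousMap.id Y) hidY n (RelHom.map (φ b) (hφ b) n γ) =
      RelHom.map _ (hm b) n γ' := by
    intro b
    rw [← RelHom.map_comp (openCubeIncl n) (mapsTo_openCubeIncl n) (φ b) (hs b), hγγ',
      RelHom.map_comp (ContinuousMap.id (Cube n)) hidC (φ b) (hs b) (hn b),
      RelHom.map_comp (φ b) (hφ b) (ContinuousMap.id Y) hidY (hn b)]
    rfl
  have hex := h.bijective_excision hm n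
  have hpi : Function.Bijective fun (c : β → ℤ) (b : β) => c b • γ' := by
    refine ⟨fun c c' hc => funext fun b => hγ'.injective (congrFun hc b), fun ξ => ?_⟩
    choose c hc using fun b => hγ'.surjective (ξ b)
    exact ⟨c, funext hc⟩
  refine (hiY.of_comp_iff' _).1 ?_
  convert hex.comp hpi using 1
  funext c
  simp only [Function.comp_apply, map_sum, map_smul, key]

end CellAttachment

end HigherTree

end

/-! ### Comparison with the categorical singular complex, and the basis of cell classes. -/

noncomputable section

namespace HigherTree

/-! ### Homology classes of cycles in a complex of modules -/

section HomClass

variable {R : Type*} [Ring R] (K L : ChainComplex (ModuleCat.{u} R) ℕ) (n : ℕ)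

/-- The submodule of cycles. -/
def cyc : Submodule R (K.X n) := LinearMap.ker (K.d n ((ComplexShape.down ℕ).next n)).hom

lemma ofHom_cyc_comp_d : ModuleCat.ofHom (cyc K n).subtype ≫
    K.d n ((ComplexShape.down ℕ).next n) = 0 := by
  ext x
  exact x.2

/-- The homology class of a cycle. -/
def homClass : cyc K n →ₗ[R] K.homology n :=
  (K.liftCycles (ModuleCat.ofHom (cyc K n).subtype) ((ComplexShape.down ℕ).next n) rfl (ofHom_cyc_comp_d K n) ≫ K.homologyπ n).hom

variable {K L n}

lemma mem_cyc {x : K.X n} : x ∈ cyc K n ↔ ∀ j, n = j + 1 → (K.d n j).hom x = 0 := by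
  rw [cyc, LinearMap.mem_ker]
  constructor
  · rintro h j rfl
    rwa [ChainComplex.next_nat_succ] at h
  · intro h
    cases n with
    | zero =>
      rw [K.shape _ _ (by simp)]
      rfl
    | succ n =>
      rw [ChainComplex.next_nat_succ]
      exact h n rfl

lemma homClass_surjective : Function.Surjective (homClass K n) := by
  intro h
  obtain ⟨z, rfl⟩ := (ModuleCat.epi_iff_surjective (K.homologyπ n)).1 inferInstance h
  have hz : (K.iCycles n).hom z ∈ cyc K n := by
    have := K.iCycles_d n ((ComplexShape.down ℕ).next n)
    exact LinearMap.congr_fun (congrArg ModuleCat.Hom.hom this) z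
  refine ⟨⟨_, hz⟩, ?_⟩
  rw [homClass, ModuleCat.hom_comp, LinearMap.comp_apply]
  congr 1
  apply (ModuleCat.mono_iff_injective (K.iCycles n)).1 inferInstance
  have := K.liftCycles_i (ModuleCat.ofHom (cyc K n).subtype) ((ComplexShape.down ℕ).next n) rfl (ofHom_cyc_comp_d K n)
  exact LinearMap.congr_fun (congrArg ModuleCat.Hom.hom this) ⟨_, hz⟩

lemma homClass_eq_zero (x : cyc K n) :
    homClass K n x = 0 ↔ ∃ w, (K.d (n + 1) n).hom w = x := by
  have hi := K.liftCycles_i (ModuleCat.ofHom (cyc K n).subtype) ((ComplexShape.down ℕ).next n) rfl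
    (ofHom_cyc_comp_d K n)
  have hi' := LinearMap.congr_fun (congrArg ModuleCat.Hom.hom hi) x
  rw [ModuleCat.hom_comp, LinearMap.comp_apply] at hi'
  have hex : (ShortComplex.mk (K.toCycles (n + 1) n) (K.homologyπ n)
      (K.toCycles_comp_homologyπ _ _)).Exact :=
    ShortComplex.exact_of_g_is_cokernel _ (K.homologyIsCokernel (n + 1) n (by simp))
  rw [homClass, ModuleCat.hom_comp, LinearMap.comp_apply]
  constructor
  · intro h
    obtain ⟨w, hw⟩ := (ShortComplex.moduleCat_exact_iff _).1 hex _ h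
    refine ⟨w, ?_⟩
    have h2 := LinearMap.congr_fun (congrArg ModuleCat.Hom.hom (K.toCycles_i (n + 1) n)) w
    rw [ModuleCat.hom_comp, LinearMap.comp_apply] at h2
    rw [← h2]
    refine Eq.trans ?_ hi'
    exact congrArg _ hw
  · rintro ⟨w, hw⟩
    have h3 : (K.liftCycles (ModuleCat.ofHom (cyc K n).subtype) ((ComplexShape.down ℕ).next n) rfl
        (ofHom_cyc_comp_d K n)).hom x = (K.toCycles (n + 1) n).hom w := by
      apply (ModuleCat.mono_iff_injective (K.iCycles n)).1 inferInstance
      refine hi'.trans ?_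
      have h2 := LinearMap.congr_fun (congrArg ModuleCat.Hom.hom (K.toCycles_i (n + 1) n)) w
      exact (h2.trans hw).symm
    rw [h3]
    exact LinearMap.congr_fun (congrArg ModuleCat.Hom.hom (K.toCycles_comp_homologyπ (n + 1) n)) w

lemma map_mem_cyc (φ : K ⟶ L) {x : K.X n} (hx : x ∈ cyc K n) : (φ.f n).hom x ∈ cyc L n := by
  rw [cyc, LinearMap.mem_ker] at hx ⊢
  have h := LinearMap.congr_fun (congrArg ModuleCat.Hom.hom
    (φ.comm n ((ComplexShape.down ℕ).next n))) x
  rw [ModuleCat.hom_comp, ModuleCat.hom_comp, LinearMap.comp_apply, LinearMap.comp_apply, hx,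
    map_zero] at h
  exact h

lemma homologyMap_homClass (φ : K ⟶ L) (x : cyc K n) :
    (HomologicalComplex.homologyMap φ n).hom (homClass K n x) =
      homClass L n ⟨(φ.f n).hom x, map_mem_cyc φ x.2⟩ := by
  have h1 := LinearMap.congr_fun (congrArg ModuleCat.Hom.hom
    (HomologicalComplex.homologyπ_naturality φ n))
  have hK := K.liftCycles_i (ModuleCat.ofHom (cyc K n).subtype) ((ComplexShape.down ℕ).next n) rfl
    (ofHom_cyc_comp_d K n)
  have hL := L.liftCycles_i (ModuleCat.ofHom (cyc L n).subtype) ((ComplexShape.down ℕ).next n) rfl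
    (ofHom_cyc_comp_d L n)
  rw [homClass, homClass, ModuleCat.hom_comp, ModuleCat.hom_comp, LinearMap.comp_apply,
    LinearMap.comp_apply]
  refine (h1 _).trans ?_
  rw [ModuleCat.hom_comp, LinearMap.comp_apply]
  congr 1
  apply (ModuleCat.mono_iff_injective (L.iCycles n)).1 inferInstance
  have h2 := LinearMap.congr_fun (congrArg ModuleCat.Hom.hom (HomologicalComplex.cyclesMap_i φ n))
  refine (h2 _).trans ?_
  refine Eq.trans ?_ (LinearMap.congr_fun (congrArg ModuleCat.Hom.hom hL)
    ⟨(φ.f n).hom x, map_mem_cyc φ x.2⟩).symm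
  exact congrArg (φ.f n).hom (LinearMap.congr_fun (congrArg ModuleCat.Hom.hom hK) x)

end HomClass

/-! ### Comparison of singular chain complexes -/

section Compare

variable {A Y B Z : TopCat.{u}}

/-- The generator of the categorical singular chains given by a simplex. -/
def sgen (n : ℕ) (σ : C(Simplex (n + 1), Y)) : (singularChains.obj Y).X n :=
  (SSet.ιChainComplex (R := ModuleCat.of ℤ (ULift.{u} ℤ)) (TopCat.toSSet.obj Y)
    ((TopCat.toSSetObjEquiv Y (Opposite.op (SimplexCategory.mk n))).symm σ)).hom ⟨1⟩

/-- The map from concrete to categorical singular chains. -/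
def toSing (n : ℕ) : SChain Y (n + 1) →+ (singularChains.obj Y).X n :=
  Finsupp.liftAddHom fun σ => zmultiplesHom _ (sgen n σ)

@[simp] lemma toSing_single (n : ℕ) (σ : C(Simplex (n + 1), Y)) :
    toSing n (Finsupp.single σ 1) = sgen n σ := by
  rw [toSing, Finsupp.liftAddHom_apply_single]
  exact one_zsmul _

/-- The map from categorical to concrete singular chains. -/
def ofSing (n : ℕ) : (singularChains.obj Y).X n ⟶ ModuleCat.of ℤ (SChain Y (n + 1)) :=
  (SSet.isColimitChainComplexXCofan (TopCat.toSSet.obj Y) (ModuleCat.of ℤ (ULift.{u} ℤ)) n).desc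
    (Cofan.mk _ fun x => ModuleCat.ofHom
      ((Finsupp.lsingle (TopCat.toSSetObjEquiv Y _ x)).comp
        (ULift.moduleEquiv (R := ℤ) (M := ℤ)).toLinearMap))

lemma ι_ofSing (n : ℕ) (x : (TopCat.toSSet.obj Y).obj (Opposite.op (SimplexCategory.mk n))) :
    SSet.ιChainComplex (R := ModuleCat.of ℤ (ULift.{u} ℤ)) (TopCat.toSSet.obj Y) x ≫ ofSing n =
      ModuleCat.ofHom ((Finsupp.lsingle (TopCat.toSSetObjEquiv Y _ x)).comp
        (ULift.moduleEquiv (R := ℤ) (M := ℤ)).toLinearMap) :=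
  (SSet.isColimitChainComplexXCofan (TopCat.toSSet.obj Y) (ModuleCat.of ℤ (ULift.{u} ℤ)) n).fac _ ⟨x⟩

lemma ofSing_sgen (n : ℕ) (σ : C(Simplex (n + 1), Y)) :
    (ofSing n).hom (sgen n σ) = Finsupp.single σ 1 := by
  have h := LinearMap.congr_fun (congrArg ModuleCat.Hom.hom (ι_ofSing n
    ((TopCat.toSSetObjEquiv Y (Opposite.op (SimplexCategory.mk n))).symm σ))) ⟨1⟩
  refine h.trans ?_
  simp

lemma ofSing_toSing (n : ℕ) (x : SChain Y (n + 1)) : (ofSing n).hom (toSing n x) = x := by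
  have : (ofSing n).hom.toAddMonoidHom.comp (toSing n) = AddMonoidHom.id (SChain Y (n + 1)) := by
    ext σ : 1
    apply AddMonoidHom.ext_int
    simp only [AddMonoidHom.comp_apply, Finsupp.singleAddHom_apply, toSing_single]
    exact ofSing_sgen n σ
  exact DFunLike.congr_fun this x

/-- The categorical chains are a coproduct of copies of ℤ over the simplices, so a map out of them
is determined on the generators. -/
lemma singularChains_hom_ext (n : ℕ) {M : ModuleCat.{u} ℤ}
    (f g : (singularChains.obj Y).X n ⟶ M) (h : ∀ σ, f.hom (sgen n σ) = g.hom (sgen n σ)) :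
    f = g := by
  refine SSet.chainComplex_hom_ext (fun x => ?_)
  have hx := h (TopCat.toSSetObjEquiv Y _ x)
  rw [sgen, Equiv.symm_apply_apply] at hx
  apply ModuleCat.hom_ext
  apply LinearMap.ext
  intro c
  have hc : c = c.down • (⟨1⟩ : ULift.{u} ℤ) := by
    ext
    simp
  rw [hc]
  refine (LinearMap.map_smul _ _ _).trans (Eq.trans ?_ (LinearMap.map_smul _ _ _).symm)
  exact congrArg _ hx

/-- An additive map between `ℤ`-modules is linear, for any two module structures. -/
def intLinear {M N : Type*} [AddCommGroup M] [AddCommGroup N] [Module ℤ M] [Module ℤ N]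
    (f : M →+ N) : M →ₗ[ℤ] N where
  toFun := f
  map_add' := map_add f
  map_smul' k x := by simpa using map_intCast_smul f ℤ ℤ k x

lemma toSing_ofSing (n : ℕ) (x : (singularChains.obj Y).X n) :
    toSing n ((ofSing n).hom x) = x := by
  have hT : ModuleCat.ofHom (intLinear ((toSing n).comp
      (ofSing n).hom.toAddMonoidHom)) = 𝟙 ((singularChains.obj Y).X n) := by
    refine singularChains_hom_ext n _ _ fun σ => ?_
    change toSing n ((ofSing n).hom (sgen n σ)) = sgen n σ
    rw [ofSing_sgen, toSing_single]
  exact LinearMap.congr_fun (congrArg ModuleCat.Hom.hom hT) x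

lemma toSing_bijective (n : ℕ) : Function.Bijective (toSing (Y := Y) n) :=
  Function.bijective_iff_has_inverse.2 ⟨_, ofSing_toSing n, toSing_ofSing n⟩

lemma toSing_d (n : ℕ) (x : SChain Y (n + 2)) :
    ((singularChains.obj Y).d (n + 1) n).hom (toSing (n + 1) x) = toSing n (SChain.d (n + 1) x) := by
  have : ((singularChains.obj Y).d (n + 1) n).hom.toAddMonoidHom.comp (toSing (n + 1)) =
      (toSing n).comp (SChain.d (n + 1)).toAddMonoidHom := by
    ext σ : 1
    apply AddMonoidHom.ext_int
    simp only [AddMonoidHom.comp_apply, Finsupp.singleAddHom_apply, toSing_single,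
      LinearMap.toAddMonoidHom_coe, SChain.d_single, map_sum]
    have h := LinearMap.congr_fun (congrArg ModuleCat.Hom.hom
      (SSet.ιChainComplex_d (R := ModuleCat.of ℤ (ULift.{u} ℤ)) (TopCat.toSSet.obj Y)
      ((TopCat.toSSetObjEquiv Y (Opposite.op (SimplexCategory.mk (n + 1)))).symm σ))) ⟨1⟩
    refine h.trans ?_
    rw [ModuleCat.hom_sum, LinearMap.sum_apply]
    refine Finset.sum_congr rfl fun i _ => ?_
    rw [map_zsmul, toSing_single]
    have hδ : (TopCat.toSSet.obj Y).δ i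
        ((TopCat.toSSetObjEquiv Y (Opposite.op (SimplexCategory.mk (n + 1)))).symm σ) =
        (TopCat.toSSetObjEquiv Y (Opposite.op (SimplexCategory.mk n))).symm (σ.comp (face i)) := by
      rw [Equiv.eq_symm_apply]
      ext t
      have h2 : ((TopCat.toSSetObjEquiv Y (Opposite.op (SimplexCategory.mk n)))
        ((TopCat.toSSet.obj Y).δ i
        ((TopCat.toSSetObjEquiv Y (Opposite.op (SimplexCategory.mk (n + 1)))).symm σ))) t =
          σ (stdSimplex.map i.succAbove t) := rfl
      rw [h2, ContinuousMap.comp_apply, face_apply]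
    rw [hδ]
    rfl
  exact DFunLike.congr_fun this x

lemma toSing_map (f : Y ⟶ Z) (n : ℕ) (x : SChain Y (n + 1)) :
    ((singularChains.map f).f n).hom (toSing n x) = toSing n (SChain.map f.hom _ x) := by
  have : ((singularChains.map f).f n).hom.toAddMonoidHom.comp (toSing n) =
      (toSing n).comp (SChain.map f.hom _).toAddMonoidHom := by
    ext σ : 1
    apply AddMonoidHom.ext_int
    simp only [AddMonoidHom.comp_apply, Finsupp.singleAddHom_apply, toSing_single,
      LinearMap.toAddMonoidHom_coe, SChain.map_single]
    have h := LinearMap.congr_fun (congrArg ModuleCat.Hom.hom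
      (SSet.ι_chainComplexMap_f (R := ModuleCat.of ℤ (ULift.{u} ℤ)) (TopCat.toSSet.obj Y)
      (TopCat.toSSet.obj Z) (TopCat.toSSet.map f)
      ((TopCat.toSSetObjEquiv Y (Opposite.op (SimplexCategory.mk n))).symm σ))) ⟨1⟩
    exact h
  exact DFunLike.congr_fun this x

end Compare

/-! ### Relative homology through chains of the ambient space -/

section Bridge

variable {A Y B Z : TopCat.{u}} (i : A ⟶ Y) (j : B ⟶ Z) {n : ℕ}

/-- The chain of the quotient complex given by a chain of the ambient space. -/
def relSing (n : ℕ) : SChain Y (n + 1) →+ (cokernel (singularChains.map i)).X n :=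
  ((cokernel.π (singularChains.map i)).f n).hom.toAddMonoidHom.comp (toSing n)

lemma pairChains_eval_exact [Mono i] (n : ℕ) :
    ((pairChains i).map (HomologicalComplex.eval _ _ n)).ShortExact :=
  (pairChains_shortExact i).map_of_exact (HomologicalComplex.eval _ _ n)

lemma relSing_surjective [Mono i] (n : ℕ) : Function.Surjective (relSing i n) := by
  intro y
  have := (pairChains_eval_exact i n).epi_g
  obtain ⟨x, hx⟩ := (ModuleCat.epi_iff_surjective _).1 this y
  obtain ⟨x, rfl⟩ := (toSing_bijective n).2 x
  exact ⟨x, hx⟩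

variable {i}

lemma relSing_eq_zero (hi : IsEmbedding i.hom) [Mono i] {x : SChain Y (n + 1)} :
    relSing i n x = 0 ↔ x ∈ SChain.sub (Set.range i.hom) (n + 1) := by
  constructor
  · intro h
    obtain ⟨a, ha⟩ := (ShortComplex.moduleCat_exact_iff _).1 (pairChains_eval_exact i n).exact _ h
    obtain ⟨a, rfl⟩ := (toSing_bijective n).2 a
    have h2 : toSing n (SChain.map i.hom _ a) = toSing n x := (toSing_map i n a).symm.trans ha
    rw [← (toSing_bijective n).1 h2]
    exact SChain.map_mem_range _ _
  · intro h
    obtain ⟨y, rfl⟩ := SChain.exists_map_eq hi h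
    have h1 := toSing_map i n y
    have h2 : singularChains.map i ≫ cokernel.π (singularChains.map i) = 0 := cokernel.condition _
    have h3 := LinearMap.congr_fun (congrArg ModuleCat.Hom.hom
      (HomologicalComplex.congr_hom h2 n)) (toSing n y)
    exact (congrArg _ h1.symm).trans h3

variable (i) in
lemma relSing_d (x : SChain Y (n + 2)) :
    ((cokernel (singularChains.map i)).d (n + 1) n).hom (relSing i (n + 1) x) =
      relSing i n (SChain.d (n + 1) x) := by
  have h := LinearMap.congr_fun (congrArg ModuleCat.Hom.hom
    ((cokernel.π (singularChains.map i)).comm (n + 1) n)) (toSing (n + 1) x)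
  exact h.trans (congrArg ((cokernel.π (singularChains.map i)).f n).hom (toSing_d n x))

lemma relSing_mem_cyc (hi : IsEmbedding i.hom) [Mono i] {x : SChain Y (n + 1)} :
    relSing i n x ∈ cyc (cokernel (singularChains.map i)) n ↔
      SChain.d n x ∈ SChain.sub (Set.range i.hom) n := by
  rw [mem_cyc]
  cases n with
  | zero =>
    refine ⟨fun _ => ?_, fun _ j hj => by omega⟩
    rw [SChain.sub_zero]
    trivial
  | succ n =>
    rw [← relSing_eq_zero hi, ← relSing_d]
    exact ⟨fun h => h n rfl, fun h j hj => by obtain rfl : n = j := by omega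
                                              exact h⟩

/-- The comparison of relative homology groups. -/
def bridge (hi : IsEmbedding i.hom) [Mono i] (n : ℕ) :
    RelHom (Set.range i.hom) n →+ relHomology i n :=
  QuotientAddGroup.lift _
    ((homClass _ n).toAddMonoidHom.comp
      (((relSing i n).comp (Submodule.subtype _).toAddMonoidHom).codRestrict
        (cyc (cokernel (singularChains.map i)) n).toAddSubgroup
        fun x : relCycles (Set.range i.hom) n => (relSing_mem_cyc hi).2 x.2)) (by
    rintro ⟨x, hx⟩ hx'
    obtain ⟨e, a, ha, rfl⟩ := RelHom.mem_relBoundaries.1 hx'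
    refine (homClass_eq_zero _).2 ⟨relSing i (n + 1) e, ?_⟩
    rw [relSing_d]
    refine Eq.symm ((map_add (relSing i n) _ a).trans ?_)
    rw [(relSing_eq_zero hi).2 ha, add_zero])

lemma bridge_mk (hi : IsEmbedding i.hom) [Mono i] (x : SChain Y (n + 1))
    (hx : SChain.d n x ∈ SChain.sub (Set.range i.hom) n) :
    bridge hi n (RelHom.mk x hx) = homClass _ n ⟨relSing i n x, (relSing_mem_cyc hi).2 hx⟩ := rfl

/-- `relSing` is onto the quotient complex with kernel the chains in the image of `i`, so cycles and
boundaries of the quotient are exactly the relative ones. -/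
lemma bridge_bijective (hi : IsEmbedding i.hom) [Mono i] (n : ℕ) :
    Function.Bijective (bridge hi n) := by
  constructor
  · rw [injective_iff_map_eq_zero]
    intro h h0
    obtain ⟨x, hx, rfl⟩ := RelHom.exists_mk h
    rw [bridge_mk, homClass_eq_zero] at h0
    obtain ⟨w, hw⟩ := h0
    obtain ⟨e, rfl⟩ := relSing_surjective i (n + 1) w
    rw [relSing_d] at hw
    rw [RelHom.mk_eq_zero]
    refine ⟨e, x - SChain.d (n + 1) e, ?_, by abel⟩
    rw [← relSing_eq_zero hi, map_sub, hw, sub_self]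
  · intro h
    obtain ⟨⟨z, hz⟩, rfl⟩ := homClass_surjective h
    obtain ⟨x, rfl⟩ := relSing_surjective i n z
    exact ⟨RelHom.mk x ((relSing_mem_cyc hi).1 hz), rfl⟩

variable {j}

lemma relHomologyMap_bridge (hi : IsEmbedding i.hom) (hj : IsEmbedding j.hom) [Mono i] [Mono j]
    (f : A ⟶ B) (g : Y ⟶ Z) (w : i ≫ g = f ≫ j)
    (hg : Set.MapsTo g.hom (Set.range i.hom) (Set.range j.hom))
    (h : RelHom (Set.range i.hom) n) :
    (relHomologyMap i j f g w n).hom (bridge hi n h) = bridge hj n (RelHom.map g.hom hg n h) := by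
  obtain ⟨x, hx, rfl⟩ := RelHom.exists_mk h
  rw [RelHom.map_mk, bridge_mk, bridge_mk, relHomologyMap, homologyMap_homClass]
  congr 2
  have h1 : cokernel.π (singularChains.map i) ≫ cokernel.map (singularChains.map i)
      (singularChains.map j) (singularChains.map f) (singularChains.map g)
      (by rw [← Functor.map_comp, ← Functor.map_comp, w]) =
      singularChains.map g ≫ cokernel.π (singularChains.map j) := cokernel.π_desc _ _ _
  have h2 := LinearMap.congr_fun (congrArg ModuleCat.Hom.hom
      (HomologicalComplex.congr_hom h1 n)) (toSing n x)
  exact h2.trans (congrArg ((cokernel.π (singularChains.map j)).f n).hom (toSing_map g n x))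

lemma mapsTo_range_of_comp_eq {f : A ⟶ B} {g : Y ⟶ Z} (w : i ≫ g = f ≫ j) :
    Set.MapsTo g.hom (Set.range i.hom) (Set.range j.hom) := by
  rintro _ ⟨a, rfl⟩
  exact ⟨f.hom a, (DFunLike.congr_fun (congrArg TopCat.Hom.hom w) a).symm⟩

end Bridge

end HigherTree

end

noncomputable section

namespace HigherTree

/-! ### The classes of the cells form a basis -/

lemma isEmbedding_diskIncl (n : ℕ) : IsEmbedding (diskIncl.{u} n).hom := by
  have h : IsEmbedding (Homeomorph.ulift.{u}.symm ∘
      (Set.inclusion (Metric.sphere_subset_closedBall (x := (0 : Fin n → ℝ)) (ε := 1)) ∘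
        Homeomorph.ulift.{u})) :=
    Homeomorph.ulift.symm.isEmbedding.comp
      ((IsEmbedding.inclusion Metric.sphere_subset_closedBall).comp Homeomorph.ulift.isEmbedding)
  exact h

instance mono_diskIncl (n : ℕ) : Mono (diskIncl.{u} n) :=
  (TopCat.mono_iff_injective _).2 (isEmbedding_diskIncl n).injective

/-- The identification of the cube with the disk. -/
def cubeUp (n : ℕ) : C(Cube n, disk.{u} n) := ⟨ULift.up, continuous_uliftUp⟩

/-- The identification of the disk with the cube. -/
def cubeDown (n : ℕ) : C(disk.{u} n, Cube n) := ⟨ULift.down, continuous_uliftDown⟩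

lemma mapsTo_cubeUp (n : ℕ) : Set.MapsTo (cubeUp.{u} n) {x | ‖x.1‖ = 1}
    (Set.range (diskIncl.{u} n).hom) :=
  fun x hx => ⟨⟨⟨x.1, mem_sphere_zero_iff_norm.2 hx⟩⟩, rfl⟩

lemma mapsTo_cubeDown (n : ℕ) : Set.MapsTo (cubeDown.{u} n) (Set.range (diskIncl.{u} n).hom)
    {x | ‖x.1‖ = 1} := by
  rintro _ ⟨x, rfl⟩
  exact mem_sphere_zero_iff_norm.1 x.down.2

lemma bijective_map_cubeUp (n : ℕ) :
    Function.Bijective (RelHom.map (cubeUp.{u} n) (mapsTo_cubeUp n) n) := by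
  refine Function.bijective_iff_has_inverse.2
    ⟨RelHom.map (cubeDown.{u} n) (mapsTo_cubeDown n) n, fun h => ?_, fun h => ?_⟩
  · exact (RelHom.map_comp _ (mapsTo_cubeUp n) _ (mapsTo_cubeDown n) (fun x hx => hx) h).trans
      (RelHom.map_id (fun x hx => hx) h)
  · exact (RelHom.map_comp _ (mapsTo_cubeDown n) _ (mapsTo_cubeUp n) (fun x hx => hx) h).trans
      (RelHom.map_id (fun x hx => hx) h)

/-- A spanning element of an infinite cyclic group is a free generator: a coincidence between
multiples of `γ` would pass to the multiple `γ'` of it. This upgrades the spanning property by which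
`diskClass` is chosen. -/
lemma IsGen.of_surjective {M : Type*} [AddCommGroup M] {γ γ' : M} (h : IsGen γ')
    (hγ : Function.Surjective fun k : ℤ => k • γ) : IsGen γ := by
  refine ⟨fun k l hkl => h.1 ?_, hγ⟩
  obtain ⟨m, rfl⟩ := hγ γ'
  have hkl : k • γ = l • γ := hkl
  simp only [smul_comm _ m, hkl]

lemma IsGen.span_map {M N : Type*} [AddCommGroup M] [AddCommGroup N] [inst : Module ℤ N] {γ : M}
    (h : IsGen γ) {F : M →+ N} (hF : Function.Surjective F) : Submodule.span ℤ {F γ} = ⊤ := by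
  -- The ℤ-action supplied by `ModuleCat` need not be definitionally the canonical one, but a
  -- ℤ-module structure is unique.
  obtain rfl : inst = AddCommGroup.toIntModule N := Subsingleton.elim _ _
  rw [Submodule.span_singleton_eq_top_iff]
  intro y
  obtain ⟨x, rfl⟩ := hF y
  obtain ⟨k, rfl⟩ := h.2 x
  exact ⟨k, (map_zsmul F k γ).symm⟩

lemma surjective_zsmul_of_span_map {M N : Type*} [AddCommGroup M] [AddCommGroup N]
    [inst : Module ℤ N] {γ : M} {F : M →+ N} (hF : Function.Injective F)
    (h : Submodule.span ℤ {F γ} = ⊤) : Function.Surjective fun k : ℤ => k • γ := by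
  obtain rfl : inst = AddCommGroup.toIntModule N := Subsingleton.elim _ _
  intro x
  obtain ⟨k, hk⟩ := (Submodule.span_singleton_eq_top_iff ℤ _).1 h (F x)
  exact ⟨k, hF ((map_zsmul F k γ).trans hk)⟩

lemma exists_isGen_diskClass (n : ℕ) : ∃ γ : RelHom {x : Cube n | ‖x.1‖ = 1} n, IsGen γ ∧
    bridge (isEmbedding_diskIncl.{u} n) n (RelHom.map (cubeUp.{u} n) (mapsTo_cubeUp n) n γ) =
      diskClass.{u} n := by
  let F : RelHom {x : Cube n | ‖x.1‖ = 1} n →+ relHomology (diskIncl.{u} n) n :=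
    (bridge (isEmbedding_diskIncl.{u} n) n).comp
      (RelHom.map (cubeUp.{u} n) (mapsTo_cubeUp n) n).toAddMonoidHom
  have hF : Function.Bijective F := (bridge_bijective (isEmbedding_diskIncl n) n).comp
    (bijective_map_cubeUp n)
  obtain ⟨γ', h'⟩ := CellAttachment.exists_isGen_cube n
  have hspan : Submodule.span ℤ {diskClass.{u} n} = ⊤ :=
    Classical.epsilon_spec (p := fun g => Submodule.span ℤ {g} = ⊤) ⟨F γ', h'.span_map hF.2⟩
  obtain ⟨γ, hγ⟩ := hF.2 (diskClass n)
  rw [← hγ] at hspan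
  exact ⟨γ, h'.of_surjective (surjective_zsmul_of_span_map hF.1 hspan), hγ⟩

section Basis

variable {X : Type u} [TopologicalSpace X] [T2Space X] (C : Set X) [CWComplex C]

lemma isEmbedding_skeletonIncl (n : ℕ) : IsEmbedding (skeletonIncl C n).hom :=
  IsEmbedding.inclusion (skeletonLT_subset_succ C n)

lemma mem_range_skeletonIncl {n : ℕ} {y : skeletonSpace C (n + 1)} :
    y ∈ Set.range (skeletonIncl C n).hom ↔ y.1 ∈ (skeletonLT C (n : ℕ∞) : Set X) := by
  constructor
  · rintro ⟨x, rfl⟩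
    exact x.2
  · intro h
    exact ⟨⟨y.1, h⟩, rfl⟩

variable {C} in
/-- The characteristic map of a cell, on the cube. -/
def cubeMap {n : ℕ} (b : cell C n) : C(Cube n, skeletonSpace C (n + 1)) :=
  (charMap b).hom.comp (cubeUp n)

variable {C} in
lemma cubeMap_apply {n : ℕ} (b : cell C n) (x : Cube n) : (cubeMap b x).1 = map n b x.1 := rfl

lemma cellAttachment (n : ℕ) : CellAttachment (Set.range (skeletonIncl C n).hom)
    (cubeMap (C := C) (n := n)) where
  isClosed := by
    have : Set.range (skeletonIncl C n).hom =
        Subtype.val ⁻¹' (skeletonLT C (n : ℕ∞) : Set X) := by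
      ext y
      exact mem_range_skeletonIncl C
    rw [this]
    exact (skeletonLT C (n : ℕ∞)).closed.preimage continuous_subtype_val
  mem_of_norm_eq b x hx := by
    rw [mem_range_skeletonIncl, cubeMap_apply]
    exact cellFrontier_subset_skeletonLT n b ⟨_, mem_sphere_zero_iff_norm.2 hx, rfl⟩
  notMem_of_norm_lt b x hx := by
    rw [mem_range_skeletonIncl, cubeMap_apply]
    intro h
    exact (disjoint_skeletonLT_openCell (le_refl (n : ℕ∞))).notMem_of_mem_left h
      ⟨_, mem_ball_zero_iff.2 hx, rfl⟩
  eq_of_eq b c x y hx hy hxy := by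
    have h := congrArg Subtype.val hxy
    rw [cubeMap_apply, cubeMap_apply] at h
    have hbc : b = c := by
      by_contra hne
      have hd : Disjoint (openCell n b) (openCell n c) :=
        disjoint_openCell_of_ne (by simpa using hne)
      exact hd.notMem_of_mem_left ⟨_, mem_ball_zero_iff.2 hx, h⟩ ⟨_, mem_ball_zero_iff.2 hy, rfl⟩
    subst hbc
    refine ⟨rfl, Subtype.ext ((map n b).injOn ?_ ?_ h)⟩
    · rw [source_eq]
      exact mem_ball_zero_iff.2 hx
    · rw [source_eq]
      exact mem_ball_zero_iff.2 hy
  cover y hy := by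
    rw [mem_range_skeletonIncl] at hy
    have h := y.2
    have h2 := skeletonLT_union_iUnion_closedCell_eq_skeletonLT_succ (C := C) n
    have h3 : y.1 ∈ (skeletonLT C (n : ℕ∞) : Set X) ∪ ⋃ (j : cell C n), closedCell n j := by
      rw [h2]
      exact_mod_cast h
    obtain h3 | h3 := h3
    · exact (hy h3).elim
    · obtain ⟨b, x, hx, hxy⟩ := Set.mem_iUnion.1 h3
      exact ⟨b, ⟨x, hx⟩, Subtype.ext hxy⟩

variable {C} in
lemma mapsTo_cubeMap {n : ℕ} (b : cell C n) :
    Set.MapsTo (cubeMap b) {x | ‖x.1‖ = 1} (Set.range (skeletonIncl C n).hom) :=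
  fun x hx => (cellAttachment C n).mem_of_norm_eq b x hx

variable {C} in
lemma cellClass_eq {n : ℕ} {γ : RelHom {x : Cube n | ‖x.1‖ = 1} n}
    (hγ : bridge (isEmbedding_diskIncl.{u} n) n (RelHom.map (cubeUp.{u} n) (mapsTo_cubeUp n) n γ) =
      diskClass.{u} n) (b : cell C n) :
    cellClass b = bridge (isEmbedding_skeletonIncl C n) n
      (RelHom.map (cubeMap b) (mapsTo_cubeMap b) n γ) := by
  have w : diskIncl n ≫ charMap b = attachMap b ≫ skeletonIncl C n := rfl
  rw [cellClass, ← hγ]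
  refine (relHomologyMap_bridge _ (isEmbedding_skeletonIncl C n) _ _ w
    (mapsTo_range_of_comp_eq w) _).trans (congrArg _ ?_)
  exact RelHom.map_comp _ _ _ _ (mapsTo_cubeMap b) γ

/-- The classes of the `n`-cells form a basis of the homology of the `n`-skeleton relative to the
`(n - 1)`-skeleton. -/
theorem bijective_linearCombination_cellClass [CWComplex.Finite C] (n : ℕ) :
    Function.Bijective (Finsupp.linearCombination ℤ (cellClass (C := C) (n := n))) := by
  obtain ⟨γ, hγ, h⟩ := exists_isGen_diskClass.{u} n
  have h1 := (bridge_bijective (isEmbedding_skeletonIncl C n) n).comp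
    ((cellAttachment C n).bijective_sum_smul mapsTo_cubeMap hγ)
  have h2 := h1.comp (Finsupp.linearEquivFunOnFinite ℤ ℤ (cell C n)).bijective
  convert h2 using 1
  ext c
  rw [Finsupp.linearCombination_apply, Finsupp.sum_fintype _ _ fun b => Module.zero_smul (R := ℤ) (cellClass b)]
  simp only [Function.comp_apply, map_sum]
  refine Finset.sum_congr rfl fun b _ => ?_
  rw [cellClass_eq h b]
  exact (LinearMap.map_smul (intLinear (bridge (isEmbedding_skeletonIncl C n) n)) (c b) _).symm

end Basis

end HigherTree

end

/-! ### The cellular boundary and its restriction to subcomplexes. -/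

noncomputable section

namespace HigherTree

/-! ### Naturality for maps of pairs -/

section Pairs

variable {A Y B Z D W : TopCat.{u}} (i : A ⟶ Y) (j : B ⟶ Z) (k : D ⟶ W)

lemma relHomologyMap_comp (f : A ⟶ B) (g : Y ⟶ Z) (w : i ≫ g = f ≫ j) (f' : B ⟶ D) (g' : Z ⟶ W)
    (w' : j ≫ g' = f' ≫ k) (f'' : A ⟶ D) (g'' : Y ⟶ W) (w'' : i ≫ g'' = f'' ≫ k)
    (hg : g ≫ g' = g'') (n : ℕ) :
    relHomologyMap i j f g w n ≫ relHomologyMap j k f' g' w' n =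
      relHomologyMap i k f'' g'' w'' n := by
  rw [relHomologyMap, relHomologyMap, relHomologyMap, ← HomologicalComplex.homologyMap_comp]
  congr 1
  rw [← cancel_epi (cokernel.π (singularChains.map i))]
  simp only [cokernel.map, cokernel.π_desc_assoc, cokernel.π_desc, Category.assoc]
  rw [← hg, Functor.map_comp, Category.assoc]

lemma toRel_connecting [Mono i] (n : ℕ) : toRel i (n + 1) ≫ connecting i n = 0 :=
  (pairChains_shortExact i).comp_δ (n + 1) n (by simp)

lemma toRel_naturality (f : A ⟶ B) (g : Y ⟶ Z) (w : i ≫ g = f ≫ j) (n : ℕ) :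
    toRel i n ≫ relHomologyMap i j f g w n =
      HomologicalComplex.homologyMap (singularChains.map g) n ≫ toRel j n := by
  rw [toRel, toRel, relHomologyMap, ← HomologicalComplex.homologyMap_comp,
    ← HomologicalComplex.homologyMap_comp]
  congr 1
  exact cokernel.π_desc _ _ _

lemma connecting_naturality [Mono i] [Mono j] (f : A ⟶ B) (g : Y ⟶ Z) (w : i ≫ g = f ≫ j)
    (n : ℕ) :
    connecting i n ≫ HomologicalComplex.homologyMap (singularChains.map f) n =
      relHomologyMap i j f g w (n + 1) ≫ connecting j n := by
  let φ : pairChains i ⟶ pairChains j :=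
    { τ₁ := singularChains.map f
      τ₂ := singularChains.map g
      τ₃ := cokernel.map (singularChains.map i) (singularChains.map j)
        (singularChains.map f) (singularChains.map g)
        (by rw [← Functor.map_comp, ← Functor.map_comp, w])
      comm₁₂ := by
        change singularChains.map f ≫ singularChains.map j =
          singularChains.map i ≫ singularChains.map g
        rw [← Functor.map_comp, ← Functor.map_comp, w]
      comm₂₃ := (cokernel.π_desc _ _ _).symm }
  exact HomologicalComplex.HomologySequence.δ_naturality φ (pairChains_shortExact i)
    (pairChains_shortExact j) (n + 1) n (by simp)

end Pairs

/-! ### The cellular boundary -/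

lemma linearCombination_single_one {α M : Type*} [AddCommMonoid M] [Module ℤ M] (v : α → M)
    (b : α) : Finsupp.linearCombination ℤ v (Finsupp.single b 1) = v b := by
  rw [Finsupp.linearCombination_single, one_smul]

section Cellular

variable {X : Type u} [TopologicalSpace X] [T2Space X] (C : Set X) [CWComplex C]

/-- The composite contains two consecutive maps of the long exact sequence of one pair of skeleta.
-/
lemma skeletonBoundary_comp (n : ℕ) : skeletonBoundary C (n + 1) ≫ skeletonBoundary C n = 0 := by
  rw [skeletonBoundary, skeletonBoundary, Category.assoc]
  have h := toRel_connecting (skeletonIncl C (n + 1)) n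
  rw [reassoc_of% h, zero_comp, comp_zero]

variable [CWComplex.Finite C]

variable {C} in
-- Since the cell classes span, the equation by which the incidence numbers were chosen has a
-- solution, so the choice satisfies it.
lemma linearCombination_cellBoundary {n : ℕ} (b : cell C (n + 1)) :
    Finsupp.linearCombination ℤ (cellClass (C := C) (n := n)) (cellBoundary b) =
      (skeletonBoundary C n).hom (cellClass b) :=
  Classical.epsilon_spec (p := fun c => Finsupp.linearCombination ℤ (cellClass (C := C) (n := n)) c =
    (skeletonBoundary C n).hom (cellClass b)) ((bijective_linearCombination_cellClass C n).2 _)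

variable {C} in
lemma linearCombination_boundary {n : ℕ} (x : IntChain C (n + 1)) :
    Finsupp.linearCombination ℤ (cellClass (C := C) (n := n)) (boundary C n x) =
      (skeletonBoundary C n).hom
        (Finsupp.linearCombination ℤ (cellClass (C := C) (n := n + 1)) x) := by
  have h : Finsupp.linearCombination ℤ (cellClass (C := C) (n := n)) ∘ₗ boundary C n =
      (skeletonBoundary C n).hom ∘ₗ
        Finsupp.linearCombination ℤ (cellClass (C := C) (n := n + 1)) := by
    ext b
    simp only [LinearMap.comp_apply, Finsupp.lsingle_apply, boundary,
      linearCombination_single_one, linearCombination_cellBoundary]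
  exact LinearMap.congr_fun h x

theorem boundary_boundary {n : ℕ} (x : IntChain C (n + 2)) :
    boundary C n (boundary C (n + 1) x) = 0 := by
  apply (bijective_linearCombination_cellClass C n).1
  rw [linearCombination_boundary, linearCombination_boundary, map_zero]
  exact LinearMap.congr_fun (congrArg ModuleCat.Hom.hom (skeletonBoundary_comp C n)) _

lemma boundaries_le_cycles (n : ℕ) : boundaries C n ≤ cycles C n := by
  cases n with
  | zero => exact le_top
  | succ n =>
    rintro _ ⟨x, rfl⟩
    exact boundary_boundary C x

end Cellular

/-! ### Subcomplexes -/

section Subcomplex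

variable {X : Type u} [TopologicalSpace X] [T2Space X] {C : Set X} [CWComplex C]
  (T : Subcomplex C)

lemma skeletonLT_subcomplex_subset (n : ℕ) :
    (skeletonLT (T : Set X) (n : ℕ∞) : Set X) ⊆ skeletonLT C (n : ℕ∞) := by
  intro x hx
  obtain ⟨m, hm, j, hj⟩ := CWComplex.mem_skeletonLT_iff.1 hx
  exact CWComplex.mem_skeletonLT_iff.2 ⟨m, hm, j.1, hj⟩

/-- The inclusion of the skeleta of a subcomplex. -/
def subSkeleton (n : ℕ) : skeletonSpace (T : Set X) n ⟶ skeletonSpace C n :=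
  TopCat.ofHom ⟨Set.inclusion (skeletonLT_subcomplex_subset T n), continuous_inclusion _⟩

lemma skeletonIncl_subSkeleton (n : ℕ) : skeletonIncl (T : Set X) n ≫ subSkeleton T (n + 1) =
    subSkeleton T n ≫ skeletonIncl C n := rfl

/-- The map of relative homology groups induced by the inclusion of a subcomplex. -/
def subRel (n : ℕ) : relHomology (skeletonIncl (T : Set X) n) n ⟶ relHomology (skeletonIncl C n) n :=
  relHomologyMap _ _ (subSkeleton T n) (subSkeleton T (n + 1)) (skeletonIncl_subSkeleton T n) n

/-- The inclusion of the cells of a subcomplex. -/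
def subCell (n : ℕ) (b : cell (T : Set X) n) : cell C n := b.1

lemma subCell_injective (n : ℕ) : Function.Injective (subCell T n) := Subtype.val_injective

lemma subRel_cellClass {n : ℕ} (b : cell (T : Set X) n) :
    (subRel T n).hom (cellClass b) = cellClass (subCell T n b) := by
  have h := relHomologyMap_comp (diskIncl n) (skeletonIncl (T : Set X) n) (skeletonIncl C n)
    (attachMap b) (charMap b) rfl (subSkeleton T n) (subSkeleton T (n + 1)) rfl
    (attachMap (subCell T n b)) (charMap (subCell T n b)) rfl rfl n
  exact LinearMap.congr_fun (congrArg ModuleCat.Hom.hom h) (diskClass n)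

lemma skeletonBoundary_naturality (n : ℕ) :
    skeletonBoundary (T : Set X) n ≫ subRel T n = subRel T (n + 1) ≫ skeletonBoundary C n := by
  rw [skeletonBoundary, skeletonBoundary, subRel, subRel, Category.assoc, toRel_naturality,
    ← Category.assoc, connecting_naturality _ _ _ _ (skeletonIncl_subSkeleton T (n + 1)),
    Category.assoc]

variable [CWComplex.Finite C]

/-- Incidence numbers of `T` and of `C` come from unrelated choices; they agree because both satisfy
the same equation in the homology of the skeleta of `C`, where the cell classes are independent. -/
theorem boundary_mapDomain {n : ℕ} (x : IntChain (T : Set X) (n + 1)) :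
    boundary C n (Finsupp.mapDomain (subCell T (n + 1)) x) =
      Finsupp.mapDomain (subCell T n) (boundary (T : Set X) n x) := by
  have h : ∀ (m : ℕ) (y : IntChain (T : Set X) m),
      Finsupp.linearCombination ℤ (cellClass (C := C) (n := m)) (Finsupp.mapDomain (subCell T m) y) =
      (subRel T m).hom (Finsupp.linearCombination ℤ (cellClass (C := (T : Set X)) (n := m)) y) := by
    intro m y
    have h1 : Finsupp.linearCombination ℤ (cellClass (C := C) (n := m)) ∘ₗ
        Finsupp.lmapDomain ℤ ℤ (subCell T m) = (subRel T m).hom ∘ₗ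
        Finsupp.linearCombination ℤ (cellClass (C := (T : Set X)) (n := m)) := by
      ext b
      simp only [LinearMap.comp_apply, Finsupp.lsingle_apply, Finsupp.lmapDomain_apply,
        Finsupp.mapDomain_single, linearCombination_single_one, subRel_cellClass]
    exact LinearMap.congr_fun h1 y
  apply (bijective_linearCombination_cellClass C n).1
  rw [linearCombination_boundary, h, h, linearCombination_boundary]
  exact (LinearMap.congr_fun (congrArg ModuleCat.Hom.hom (skeletonBoundary_naturality T n)) _).symm

end Subcomplex

end HigherTree

end

/-! ### Cauchy–Binet, lattice indices and torsion. -/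

noncomputable section

namespace HigherTree

/-! ### The Cauchy–Binet formula -/

section CauchyBinet

open Matrix Finset

variable {R β : Type*} [CommRing R] [Fintype β] {r : ℕ}

lemma det_mul_eq_sum_fun (A : Matrix (Fin r) β R) (B : Matrix β (Fin r) R) :
    (A * B).det = ∑ p : Fin r → β, (∏ i, B (p i) i) * (A.submatrix id p).det := by
  simp only [det_apply', mul_apply, prod_univ_sum, mul_sum, Fintype.piFinset_univ]
  rw [sum_comm]
  refine sum_congr rfl fun p _ => sum_congr rfl fun σ _ => ?_
  rw [prod_mul_distrib]
  simp only [submatrix_apply, id]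
  ring

variable [DecidableEq β]

/-- Injective functions with the same image as `c` are `c` composed with permutations; the sign from
permuting the columns of A assembles the terms into the determinant of the minor of B. -/
lemma sum_fun_of_image (A : Matrix (Fin r) β R) (B : Matrix β (Fin r) R) {c : Fin r → β}
    (hc : Function.Injective c) :
    ∑ p : Fin r → β with Function.Injective p ∧ univ.image p = univ.image c,
      (∏ i, B (p i) i) * (A.submatrix id p).det =
    (A.submatrix id c).det * (B.submatrix c id).det := by
  have h : ∀ τ : Equiv.Perm (Fin r), (∏ i, B (c (τ i)) i) * (A.submatrix id (c ∘ τ)).det =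
      (A.submatrix id c).det * (Equiv.Perm.sign τ * ∏ i, B (c (τ i)) i) := by
    intro τ
    have := det_permute' τ (A.submatrix id c)
    rw [submatrix_submatrix] at this
    rw [Function.comp_id] at this
    rw [this]
    ring
  rw [det_apply' (B.submatrix c id), mul_sum]
  symm
  refine sum_bij (fun τ _ => c ∘ τ) (fun τ _ => ?_) (fun σ _ τ _ hστ => ?_) (fun p hp => ?_)
    (fun τ _ => (h τ).symm)
  · rw [mem_filter_univ]
    refine ⟨hc.comp τ.injective, ?_⟩
    rw [← image_image, image_univ_equiv]
  · ext i
    exact congrArg Fin.val (hc (congrFun hστ i))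
  · rw [mem_filter_univ] at hp
    have hex : ∀ i, ∃ j, c j = p i := by
      intro i
      have : p i ∈ univ.image c := hp.2 ▸ mem_image_of_mem p (mem_univ i)
      simpa using this
    choose τ hτ using hex
    have hinj : Function.Injective τ := fun i j hij => hp.1 (by rw [← hτ, ← hτ, hij])
    exact ⟨Equiv.ofBijective τ (Finite.injective_iff_bijective.1 hinj), mem_univ _, funext hτ⟩

/-- The **Cauchy–Binet formula**, for any choice of enumerations of the sets of `r` elements. -/
theorem det_mul_eq_sum_minors (A : Matrix (Fin r) β R) (B : Matrix β (Fin r) R)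
    (c : Finset β → Fin r → β)
    (hc : ∀ S, S.card = r → Function.Injective (c S) ∧ univ.image (c S) = S) :
    (A * B).det = ∑ S ∈ powersetCard r univ,
      (A.submatrix id (c S)).det * (B.submatrix (c S) id).det := by
  rw [det_mul_eq_sum_fun, ← sum_filter_of_ne (p := Function.Injective),
    ← sum_fiberwise_of_maps_to (t := powersetCard r univ) (g := fun p => univ.image p)]
  · refine sum_congr rfl fun S hS => ?_
    have hS := hc S (mem_powersetCard.1 hS).2
    rw [filter_filter, ← sum_fun_of_image A B hS.1, hS.2]
  · intro p hp
    rw [mem_filter_univ] at hp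
    rw [mem_powersetCard, card_image_of_injective _ hp, card_univ, Fintype.card_fin]
    exact ⟨subset_univ _, rfl⟩
  · intro p _ hp
    by_contra hinj
    rw [Function.Injective] at hinj
    push Not at hinj
    obtain ⟨i, j, hij, hne⟩ := hinj
    -- A repeated index gives two equal columns, so only injective functions contribute.
    exact hp (by rw [det_zero_of_column_eq hne (fun k => by simp [hij]), mul_zero])

lemma det_mul_diagonal_mul_transpose (Q : Matrix (Fin r) β R) (d : β → R)
    (c : Finset β → Fin r → β)
    (hc : ∀ S, S.card = r → Function.Injective (c S) ∧ univ.image (c S) = S) :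
    (Q * diagonal d * Qᵀ).det = ∑ S ∈ powersetCard r univ,
      (Q.submatrix id (c S)).det ^ 2 * ∏ b ∈ S, d b := by
  rw [det_mul_eq_sum_minors _ _ c hc]
  refine sum_congr rfl fun S hS => ?_
  have hS := hc S (mem_powersetCard.1 hS).2
  have h1 : (Q * diagonal d).submatrix id (c S) =
      Q.submatrix id (c S) * diagonal (d ∘ c S) := by
    ext i j
    simp
  have h2 : Qᵀ.submatrix (c S) id = (Q.submatrix id (c S))ᵀ := rfl
  rw [h1, h2, det_mul, det_transpose, det_diagonal]
  have h3 : ∏ b ∈ S, d b = ∏ i, d (c S i) := by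
    conv_lhs => rw [← hS.2]
    exact prod_image fun i _ j _ hij => hS.1 hij
  rw [h3]
  simp only [Function.comp_apply]
  ring

lemma exists_enumeration (β : Type*) [DecidableEq β] (r : ℕ) [Nonempty (Fin r → β)] : ∃ c : Finset β → Fin r → β,
    ∀ S, S.card = r → Function.Injective (c S) ∧ univ.image (c S) = S := by
  have : ∀ S : Finset β, ∃ c : Fin r → β, S.card = r →
      Function.Injective c ∧ univ.image c = S := by
    intro S
    by_cases hS : S.card = r
    · let e := (S.equivFinOfCardEq hS).symm
      refine ⟨fun i => e i, fun _ => ⟨Subtype.val_injective.comp e.injective, ?_⟩⟩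
      ext b
      simp only [mem_image, mem_univ, true_and]
      constructor
      · rintro ⟨i, rfl⟩
        exact (e i).2
      · intro hb
        exact ⟨e.symm ⟨b, hb⟩, by simp⟩
    · exact ⟨Classical.arbitrary _, fun h => (hS h).elim⟩
  choose c hc using this
  exact ⟨c, hc⟩

end CauchyBinet

end HigherTree

end

noncomputable section

namespace HigherTree

/-! ### Torsion of quotients of a lattice -/

section Torsion

variable {N : Type*} [AddCommGroup N]

/-- The elements of `Z` with a nonzero multiple in `B`. -/
def saturation (Z B : AddSubgroup N) : AddSubgroup N where
  carrier := {x | x ∈ Z ∧ ∃ k : ℤ, k ≠ 0 ∧ k • x ∈ B}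
  zero_mem' := ⟨zero_mem Z, 1, one_ne_zero, by rw [smul_zero]; exact zero_mem B⟩
  add_mem' := by
    rintro x y ⟨hx, k, hk, hkx⟩ ⟨hy, l, hl, hly⟩
    refine ⟨add_mem hx hy, k * l, mul_ne_zero hk hl, ?_⟩
    rw [smul_add, mul_comm, mul_smul, mul_comm, mul_smul]
    exact add_mem (zsmul_mem hkx l) (zsmul_mem hly k)
  neg_mem' := by
    rintro x ⟨hx, k, hk, hkx⟩
    refine ⟨neg_mem hx, k, hk, ?_⟩
    rw [smul_neg]
    exact neg_mem hkx

/-- The order of the torsion of `Z / B`, for subgroups `B ≤ Z`. -/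
def torsionCard (Z B : AddSubgroup N) : ℕ := B.relIndex (saturation Z B)

/-- The torsion of Z / B is the saturation of B modulo B. A subgroup of finite index has the same
saturation, so the formula is multiplicativity of the index. This yields θ_T = [B_k(X) : B_k(T)]
θ_X. -/
lemma torsionCard_of_le {Z B B' : AddSubgroup N} (h : B' ≤ B) (hZ : B ≤ Z)
    (hi : B'.relIndex B ≠ 0) : torsionCard Z B' = B'.relIndex B * torsionCard Z B := by
  have hs : saturation Z B' = saturation Z B := by
    ext x
    refine ⟨fun ⟨hx, k, hk, hkx⟩ => ⟨hx, k, hk, h hkx⟩, fun ⟨hx, k, hk, hkx⟩ => ?_⟩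
    -- The index of B' in B annihilates B / B'.
    have h2 := (B'.addSubgroupOf B).nsmul_index_mem ⟨_, hkx⟩
    rw [AddSubgroup.mem_addSubgroupOf] at h2
    refine ⟨hx, (B'.relIndex B : ℤ) * k, mul_ne_zero (by exact_mod_cast hi) hk, ?_⟩
    rw [mul_smul, natCast_zsmul]
    exact h2
  have hle : B ≤ saturation Z B :=
    fun x hx => ⟨hZ hx, 1, one_ne_zero, by rwa [one_smul]⟩
  rw [torsionCard, torsionCard, hs, AddSubgroup.relIndex_mul_relIndex _ _ _ h hle]

lemma torsionCard_map {M : Type*} [AddCommGroup M] {j : M →+ N} (hj : Function.Injective j)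
    (Z B : AddSubgroup M) : torsionCard (Z.map j) (B.map j) = torsionCard Z B := by
  have hs : saturation (Z.map j) (B.map j) = (saturation Z B).map j := by
    ext x
    constructor
    · rintro ⟨⟨z, hz, rfl⟩, k, hk, y, hy, hyz⟩
      rw [← map_zsmul] at hyz
      exact ⟨z, ⟨hz, k, hk, by rwa [← hj hyz]⟩, rfl⟩
    · rintro ⟨z, ⟨hz, k, hk, hkz⟩, rfl⟩
      exact ⟨⟨z, hz, rfl⟩, k, hk, k • z, hkz, map_zsmul j k z⟩
  rw [torsionCard, torsionCard, hs, AddSubgroup.relIndex_map_map_of_injective _ _ hj]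

lemma card_torsion_eq_relIndex {G M : Type*} [AddCommGroup M] [AddCommGroup G]
    [inst : Module ℤ G] (q : M →+ G) (hq : Function.Surjective q) :
    Nat.card (Submodule.torsion ℤ G) = torsionCard ⊤ q.ker := by
  obtain rfl : inst = AddCommGroup.toIntModule G := Subsingleton.elim _ _
  have hs : saturation ⊤ q.ker = (Submodule.torsion ℤ G).toAddSubgroup.comap q := by
    ext x
    change (_ ∧ _) ↔ q x ∈ Submodule.torsion ℤ G
    rw [Submodule.mem_torsion_iff]
    constructor
    · rintro ⟨-, k, hk, hkx⟩
      exact ⟨⟨k, mem_nonZeroDivisors_of_ne_zero hk⟩, (map_zsmul q k x).symm.trans hkx⟩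
    · rintro ⟨k, hk⟩
      exact ⟨trivial, k, nonZeroDivisors.coe_ne_zero k, (map_zsmul q (k : ℤ) x).trans hk⟩
  rw [torsionCard, hs, AddSubgroup.relIndex_ker, AddSubgroup.map_comap_eq_self_of_surjective hq]
  rfl

lemma card_torsion_eq_torsionCard {G : Type*} [AddCommGroup G] [Module ℤ G] {Z B : AddSubgroup N}
    (h : B ≤ Z) (q : Z →+ G) (hq : Function.Surjective q) (hk : ∀ z, q z = 0 ↔ z.1 ∈ B) :
    Nat.card (Submodule.torsion ℤ G) = torsionCard Z B := by
  rw [card_torsion_eq_relIndex q hq, ← torsionCard_map (j := Z.subtype) Z.subtype_injective]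
  congr 1
  · ext x
    constructor
    · rintro ⟨y, -, rfl⟩
      exact y.2
    · intro hx
      exact ⟨⟨x, hx⟩, trivial, rfl⟩
  · ext x
    constructor
    · rintro ⟨y, hy, rfl⟩
      exact (hk y).1 hy
    · intro hx
      exact ⟨⟨x, h hx⟩, (hk ⟨x, h hx⟩).2 hx, rfl⟩

lemma finite_of_isTorsion {G : Type*} [AddCommGroup G] [inst : Module ℤ G] [Module.Finite ℤ G]
    (h : ∀ x : G, ∃ k : ℤ, k ≠ 0 ∧ k • x = 0) : Finite G := by
  obtain rfl : inst = AddCommGroup.toIntModule G := Subsingleton.elim _ _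
  refine Module.finite_of_fg_torsion G fun x => ?_
  obtain ⟨k, hk, hkx⟩ := h x
  exact ⟨⟨k, mem_nonZeroDivisors_of_ne_zero hk⟩, hkx⟩

lemma card_torsion_ne_zero (G : Type*) [AddCommGroup G] [AddGroup.FG G] :
    Nat.card (Submodule.torsion ℤ G) ≠ 0 := by
  have h : Module.Finite ℤ G := Module.Finite.iff_addGroup_fg.2 inferInstance
  have hn : IsNoetherian ℤ G := isNoetherian_of_isNoetherianRing_of_finite ℤ G
  have hf : Module.Finite ℤ (Submodule.torsion ℤ G) := Module.IsNoetherian.finite ℤ _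
  have : Finite (Submodule.torsion ℤ G) :=
    finite_of_isTorsion (inst := (Submodule.torsion ℤ G).module) fun x => by
      obtain ⟨k, hk⟩ := (Submodule.mem_torsion_iff _).1 x.2
      exact ⟨k, nonZeroDivisors.coe_ne_zero k, Subtype.ext hk⟩
  exact Nat.card_pos.ne'

end Torsion

/-! ### Determinants and indices -/

section Index

open Finset

variable {N β : Type*} [AddCommGroup N] [inst : Module ℤ N] {r : ℕ}

lemma det_ne_zero_iff_linearIndependent {B : Type*} [AddCommGroup B] [Module ℤ B]
    (e : Module.Basis (Fin r) ℤ B) (v : Fin r → B) : e.det v ≠ 0 ↔ LinearIndependent ℤ v := by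
  rw [← e.equivFun.toLinearMap.linearIndependent_iff e.equivFun.ker, e.det_apply,
    ← Matrix.det_transpose]
  have h : e.equivFun.toLinearMap ∘ v = (e.toMatrix v).transpose.row := by
    ext i j
    rfl
  rw [h, ← Matrix.vecMul_injective_iff, ← not_iff_not, not_not,
    ← Matrix.exists_vecMul_eq_zero_iff, ← Matrix.coe_vecMulLinear, injective_iff_map_eq_zero]
  simp only [Matrix.vecMulLinear_apply]
  push Not
  exact ⟨fun ⟨x, h1, h2⟩ => ⟨x, h2, h1⟩, fun ⟨x, h1, h2⟩ => ⟨x, h2, h1⟩⟩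

lemma relIndex_span_eq_natAbs_det {B : Submodule ℤ N} (e : Module.Basis (Fin r) ℤ B)
    {v : Fin r → B} (hv : LinearIndependent ℤ v) :
    (Submodule.span ℤ (Set.range fun i => (v i : N))).toAddSubgroup.relIndex B.toAddSubgroup =
      (e.det v).natAbs := by
  obtain rfl : inst = AddCommGroup.toIntModule N := Subsingleton.elim _ _
  have hle : (Submodule.span ℤ (Set.range fun i => (v i : N))).toAddSubgroup ≤ B.toAddSubgroup := by
    change Submodule.span ℤ (Set.range fun i => (v i : N)) ≤ B
    rw [Submodule.span_le]
    rintro _ ⟨i, rfl⟩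
    exact (v i).2
  have hv' : LinearIndependent ℤ fun i => (v i : N) :=
    hv.map' B.subtype (Submodule.ker_subtype B)
  have h := AddSubgroup.relIndex_eq_natAbs_det _ _ hle (Module.Basis.span hv') e
  rw [h]
  congr 2
  ext i
  have h2 := congrArg Subtype.val (Module.Basis.span_apply hv' i)
  exact h2

end Index

end HigherTree

end

noncomputable section

namespace HigherTree

/-! ### The sum over the independent sets of maximal rank -/

lemma linearIndependent_comp_iff {ι M N : Type*} [AddCommGroup M] [AddCommGroup N] [Module ℤ M]
    [Module ℤ N] {f : M →+ N} (hf : Function.Injective f) (v : ι → M) :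
    LinearIndependent ℤ (fun i => f (v i)) ↔ LinearIndependent ℤ v :=
  (intLinear f).linearIndependent_iff (LinearMap.ker_eq_bot.2 hf)

lemma finrank_span_image {N β : Type*} [AddCommGroup N] [inst : Module ℤ N] {w : β → N}
    {S : Finset β} (h : LinearIndependent ℤ (fun b : S => w b)) :
    Module.finrank ℤ (Submodule.span ℤ (w '' S)) = S.card := by
  have h1 := finrank_span_eq_card h
  have h3 : Set.range (fun b : S => w b) = w '' S := by
    ext y
    simp
  rw [h3, Fintype.card_coe] at h1
  rw [← h1]
  congr 1
  exact Subsingleton.elim _ _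

section Minors

open Finset Matrix

variable {N β : Type*} [AddCommGroup N] [Module ℤ N] {r : ℕ} {w : β → N}
  (e : Module.Basis (Fin r) ℤ (Submodule.span ℤ (Set.range w)))

/-- The coordinates of vectors in a basis of their span. -/
def coordMatrix : Matrix (Fin r) β ℤ :=
  Matrix.of fun i b => e.repr ⟨w b, Submodule.subset_span ⟨b, rfl⟩⟩ i

lemma det_coordMatrix_submatrix (c : Fin r → β) : ((coordMatrix e).submatrix id c).det =
    e.det fun i => ⟨w (c i), Submodule.subset_span ⟨c i, rfl⟩⟩ := by
  rw [e.det_apply]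
  rfl

variable [DecidableEq β] {c : Fin r → β} {S : Finset β}

lemma linearIndependent_iff_det_ne_zero (hc : Function.Injective c) (hS : univ.image c = S) :
    LinearIndependent ℤ (fun b : S => w b) ↔ ((coordMatrix e).submatrix id c).det ≠ 0 := by
  rw [det_coordMatrix_submatrix, det_ne_zero_iff_linearIndependent]
  rw [← linearIndependent_comp_iff
    (f := (Submodule.span ℤ (Set.range w)).subtype.toAddMonoidHom) Subtype.val_injective]
  let f : Fin r ≃ S := Equiv.ofBijective
    (fun i => (⟨c i, hS ▸ mem_image_of_mem c (mem_univ i)⟩ : S))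
    ⟨fun i j hij => hc (congrArg Subtype.val hij), fun ⟨b, hb⟩ => by
      rw [← hS] at hb
      obtain ⟨i, -, rfl⟩ := mem_image.1 hb
      exact ⟨i, rfl⟩⟩
  rw [← linearIndependent_equiv f]
  rfl

lemma torsionCard_span_image (hS : univ.image c = S) {Z : AddSubgroup N}
    (hZ : (Submodule.span ℤ (Set.range w)).toAddSubgroup ≤ Z)
    (hd : ((coordMatrix e).submatrix id c).det ≠ 0) :
    torsionCard Z (Submodule.span ℤ (w '' S)).toAddSubgroup =
      ((coordMatrix e).submatrix id c).det.natAbs *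
        torsionCard Z (Submodule.span ℤ (Set.range w)).toAddSubgroup := by
  have h : w '' S = Set.range (fun i => w (c i)) := by
    rw [← hS, coe_image, coe_univ, Set.image_univ, ← Set.range_comp]
    rfl
  rw [h]
  rw [det_coordMatrix_submatrix] at hd ⊢
  rw [← relIndex_span_eq_natAbs_det e ((det_ne_zero_iff_linearIndependent e _).1 hd)]
  refine torsionCard_of_le ?_ hZ ?_
  · refine Submodule.span_mono ?_
    rintro _ ⟨i, rfl⟩
    exact ⟨c i, rfl⟩
  · rw [relIndex_span_eq_natAbs_det e ((det_ne_zero_iff_linearIndependent e _).1 hd)]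
    exact Int.natAbs_ne_zero.2 hd

end Minors

section Sum

open Finset Matrix

variable {N β : Type*} [AddCommGroup N] [Module ℤ N] {r : ℕ} {w : β → N}
  (e : Module.Basis (Fin r) ℤ (Submodule.span ℤ (Set.range w)))

/-- The vectors indexed by `S` are independent and span a subgroup of maximal rank. -/
def IsMaximalIndep (w : β → N) (S : Finset β) : Prop :=
  LinearIndependent ℤ (fun b : S => w b) ∧
    Module.finrank ℤ (Submodule.span ℤ (w '' S)) =
      Module.finrank ℤ (Submodule.span ℤ (Set.range w))

include e in
lemma IsMaximalIndep.card_eq {S : Finset β} (h : IsMaximalIndep w S) : S.card = r := by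
  rw [← finrank_span_image h.1, h.2, Module.finrank_eq_card_basis e, Fintype.card_fin]

lemma isMaximalIndep_iff [DecidableEq β] {c : Fin r → β} {S : Finset β} (hc : Function.Injective c)
    (hS : univ.image c = S) :
    IsMaximalIndep w S ↔ ((coordMatrix e).submatrix id c).det ≠ 0 := by
  rw [← linearIndependent_iff_det_ne_zero e hc hS]
  refine ⟨fun h => h.1, fun h => ⟨h, ?_⟩⟩
  rw [finrank_span_image h, Module.finrank_eq_card_basis e, Fintype.card_fin, ← hS,
    card_image_of_injective _ hc, card_univ, Fintype.card_fin]

variable [Fintype β] [DecidableEq β]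

open Classical in
-- In the Cauchy–Binet sum, a minor is nonzero exactly for a maximal independent set, and its
-- absolute value is the index of the sublattice spanned; multiplied by the torsion order of the
-- full span it gives that of the sublattice.
theorem sq_torsionCard_mul_det (Z : AddSubgroup N)
    (hZ : (Submodule.span ℤ (Set.range w)).toAddSubgroup ≤ Z) (d : β → ℝ) :
    (torsionCard Z (Submodule.span ℤ (Set.range w)).toAddSubgroup : ℝ) ^ 2 *
      ((coordMatrix e).map (Int.cast : ℤ → ℝ) * diagonal d *
        ((coordMatrix e).map (Int.cast : ℤ → ℝ))ᵀ).det =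
    ∑ S : Finset β with IsMaximalIndep w S,
      (torsionCard Z (Submodule.span ℤ (w '' S)).toAddSubgroup : ℝ) ^ 2 * ∏ b ∈ S, d b := by
  -- A default enumeration is needed for sets of the wrong size. If there are no vectors, the span
  -- is zero and r = 0.
  have : Nonempty (Fin r → β) := by
    rcases isEmpty_or_nonempty β with hβ | hβ
    · have h2 : IsMaximalIndep w ∅ := by
        refine ⟨linearIndependent_empty_type, ?_⟩
        rw [coe_empty, Set.image_empty, Set.range_eq_empty]
      obtain rfl : 0 = r := h2.card_eq e
      infer_instance
    · infer_instance
  obtain ⟨c, hc⟩ := exists_enumeration β r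
  have hdet : ∀ S, (((coordMatrix e).map (Int.cast : ℤ → ℝ)).submatrix id (c S)).det =
      (((coordMatrix e).submatrix id (c S)).det : ℝ) := by
    intro S
    exact (Int.cast_det _).symm
  rw [det_mul_diagonal_mul_transpose _ d c hc, mul_sum]
  symm
  refine sum_subset_zero_on_sdiff (fun S hS => ?_) (fun S hS => ?_) (fun S hS => ?_)
  · rw [mem_powersetCard]
    exact ⟨subset_univ _, ((mem_filter_univ _).1 hS).card_eq e⟩
  · rw [mem_sdiff, mem_powersetCard, mem_filter_univ] at hS
    have h := hc S hS.1.2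
    rw [isMaximalIndep_iff e h.1 h.2, not_not] at hS
    rw [hdet, hS.2]
    simp
  · rw [mem_filter_univ] at hS
    have h := hc S (hS.card_eq e)
    rw [isMaximalIndep_iff e h.1 h.2] at hS
    rw [torsionCard_span_image e h.2 hZ hS, hdet, Nat.cast_mul, mul_pow, Nat.cast_natAbs,
      Int.cast_abs, sq_abs]
    ring

end Sum

end HigherTree

end

/-! ### The covolume and the matrix of the weighted Laplacian. -/

noncomputable section

namespace HigherTree

/-! ### Covolumes and Gram determinants -/

section Covolume

open Matrix MeasureTheory

variable {E : Type*} [NormedAddCommGroup E] [InnerProductSpace ℝ E] {ι κ : Type*} [Fintype ι]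
  [DecidableEq ι] [Fintype κ]

lemma det_gram_eq_sq (b : OrthonormalBasis ι ℝ E) (v : ι → E) :
    (gram ℝ v).det = b.toBasis.det v ^ 2 := by
  rw [gram_eq_conjTranspose_mul b, det_mul, det_conjTranspose, Module.Basis.det_apply, sq]
  have h : (of fun i j => b.repr (v j) i) = b.toBasis.toMatrix v := by
    ext i j
    simp [Module.Basis.toMatrix_apply]
  simp [h]

variable [MeasurableSpace E] [BorelSpace E]

lemma covolume_sq_eq_det_gram (b : OrthonormalBasis κ ℝ E) (V : Module.Basis ι ℝ E)
    {L : Submodule ℤ E} (hL : L = Submodule.span ℤ (Set.range V)) :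
    ZLattice.covolume L b.toBasis.addHaar ^ 2 = (gram ℝ V).det := by
  subst hL
  have hfin : FiniteDimensional ℝ E := V.finiteDimensional_of_finite
  let f : κ ≃ ι := b.toBasis.indexEquiv V
  -- The two bases must share an index type for the determinant of one in the other to make sense.
  let b' : OrthonormalBasis ι ℝ E := b.reindex f
  have hμ : b.toBasis.addHaar = b'.toBasis.addHaar := by
    rw [OrthonormalBasis.reindex_toBasis, Module.Basis.addHaar_reindex]
  rw [hμ, ZLattice.covolume_eq_measure_fundamentalDomain _ _
    (ZSpan.isAddFundamentalDomain V b'.toBasis.addHaar), measureReal_def,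
    ZSpan.measure_fundamentalDomain V _ b'.toBasis,
    measure_congr (ZSpan.fundamentalDomain_ae_parallelepiped b'.toBasis _),
    Module.Basis.addHaar_self, mul_one, ENNReal.toReal_ofReal (abs_nonneg _), sq_abs,
    ← det_gram_eq_sq]

end Covolume

/-! ### The weighted Laplacian in a basis of the lattice of boundaries -/

lemma map_eq_sum_repr {ι M N : Type*} [Fintype ι] [AddCommGroup M] [Module ℤ M] [AddCommGroup N]
    [Module ℝ N] (e : Module.Basis ι ℤ M) (f : M →+ N) (x : M) :
    f x = ∑ i, (e.repr x i : ℝ) • f (e i) := by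
  conv_lhs => rw [← e.sum_repr x, map_sum]
  refine Finset.sum_congr rfl fun i _ => ?_
  rw [Int.cast_smul_eq_zsmul]
  have h := (intLinear f).map_smul (e.repr x i) (e i)
  exact h

section Coordinates

variable {X : Type u} [TopologicalSpace X] {C : Set X} [CWComplex C] [CWComplex.Finite C]

lemma map_intChain {N : Type*} [AddCommGroup N] [Module ℝ N] {n : ℕ} (f : IntChain C n →+ N)
    (x : IntChain C n) : f x = ∑ b, (x b : ℝ) • f (Finsupp.single b 1) := by
  rw [map_eq_sum_repr Finsupp.basisSingleOne f x]
  simp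

lemma toReal_apply {n : ℕ} (x : IntChain C n) (a : cell C n) : toReal C n x a = x a := by
  classical
  have h := map_intChain (toReal C n).toAddMonoidHom x
  simp only [LinearMap.toAddMonoidHom_coe] at h
  rw [h]
  simp [toReal, cellBasis, EuclideanSpace.basisFun_apply,
    Pi.single_apply]

lemma toReal_injective (n : ℕ) : Function.Injective (toReal C n) := by
  intro x y h
  ext a
  have := congrArg (fun z : RealChain C n => z a) h
  simp only [toReal_apply] at this
  exact_mod_cast this

lemma resistance_apply {n : ℕ} (s : cell C n → ℝ) (v : RealChain C n) (b : cell C n) :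
    resistance s v b = s b * v b := by
  classical
  simp [resistance, Module.Basis.constr_apply_fintype, cellBasis, EuclideanSpace.basisFun_apply,
    Pi.single_apply, mul_comm]

lemma inner_cellBasis {n : ℕ} (y : RealChain C n) (b : cell C n) :
    inner ℝ (cellBasis C n b) y = y b := by
  rw [← OrthonormalBasis.repr_apply_apply]
  rfl

end Coordinates

section Laplacian

open Matrix

variable {X : Type u} [TopologicalSpace X] [T2Space X] {C : Set X} [CWComplex C]
  [CWComplex.Finite C]

lemma realBoundary_cellBasis {n : ℕ} (b : cell C (n + 1)) :
    realBoundary C n (cellBasis C (n + 1) b) = toReal C n (cellBoundary b) := by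
  have h := (cellBasis C (n + 1)).toBasis.constr_basis ℝ
    (fun b => toReal C n (boundary C n (Finsupp.single b 1))) b
  rw [OrthonormalBasis.coe_toBasis] at h
  rw [realBoundary, h, boundary, linearCombination_single_one]

lemma realBoundary_apply {n : ℕ} (y : RealChain C (n + 1)) :
    realBoundary C n y = ∑ b, y b • toReal C n (cellBoundary b) := by
  conv_lhs => rw [← (cellBasis C (n + 1)).sum_repr y]
  rw [map_sum]
  refine Finset.sum_congr rfl fun b _ => ?_
  rw [map_smul, realBoundary_cellBasis]
  rfl

lemma weightedCoboundary_apply {n : ℕ} (r : cell C (n + 1) → ℝ) (y : RealChain C n)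
    (b : cell C (n + 1)) :
    weightedCoboundary r y b = (r b)⁻¹ * inner ℝ (toReal C n (cellBoundary b)) y := by
  rw [weightedCoboundary, LinearMap.comp_apply, resistance_apply, ← realBoundary_cellBasis,
    ← LinearMap.adjoint_inner_right, inner_cellBasis]

variable {k ρ : ℕ} (e : Module.Basis (Fin ρ) ℤ
  (Submodule.span ℤ (Set.range (cellBoundary (C := C) (n := k)))))

/-- The vectors of a basis of the integral boundaries, as real chains. -/
def realVector (i : Fin ρ) : RealChain C k := toReal C k (e i)

/-- The Gram matrix of a basis of the integral boundaries. -/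
def intGram : Matrix (Fin ρ) (Fin ρ) ℤ :=
  Matrix.of fun i j => ∑ a, (e i).1 a * (e j).1 a

lemma gram_realVector : gram ℝ (realVector e) = (intGram e).map (Int.cast : ℤ → ℝ) := by
  ext i j
  rw [gram_apply, PiLp.inner_apply, map_apply, intGram, of_apply, Int.cast_sum]
  refine Finset.sum_congr rfl fun a _ => ?_
  simp only [realVector, toReal_apply, RCLike.inner_apply, conj_trivial, Int.cast_mul, mul_comm]

lemma det_gram_realVector : (gram ℝ (realVector e)).det = ((intGram e).det : ℝ) := by
  rw [gram_realVector]
  exact (Int.cast_det _).symm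

lemma toReal_eq_sum_repr (x : Submodule.span ℤ (Set.range (cellBoundary (C := C) (n := k)))) :
    toReal C k x = ∑ i, (e.repr x i : ℝ) • realVector e i :=
  map_eq_sum_repr e ((toReal C k).toAddMonoidHom.comp (Submodule.subtype _).toAddMonoidHom) x

/-- If the integer Gram matrix were singular, it would have a nonzero integer kernel vector; the
corresponding integral chain would have norm zero, contradicting independence over ℤ. -/
lemma linearIndependent_realVector : LinearIndependent ℝ (realVector e) := by
  rw [← det_gram_ne_zero_iff_linearIndependent, det_gram_realVector, Int.cast_ne_zero]
  intro h0
  obtain ⟨x, hx, hGx⟩ := exists_mulVec_eq_zero_iff.2 h0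
  refine hx ?_
  have h1 := star_dotProduct_gram_mulVec (𝕜 := ℝ) (realVector e) (fun i => (x i : ℝ))
    (fun i => (x i : ℝ))
  have h2 : gram ℝ (realVector e) *ᵥ (fun i => (x i : ℝ)) = 0 := by
    rw [gram_realVector]
    ext i
    have := congrFun hGx i
    simp only [mulVec, dotProduct, map_apply, Pi.zero_apply] at this ⊢
    exact_mod_cast this
  rw [h2, dotProduct_zero] at h1
  have h3 := inner_self_eq_zero.1 h1.symm
  have h4 := toReal_eq_sum_repr e (e.equivFun.symm x)
  simp only [← e.equivFun_apply, LinearEquiv.apply_symm_apply] at h4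
  rw [h3] at h4
  have h5 : e.equivFun.symm x = 0 := Subtype.ext (toReal_injective k (h4.trans (map_zero _).symm))
  exact (LinearEquiv.map_eq_zero_iff _).1 h5

lemma toReal_cellBoundary (b : cell C (k + 1)) :
    toReal C k (cellBoundary b) = ∑ i, (coordMatrix e i b : ℝ) • realVector e i :=
  toReal_eq_sum_repr e ⟨cellBoundary b, Submodule.subset_span ⟨b, rfl⟩⟩

lemma boundaries_eq_span (C : Set X) [CWComplex C] (k : ℕ) :
    boundaries C k = Submodule.span ℤ (Set.range (cellBoundary (C := C) (n := k))) :=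
  Finsupp.range_linearCombination ℤ

lemma realBoundaries_eq_span :
    realBoundaries C k = Submodule.span ℝ (Set.range (realVector e)) := by
  apply le_antisymm
  · rintro _ ⟨y, rfl⟩
    rw [realBoundary_apply]
    refine Submodule.sum_mem _ fun b _ => Submodule.smul_mem _ _ ?_
    rw [toReal_cellBoundary e]
    exact Submodule.sum_mem _ fun i _ => Submodule.smul_mem _ _ (Submodule.subset_span ⟨i, rfl⟩)
  · rw [Submodule.span_le]
    rintro _ ⟨i, rfl⟩
    have h : ((e i).1 : IntChain C k) ∈ boundaries C k := by
      rw [boundaries_eq_span]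
      exact (e i).2
    obtain ⟨x, hx⟩ := h
    rw [realVector, ← hx]
    have h2 := map_intChain ((toReal C k).comp (boundary C k)).toAddMonoidHom x
    simp only [LinearMap.toAddMonoidHom_coe, LinearMap.comp_apply] at h2
    rw [h2]
    refine Submodule.sum_mem _ fun b _ => Submodule.smul_mem _ _ ?_
    rw [boundary, linearCombination_single_one, ← realBoundary_cellBasis]
    exact ⟨_, rfl⟩

/-- The basis of the real boundaries given by a basis of the integral boundaries. -/
def realBasis : Module.Basis (Fin ρ) ℝ (realBoundaries C k) :=
  (Module.Basis.span (linearIndependent_realVector e)).map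
    (LinearEquiv.ofEq _ _ (realBoundaries_eq_span e).symm)

lemma coe_realBasis (i : Fin ρ) : (realBasis e i : RealChain C k) = realVector e i := by
  have h := congrArg Subtype.val (Module.Basis.span_apply (linearIndependent_realVector e) i)
  exact h

lemma boundaryLattice_eq_span :
    boundaryLattice C k = Submodule.span ℤ (Set.range (realBasis e)) := by
  apply le_antisymm
  · rintro ⟨x, hx⟩ ⟨y, hy, hyx⟩
    rw [boundaries_eq_span] at hy
    have h : (⟨x, hx⟩ : realBoundaries C k) = ∑ i, (e.repr ⟨y, hy⟩ i : ℝ) • realBasis e i := by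
      ext1
      simp only [Submodule.coe_sum, Submodule.coe_smul, coe_realBasis]
      exact hyx.symm.trans (toReal_eq_sum_repr e ⟨y, hy⟩)
    rw [h]
    refine Submodule.sum_mem _ fun i _ => ?_
    rw [Int.cast_smul_eq_zsmul]
    exact zsmul_mem (S := Submodule ℤ (realBoundaries C k))
      (Submodule.subset_span (Set.mem_range_self i)) _
  · rw [Submodule.span_le]
    rintro _ ⟨i, rfl⟩
    refine ⟨e i, ?_, (coe_realBasis e i).symm⟩
    rw [boundaries_eq_span]
    exact (e i).2

lemma gram_realBasis : gram ℝ (realBasis e) = gram ℝ (realVector e) := by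
  ext i j
  rw [gram_apply, gram_apply, ← coe_realBasis, ← coe_realBasis]
  rfl

theorem covolumeSq_eq : covolumeSq C k = ((intGram e).det : ℝ) := by
  rw [covolumeSq, covolume_sq_eq_det_gram _ (realBasis e) (boundaryLattice_eq_span e),
    gram_realBasis, det_gram_realVector]

/-- The matrix is Q D Qᵀ G: pairing the basis with the boundaries of cells gives Qᵀ G, the
resistances give D, and expanding the boundaries in the basis gives Q. The Gram factor appears
because the basis is not orthonormal. -/
lemma weightedLaplacian_realBasis [DecidableEq (cell C (k + 1))] (r : cell C (k + 1) → ℝ) (j : Fin ρ) :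
    weightedLaplacian r (realBasis e j) = ∑ i, ((coordMatrix e).map (Int.cast : ℤ → ℝ) *
      diagonal (fun b => (r b)⁻¹) * ((coordMatrix e).map (Int.cast : ℤ → ℝ))ᵀ *
        gram ℝ (realVector e)) i j • realBasis e i := by
  ext1
  have h : ((weightedLaplacian r (realBasis e j) : realBoundaries C k) : RealChain C k) =
    realBoundary C k (weightedCoboundary r (realVector e j)) := by
    rw [← coe_realBasis]
    rfl
  rw [h, realBoundary_apply]
  simp only [weightedCoboundary_apply, toReal_cellBoundary e, sum_inner, inner_smul_left,
    conj_trivial, Submodule.coe_sum, Submodule.coe_smul, coe_realBasis, Finset.smul_sum, smul_smul]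
  rw [Finset.sum_comm]
  refine Finset.sum_congr rfl fun i _ => ?_
  rw [← Finset.sum_smul]
  congr 1
  rw [Matrix.mul_assoc, mul_apply]
  refine Finset.sum_congr rfl fun b _ => ?_
  rw [mul_diagonal, mul_apply]
  simp only [map_apply, transpose_apply, gram_apply]
  ring

theorem det_weightedLaplacian [DecidableEq (cell C (k + 1))] (r : cell C (k + 1) → ℝ) :
    LinearMap.det (weightedLaplacian r) = covolumeSq C k *
      ((coordMatrix e).map (Int.cast : ℤ → ℝ) * diagonal (fun b => (r b)⁻¹) *
        ((coordMatrix e).map (Int.cast : ℤ → ℝ))ᵀ).det := by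
  rw [covolumeSq_eq e, ← det_gram_realVector, mul_comm, ← det_mul,
    ← LinearMap.det_toMatrix (realBasis e)]
  congr 1
  ext i j
  rw [LinearMap.toMatrix_apply, weightedLaplacian_realBasis e, map_sum, Finsupp.finsetSum_apply]
  simp [Finsupp.single_apply]

/-- The value is the determinant of an integer Gram matrix, and nonnegative as a square. -/
theorem exists_covolumeSq_eq (C : Set X) [CWComplex C] [CWComplex.Finite C] (k : ℕ) :
    ∃ m : ℕ, covolumeSq C k = m := by
  let e := Module.finBasis ℤ (Submodule.span ℤ (Set.range (cellBoundary (C := C) (n := k))))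
  have h := covolumeSq_eq e
  have h0 : 0 ≤ (intGram e).det := by
    have : (0 : ℝ) ≤ covolumeSq C k := sq_nonneg _
    rw [h] at this
    exact_mod_cast this
  refine ⟨(intGram e).det.toNat, ?_⟩
  rw [h]
  exact_mod_cast (Int.toNat_of_nonneg h0).symm

end Laplacian

end HigherTree

end

/-! ### Spanning trees as maximal independent sets of boundaries. -/

noncomputable section

namespace HigherTree

/-! ### Homology of cellular chains -/

lemma finrank_eq_of_addEquiv {M N : Type*} [AddCommGroup M] [AddCommGroup N] [Module ℤ M]
    [Module ℤ N] (e : M ≃+ N) : Module.finrank ℤ M = Module.finrank ℤ N :=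
  (LinearEquiv.ofBijective (intLinear e.toAddMonoidHom) e.bijective).finrank_eq

section Homology

variable {X : Type u} [TopologicalSpace X] [T2Space X] (C : Set X) [CWComplex C]
  [CWComplex.Finite C]

lemma torsionOrder_eq (n : ℕ) :
    torsionOrder C n = torsionCard (cycles C n).toAddSubgroup (boundaries C n).toAddSubgroup := by
  refine card_torsion_eq_torsionCard (boundaries_le_cycles C n)
    (Submodule.mkQ ((boundaries C n).comap (cycles C n).subtype)).toAddMonoidHom
    (Submodule.mkQ_surjective _) fun z => ?_
  exact Submodule.Quotient.mk_eq_zero _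

lemma torsionOrder_ne_zero (n : ℕ) : torsionOrder C n ≠ 0 := by
  have h : Module.Finite ℤ (Homology C n) := inferInstance
  have : AddGroup.FG (Homology C n) := Module.Finite.iff_addGroup_fg.1 h
  exact card_torsion_ne_zero (Homology C n)

lemma betti_add_finrank (n : ℕ) :
    betti C n + Module.finrank ℤ (boundaries C n) = Module.finrank ℤ (cycles C n) := by
  rw [betti, ← Submodule.finrank_quotient_add_finrank
    ((boundaries C n).comap (cycles C n).subtype)]
  congr 1
  exact (Submodule.comapSubtypeEquivOfLe (boundaries_le_cycles C n)).finrank_eq.symm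

end Homology

/-! ### Subcomplexes containing the codimension one skeleton -/

section Cells

variable {X : Type u} [TopologicalSpace X] {C : Set X} [CWComplex C]

lemma subcomplex_eq_of_I_eq {T T' : Subcomplex C} (h : T.I = T'.I) : T = T' := by
  apply SetLike.coe_injective
  rw [← CWComplex.Subcomplex.union (E := T), ← CWComplex.Subcomplex.union (E := T'), h]

variable [CWComplex.Finite C]

/-- The `n`-cells of a subcomplex. -/
def cellFinset (T : Subcomplex C) (n : ℕ) : Finset (cell C n) := (Set.toFinite (T.I n)).toFinset

lemma mem_cellFinset {T : Subcomplex C} {n : ℕ} {b : cell C n} :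
    b ∈ cellFinset T n ↔ b ∈ T.I n := Set.Finite.mem_toFinset _

end Cells

section Trees

variable {X : Type u} [TopologicalSpace X] [T2Space X] {C : Set X} [CWComplex C]

lemma mem_of_skeleton_subset {T : Subcomplex C} {k n : ℕ}
    (hT : (skeleton C (k : ℕ∞) : Set X) ⊆ T) (hn : n ≤ k) (i : cell C n) : i ∈ T.I n := by
  by_contra hi
  have h1 : openCell n i ⊆ (T : Set X) := ((openCell_subset_skeleton n i).trans
    (skeleton_mono (by exact_mod_cast hn))).trans hT
  have h2 := CWComplex.Subcomplex.disjoint_openCell_subcomplex_of_not_mem T hi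
  obtain ⟨x, hx⟩ := RelCWComplex.openCell_nonempty n i
  exact h2.notMem_of_mem_left hx (h1 hx)

lemma subcomplex_eq_of_top {k : ℕ} (hdim : ∀ n, k + 1 < n → IsEmpty (cell C n))
    {T T' : Subcomplex C} (hT : (skeleton C (k : ℕ∞) : Set X) ⊆ T)
    (hT' : (skeleton C (k : ℕ∞) : Set X) ⊆ T') (h : T.I (k + 1) = T'.I (k + 1)) : T = T' := by
  refine subcomplex_eq_of_I_eq (funext fun n => ?_)
  rcases lt_trichotomy n (k + 1) with hn | rfl | hn
  · ext i
    exact ⟨fun _ => mem_of_skeleton_subset hT' (by omega) i,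
      fun _ => mem_of_skeleton_subset hT (by omega) i⟩
  · exact h
  · have := hdim n hn
    exact Subsingleton.elim _ _

/-- The subcomplex consisting of the `k`-skeleton and a set of `(k + 1)`-cells. -/
lemma exists_subcomplex (k : ℕ) (S : Set (cell C (k + 1))) :
    ∃ T : Subcomplex C, (skeleton C (k : ℕ∞) : Set X) ⊆ T ∧ T.I (k + 1) = S := by
  let I : ∀ n, Set (cell C n) := fun n => {i | n ≤ k ∨ ∃ h : n = k + 1, h ▸ i ∈ S}
  have hI : I (k + 1) = S := by
    ext i
    constructor
    · rintro (h | ⟨h, hi⟩)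
      · omega
      · exact hi
    · intro hi
      exact Or.inr ⟨rfl, hi⟩
  have hsk : (skeleton C (k : ℕ∞) : Set X) ⊆ ⋃ (n : ℕ) (j : I n), openCell (C := C) n j := by
    intro x hx
    obtain ⟨m, hm, j, hj⟩ := CWComplex.mem_skeleton_iff.1 hx
    exact Set.mem_iUnion.2 ⟨m, Set.mem_iUnion.2 ⟨⟨j, Or.inl (by exact_mod_cast hm)⟩, hj⟩⟩
  suffices hcl : ∀ (n : ℕ) (i : I n), closedCell (C := C) n i ⊆
      ⋃ (n : ℕ) (j : I n), openCell (C := C) n j from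
    ⟨CWComplex.Subcomplex.mk' C _ I hcl rfl, hsk, hI⟩
  rintro n ⟨i, hi⟩
  -- The frontier of a cell of dimension at most k + 1 lies in the k-skeleton, so any set of top
  -- cells may be added to it.
  rw [← cellFrontier_union_openCell_eq_closedCell]
  refine Set.union_subset ?_ fun x hx => Set.mem_iUnion.2 ⟨n, Set.mem_iUnion.2 ⟨⟨i, hi⟩, hx⟩⟩
  have hn : n ≤ k + 1 := by
    rcases hi with h | ⟨h, -⟩ <;> omega
  refine ((cellFrontier_subset_skeletonLT n i).trans (skeletonLT_mono ?_)).trans hsk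
  exact_mod_cast hn

variable (T : Subcomplex C)

/-- The inclusion of the chains of a subcomplex. -/
def subChain (n : ℕ) : IntChain (T : Set X) n →ₗ[ℤ] IntChain C n :=
  Finsupp.lmapDomain ℤ ℤ (subCell T n)

lemma subChain_injective (n : ℕ) : Function.Injective (subChain T n) :=
  Finsupp.mapDomain_injective (subCell_injective T n)

variable {T} {k : ℕ}

lemma subChain_surjective (hT : (skeleton C (k : ℕ∞) : Set X) ⊆ T) :
    Function.Surjective (subChain T k) :=
  Finsupp.mapDomain_surjective fun i => ⟨⟨i, mem_of_skeleton_subset hT le_rfl i⟩, rfl⟩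

variable [CWComplex.Finite C] (T)

lemma boundary_subChain (n : ℕ) (x : IntChain (T : Set X) (n + 1)) :
    boundary C n (subChain T (n + 1) x) = subChain T n (boundary (T : Set X) n x) :=
  boundary_mapDomain T x

lemma subChain_cellBoundary (n : ℕ) (b : cell (T : Set X) (n + 1)) :
    subChain T n (cellBoundary b) = cellBoundary (subCell T (n + 1) b) := by
  have h := boundary_subChain T n (Finsupp.single b 1)
  rw [subChain, Finsupp.lmapDomain_apply, Finsupp.mapDomain_single, boundary, boundary,
    linearCombination_single_one, linearCombination_single_one] at h
  exact h.symm

lemma map_boundaries (n : ℕ) : (boundaries (T : Set X) n).map (subChain T n) =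
    Submodule.span ℤ (cellBoundary '' (cellFinset T (n + 1) : Set (cell C (n + 1)))) := by
  rw [boundaries_eq_span, Submodule.map_span]
  congr 1
  ext x
  constructor
  · rintro ⟨_, ⟨b, rfl⟩, rfl⟩
    exact ⟨subCell T (n + 1) b, mem_cellFinset.2 b.2, (subChain_cellBoundary T n b).symm⟩
  · rintro ⟨b, hb, rfl⟩
    exact ⟨_, ⟨⟨b, mem_cellFinset.1 hb⟩, rfl⟩, subChain_cellBoundary T n _⟩

variable {T}

/-- The subcomplex has all the k-cells, and inclusion of chains is injective and commutes with the
boundary; so only the boundaries, not the cycles, depend on `T`. -/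
lemma map_cycles (hT : (skeleton C (k : ℕ∞) : Set X) ⊆ T) :
    (cycles (T : Set X) k).map (subChain T k) = cycles C k := by
  ext x
  obtain ⟨y, rfl⟩ := subChain_surjective hT x
  rw [← Submodule.mem_comap, Submodule.comap_map_eq_of_injective (subChain_injective T k)]
  cases k with
  | zero => exact ⟨fun _ => trivial, fun _ => trivial⟩
  | succ n =>
    rw [cycles, cycles, LinearMap.mem_ker, LinearMap.mem_ker, boundary_subChain,
      (map_eq_zero_iff _ (subChain_injective T n))]

lemma torsionOrder_subcomplex (hT : (skeleton C (k : ℕ∞) : Set X) ⊆ T) :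
    torsionOrder (T : Set X) k = torsionCard (cycles C k).toAddSubgroup
      (Submodule.span ℤ (cellBoundary '' (cellFinset T (k + 1) : Set (cell C (k + 1))))).toAddSubgroup := by
  rw [torsionOrder_eq, ← map_cycles hT, ← map_boundaries,
    ← torsionCard_map (j := (subChain T k).toAddMonoidHom) (subChain_injective T k)]
  rfl

/-- The Betti number is the rank of the cycles minus that of the boundaries, and the cycles agree.
-/
lemma betti_subcomplex_eq_iff (hT : (skeleton C (k : ℕ∞) : Set X) ⊆ T) :
    betti (T : Set X) k = betti C k ↔
      Module.finrank ℤ (Submodule.span ℤ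
        (cellBoundary '' (cellFinset T (k + 1) : Set (cell C (k + 1))))) =
      Module.finrank ℤ (Submodule.span ℤ (Set.range (cellBoundary (C := C) (n := k)))) := by
  have h1 := betti_add_finrank (T : Set X) k
  have h2 := betti_add_finrank C k
  have h3 : Module.finrank ℤ (cycles (T : Set X) k) = Module.finrank ℤ (cycles C k) := by
    rw [← map_cycles hT]
    exact finrank_eq_of_addEquiv
      (Submodule.equivMapOfInjective _ (subChain_injective T k) _).toAddEquiv
  have h4 : betti (T : Set X) k = betti C k ↔
      Module.finrank ℤ (boundaries (T : Set X) k) = Module.finrank ℤ (boundaries C k) := by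
    omega
  rw [h4, ← map_boundaries, ← boundaries_eq_span]
  refine Eq.congr ?_ ?_
  · exact finrank_eq_of_addEquiv
      (Submodule.equivMapOfInjective _ (subChain_injective T k) _).toAddEquiv
  · exact finrank_eq_of_addEquiv (AddEquiv.refl _)

/-- Without cells in dimension k + 2 there are no boundaries to divide by: the homology is the group
of cycles, that is, of linear relations between the boundaries of the (k + 1)-cells of `T`. -/
lemma subsingleton_homology_iff [IsEmpty (cell C (k + 2))] :
    Subsingleton (Homology (T : Set X) (k + 1)) ↔
      LinearIndependent ℤ (fun b : cellFinset T (k + 1) => cellBoundary (b : cell C (k + 1))) := by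
  have h0 : boundaries (T : Set X) (k + 1) = ⊥ := by
    have : IsEmpty (cell (T : Set X) (k + 2)) := ⟨fun b => IsEmpty.false b.1⟩
    rw [boundaries_eq_span, Set.range_eq_empty, Submodule.span_empty]
  let f : cell (T : Set X) (k + 1) ≃ cellFinset T (k + 1) :=
    Equiv.subtypeEquivRight fun b => mem_cellFinset.symm
  rw [← linearIndependent_equiv f]
  have h1 : (fun b : cellFinset T (k + 1) => cellBoundary (b : cell C (k + 1))) ∘ f =
      subChain T k ∘ cellBoundary := by
    ext1 b
    exact (subChain_cellBoundary T k b).symm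
  rw [h1, (subChain T k).linearIndependent_iff (LinearMap.ker_eq_bot.2 (subChain_injective T k)),
    Submodule.Quotient.subsingleton_iff, h0, LinearIndependent, ← LinearMap.ker_eq_bot]
  change _ ↔ cycles (T : Set X) (k + 1) = ⊥
  rw [Submodule.comap_subtype_eq_top, le_bot_iff]

lemma isSpanningTree_iff [IsEmpty (cell C (k + 2))] :
    IsSpanningTree k T ↔ (skeleton C (k : ℕ∞) : Set X) ⊆ T ∧
      IsMaximalIndep (cellBoundary (C := C) (n := k)) (cellFinset T (k + 1)) := by
  constructor
  · rintro ⟨h1, h2, h3⟩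
    exact ⟨h3, subsingleton_homology_iff.1 h1, (betti_subcomplex_eq_iff h3).1 h2⟩
  · rintro ⟨h3, h1, h2⟩
    exact ⟨subsingleton_homology_iff.2 h1, (betti_subcomplex_eq_iff h3).2 h2, h3⟩

open Classical in
lemma sum_weight_spanningTrees (hdim : ∀ n, k + 1 < n → IsEmpty (cell C n))
    (r : cell C (k + 1) → ℝ) :
    ∑ T ∈ spanningTrees C k, weight r T =
      ∑ S : Finset (cell C (k + 1)) with IsMaximalIndep cellBoundary S,
        (torsionCard (cycles C k).toAddSubgroup
          (Submodule.span ℤ (cellBoundary '' (S : Set (cell C (k + 1))))).toAddSubgroup : ℝ) ^ 2 *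
          ∏ b ∈ S, (r b)⁻¹ := by
  have := hdim (k + 2) (by omega)
  have hmem : ∀ T, T ∈ spanningTrees C k ↔ (skeleton C (k : ℕ∞) : Set X) ⊆ T ∧
      IsMaximalIndep (cellBoundary (C := C) (n := k)) (cellFinset T (k + 1)) := by
    intro T
    rw [← isSpanningTree_iff]
    exact Set.Finite.mem_toFinset _
  refine Finset.sum_bij (fun T _ => cellFinset T (k + 1)) (fun T hT => ?_)
    (fun T hT T' hT' h => ?_) (fun S hS => ?_) (fun T hT => ?_)
  · exact (Finset.mem_filter_univ _).2 ((hmem T).1 hT).2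
  · refine subcomplex_eq_of_top hdim ((hmem T).1 hT).1 ((hmem T').1 hT').1 ?_
    ext b
    rw [← mem_cellFinset, h, mem_cellFinset]
  · obtain ⟨T, hT, hTS⟩ := exists_subcomplex k (S : Set (cell C (k + 1)))
    have h : cellFinset T (k + 1) = S := by
      ext b
      rw [mem_cellFinset, hTS, Finset.mem_coe]
    refine ⟨T, (hmem T).2 ⟨hT, ?_⟩, h⟩
    rw [h]
    exact (Finset.mem_filter_univ _).1 hS
  · rw [weight, torsionOrder_subcomplex ((hmem T).1 hT).1]
    rfl

end Trees

end HigherTree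

end

theorem theoremB {X : Type u} [TopologicalSpace X] [T2Space X] (C : Set X) [CWComplex C]
    [CWComplex.Finite C] (hconn : IsConnected C) (k : ℕ) (hdim : HigherTree.HasDimension C (k + 1))
    (r : cell C (k + 1) → ℝ) (hr : ∀ b, 0 < r b) :
    (∃ m : ℕ, HigherTree.covolumeSq C k = m) ∧
      LinearMap.det (HigherTree.weightedLaplacian r) =
        HigherTree.covolumeSq C k / (HigherTree.torsionOrder C k : ℝ) ^ 2 *
          ∑ T ∈ HigherTree.spanningTrees C k, HigherTree.weight r T := by
  classical
  refine ⟨HigherTree.exists_covolumeSq_eq C k, ?_⟩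
  -- `Nat.card` is zero on infinite types, so finiteness of the torsion is what permits the division
  -- by θ_X².
  have h0 : (HigherTree.torsionOrder C k : ℝ) ≠ 0 := by
    exact_mod_cast HigherTree.torsionOrder_ne_zero C k
  have hZ := HigherTree.boundaries_le_cycles C k
  rw [HigherTree.boundaries_eq_span] at hZ
  let e := Module.finBasis ℤ
    (Submodule.span ℤ (Set.range (HigherTree.cellBoundary (C := C) (n := k))))
  have h1 := HigherTree.sq_torsionCard_mul_det e (HigherTree.cycles C k).toAddSubgroup hZ
    fun b => (r b)⁻¹
  have h2 := HigherTree.torsionOrder_eq C k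
  rw [HigherTree.boundaries_eq_span] at h2
  rw [← h2] at h1
  rw [HigherTree.sum_weight_spanningTrees hdim.2 r, ← h1, HigherTree.det_weightedLaplacian e]
  field_simp
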